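/- Setting. Let $\mathcal S$ and $\mathcal B$ be finite sets of seller and buyer operators, and fix a seller $s\in\mathcal S$ with a finite set $\mathcal L_s$ of licensed sub-bands. Sub-band $l\in\mathcal L_s$ is used by the operators in a set $Q_l$ with $s\in Q_l$ and $Q_l\setminus\{s\}\subseteq\mathcal B$. For each operator $k$, the base stations form a homogeneous Poisson point process in $\mathbb R^2$ with intensity $\lambda_k>0$; the users of $s$ form a homogeneous Poisson point process $\Psi_s$ in $\mathbb R^2$ with intensity $\mu_s>0$. Let $\alpha>2$ be the path loss exponent, $\sigma^2\ge 0$ the noise power, $P^{\rm S}>0$ the transmit power of the base stations of sellers, and $\zeta_s>0$ the interference threshold. A typical user of $s$ is located at the origin. Denote by $x_f^{k}$ the distance from the origin to base station $f$ of operator $k$, and by $h_{f,l}^{k}$ the corresponding channel gain on sub-band $l$, which is exponential with mean $1$. The user is served by the base station $0$ of $s$ that provides the maximum average received power. The transmit power $P_{f,l}^{b}$ on sub-band $l$ of base station $f$ of buyer $b\in Q_l\setminus\{s\}$ has the law of $$P_l^{\rm B}=\zeta_s/H_l,\qquad H_l=\max_{y_i\in\Psi_s} h_{i,l}\,\|{\rm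 x}^{\rm B}-y_i\|^{-\alpha},$$ where ${\rm x}^{\rm B}\in\mathbb R^2$ is an arbitrary location and the $h_{i,l}$ are independent exponentials of mean $1$, independent of $\Psi_s$. On each sub-band $l$, the base station processes of the operators in $Q_l$, the gains $h^k_{f,l}$ ($k\in Q_l$) and the powers $P_{f,l}^b$ ($b\in Q_l\setminus\{s\}$) are all mutually independent. The SINR of the typical user on sub-band $l$ is $$\gamma_l=\frac{P^{\rm S}h_{0,l}^{s}(x_0^{s})^{-\alpha}}{\sum_{f\ne 0}P^{\rm S}h_{f,l}^{s}(x_f^{s})^{-\alpha}+\sum_{b\in Q_l\setminus\{s\}}\sum_{f}P_{f,l}^{b}h_{f,l}^{b}(x_f^{b})^{-\alpha}+\sigma^2}.$$ Theorem. Let $\mathbb P[\,\cdot\,]$ and $\mathbb E_{\gamma_l}$ refer to the conditional law of $\gamma_l$ given the buyers' transmit powers on sub-band $l$, and let $\mathbb E_{P_l}$ be the expectation over these powers. Then $\mathbb E[(P_l^{\rm B})^{2/\alpha}]$ and $\mathbb E[\ln(1+\gamma_l)]$ are finite for every $l\in\mathcal L_s$, the integrals below converge, and the average rate $\mathcal R_s^{\rm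 S}=\sum_{l\in\mathcal L_s}\mathbb E_{P_l}\big[\mathbb E_{\gamma_l}[\ln(1+\gamma_l)]\big]$ of the typical user of $s$ satisfies $$\mathcal R_s^{\rm S}=\sum_{l\in\mathcal L_s}\mathbb E_{P_l}\Big[\int_0^\infty\mathbb P[\ln(1+\gamma_l)>t]\,{\rm d}t\Big]$$ $$=\sum_{l\in\mathcal L_s}\int_0^\infty\!\!\int_0^\infty \pi\lambda_s (P^{\rm S})^{2/\alpha}\exp\!\big(-\beta_t\sigma^2z^{\alpha/2}\big)\exp\!\big(-\pi\lambda_s (P^{\rm S})^{2/\alpha}z\big)\,\mathcal L_{l,\beta_t}\big(\beta_t z^{\alpha/2}\big)\,{\rm d}z\,{\rm d}t,$$ where $\beta_t=e^t-1$ and $$\mathcal L_{l,\beta}(\kappa)=\exp\!\big(-\pi\lambda_s (P^{\rm S})^{2/\alpha}\kappa^{2/\alpha}\rho(\alpha,\beta)\big)\exp\!\Big(-\pi\Big(\sum_{b\in Q_l\setminus\{s\}}\lambda_b\Big)\mathbb E\big[(P_l^{\rm B})^{2/\alpha}\big]\kappa^{2/\alpha}\rho(\alpha,\infty)\Big),$$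 $$\rho(\alpha,\beta)=\int_{\beta^{-2/\alpha}}^\infty\frac{{\rm d}\nu}{1+\nu^{\alpha/2}},\qquad \rho(\alpha,\infty)=\int_0^\infty\frac{{\rm d}\nu}{1+\nu^{\alpha/2}}.$$ -/

import Mathlib

open MeasureTheory ProbabilityTheory Set
open scoped ENNReal

noncomputable section

namespace SpectrumSharing

/-- The plane with its Euclidean norm. -/
abbrev Plane : Type := EuclideanSpace ℝ (Fin 2)

/-- The number of points of the enumerated point configuration `X` in the set `B`. -/
def pointCount {Ω E : Type*} (X : ℕ → Ω → E) (B : Set E) (ω : Ω) : ℝ≥0∞ :=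
  ∑' n, B.indicator (fun _ => (1 : ℝ≥0∞)) (X n ω)

/-- `X` enumerates the points of a Poisson point process with intensity measure `Λ`:
the number of points in a set of finite measure `Λ B` is Poisson with mean `Λ B`, and the numbers
of points in disjoint sets are independent. -/
structure IsPoissonProcess {Ω E : Type*} [MeasurableSpace Ω] [MeasurableSpace E]
    (X : ℕ → Ω → E) (Λ : Measure E) (Pr : Measure Ω) : Prop where
  measurable : ∀ n, Measurable (X n)
  count_law : ∀ B : Set E, MeasurableSet B → Λ B ≠ ∞ → ∀ k : ℕ,
    Pr {ω | pointCount X B ω = (k : ℝ≥0∞)} =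
      ENNReal.ofReal (Real.exp (-(Λ B).toReal) * (Λ B).toReal ^ k / (k.factorial : ℝ))
  count_indep : ∀ (m : ℕ) (B : Fin m → Set E), (∀ i, MeasurableSet (B i)) →
    Pairwise (fun i j => Disjoint (B i) (B j)) →
    iIndepFun (fun i => pointCount X (B i)) Pr

/-- A homogeneous Poisson point process in the plane with intensity `c`. -/
def IsHomogeneousPPP {Ω : Type*} [MeasurableSpace Ω]
    (X : ℕ → Ω → Plane) (c : ℝ) (Pr : Measure Ω) : Prop :=
  IsPoissonProcess X (ENNReal.ofReal c • (volume : Measure Plane)) Pr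

/-- The deterministic parameters of the spectrum sharing system. -/
structure Network (O : Type*) [DecidableEq O] where
  /-- the set of seller operators -/
  sellers : Finset O
  /-- the set of buyer operators -/
  buyers : Finset O
  /-- the number of licensed sub-bands of a seller -/
  numBands : O → ℕ
  /-- the operators sharing a sub-band -/
  group : (s : O) → Fin (numBands s) → Finset O
  seller_mem_group : ∀ s ∈ sellers, ∀ l, s ∈ group s l
  group_subset : ∀ s ∈ sellers, ∀ l, (group s l).erase s ⊆ buyers
  /-- base station intensities -/
  bsIntensity : O → ℝ
  /-- user intensities -/
  ueIntensity : O → ℝ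
  bsIntensity_pos : ∀ k ∈ sellers ∪ buyers, 0 < bsIntensity k
  ueIntensity_pos : ∀ k ∈ sellers ∪ buyers, 0 < ueIntensity k
  /-- path loss exponent -/
  α : ℝ
  two_lt_α : 2 < α
  /-- transmit power of the base stations of sellers -/
  PS : ℝ
  PS_pos : 0 < PS
  /-- maximum interference thresholds -/
  ζ : O → ℝ
  ζ_pos : ∀ s ∈ sellers, 0 < ζ s
  /-- the noise power is `σ ^ 2` -/
  σ : ℝ

variable {O : Type*} [DecidableEq O]

/-- The random quantities that enter the downlink of a typical user, located at the origin, of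
seller `s`. -/
structure Downlink (N : Network O) (s : O) (Ω : Type*) where
  /-- `bs k f` is the location of base station `f` of operator `k` -/
  bs : O → ℕ → Ω → Plane
  /-- `gain l k f` is the channel gain, on sub-band `l`, from base station `f` of operator `k` to
  the typical user -/
  gain : Fin (N.numBands s) → O → ℕ → Ω → ℝ
  /-- `buyerPower l b f` is the transmit power, on sub-band `l`, of base station `f` of buyer `b` -/
  buyerPower : Fin (N.numBands s) → O → ℕ → Ω → ℝ
  /-- locations of the users of seller `s` -/
  ue : ℕ → Ω → Plane
  /-- location of an arbitrary buyer base station -/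
  buyerSite : Plane
  /-- `ueGain l i` is the channel gain, on sub-band `l`, between user `i` and the buyer base
  station at `buyerSite` -/
  ueGain : Fin (N.numBands s) → ℕ → Ω → ℝ

namespace Downlink

variable {N : Network O} {s : O} {Ω : Type*}

/-- The largest interference channel gain between the buyer base station at `buyerSite` and the
users of seller `s`. -/
def largestGain (D : Downlink N s Ω) (l : Fin (N.numBands s)) (ω : Ω) : ℝ :=
  ⨆ i, D.ueGain l i ω * ‖D.buyerSite - D.ue i ω‖ ^ (-N.α)

/-- The maximal power that keeps the interference at all users of seller `s` below `ζ s`. -/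
def allowedPower (D : Downlink N s Ω) (l : Fin (N.numBands s)) (ω : Ω) : ℝ :=
  N.ζ s / D.largestGain l ω

/-- The transmit power on sub-band `l` of base station `f` of operator `k`. -/
def txPower (D : Downlink N s Ω) (l : Fin (N.numBands s)) (k : O) (f : ℕ) (ω : Ω) : ℝ :=
  if k = s then N.PS else D.buyerPower l k f ω

/-- The base station of seller `s` that serves the typical user: the one providing the maximum
average received power (almost surely there is exactly one). -/
def serving (D : Downlink N s Ω) (ω : Ω) : ℕ :=
  sInf {f : ℕ | ∀ j, N.PS * ‖D.bs s j ω‖ ^ (-N.α) ≤ N.PS * ‖D.bs s f ω‖ ^ (-N.α)}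

/-- The interference at the typical user on sub-band `l`. -/
def interference (D : Downlink N s Ω) (l : Fin (N.numBands s)) (ω : Ω) : ℝ :=
  (∑' f, if f = D.serving ω then 0 else N.PS * D.gain l s f ω * ‖D.bs s f ω‖ ^ (-N.α)) +
    ∑ b ∈ (N.group s l).erase s,
      ∑' f, D.buyerPower l b f ω * D.gain l b f ω * ‖D.bs b f ω‖ ^ (-N.α)

/-- The SINR at the typical user on sub-band `l`. -/
def sinr (D : Downlink N s Ω) (l : Fin (N.numBands s)) (ω : Ω) : ℝ :=
  N.PS * D.gain l s (D.serving ω) ω * ‖D.bs s (D.serving ω) ω‖ ^ (-N.α) /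
    (D.interference l ω + N.σ ^ 2)

/-- The transmit powers, on sub-band `l`, of all base stations of the buyers sharing it. -/
def buyerPowers (D : Downlink N s Ω) (l : Fin (N.numBands s)) (ω : Ω) :
    {b // b ∈ (N.group s l).erase s} → ℕ → ℝ :=
  fun b f => D.buyerPower l b f ω

/-- The probabilistic assumptions. Sub-band by sub-band, the networks of the sharing operators are
independent, each one being a homogeneous Poisson process of base stations that carry independent
marks: Rayleigh fading gains and, for buyers, transmit powers distributed as the allowed power
`ζ s / H`, where `H` is the largest gain towards a Poisson process of users. Nothing is assumed
about the joint law of different sub-bands. -/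
structure IsModel [MeasurableSpace Ω] (D : Downlink N s Ω) (Pr : Measure Ω) : Prop where
  ue_ppp : IsHomogeneousPPP D.ue (N.ueIntensity s) Pr
  ueGain_law : ∀ l i, HasLaw (D.ueGain l i) (expMeasure 1) Pr
  ueGain_indep : ∀ l, iIndepFun (fun i => D.ueGain l i) Pr
  ue_indep_ueGain : ∀ l, IndepFun (fun ω i => D.ue i ω) (fun ω i => D.ueGain l i ω) Pr
  bs_ppp : ∀ k ∈ N.sellers ∪ N.buyers, IsHomogeneousPPP (D.bs k) (N.bsIntensity k) Pr
  gain_law : ∀ l, ∀ k ∈ N.group s l, ∀ f, HasLaw (D.gain l k f) (expMeasure 1) Pr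
  power_law : ∀ l, ∀ b ∈ (N.group s l).erase s, ∀ f,
    IdentDistrib (D.buyerPower l b f) (D.allowedPower l) Pr Pr
  operators_indep : ∀ l, iIndepFun (fun (k : {k // k ∈ N.group s l}) ω =>
    ((fun f => D.bs k f ω), (fun f => (D.gain l k f ω, D.txPower l k f ω)))) Pr
  bs_indep_marks : ∀ l, ∀ k ∈ N.group s l,
    IndepFun (fun ω f => D.bs k f ω) (fun ω f => (D.gain l k f ω, D.txPower l k f ω)) Pr
  marks_indep : ∀ l, ∀ k ∈ N.group s l,
    iIndepFun (fun f ω => (D.gain l k f ω, D.txPower l k f ω)) Pr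
  gain_indep_power : ∀ l, ∀ k ∈ N.group s l, ∀ f,
    IndepFun (D.gain l k f) (D.txPower l k f) Pr

variable [MeasurableSpace Ω]

/-- The conditional law of the SINR on sub-band `l` given the buyers' transmit powers. -/
def sinrLaw (D : Downlink N s Ω) (Pr : Measure Ω) [IsFiniteMeasure Pr]
    (l : Fin (N.numBands s)) : Kernel ({b // b ∈ (N.group s l).erase s} → ℕ → ℝ) ℝ :=
  condDistrib (D.sinr l) (D.buyerPowers l) Pr

/-- The average rate of the typical user: the sum over the sub-bands of
`E_P [E_γ [ln (1 + γ)]]`. -/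
def averageRate (D : Downlink N s Ω) (Pr : Measure Ω) [IsFiniteMeasure Pr] : ℝ :=
  ∑ l, ∫ p, (∫ γ, Real.log (1 + γ) ∂(D.sinrLaw Pr l p)) ∂(Pr.map (D.buyerPowers l))

/-- The expectation `E [P ^ (2 / α)]` of a buyer's transmit power `P` on sub-band `l`. -/
def powerMoment (D : Downlink N s Ω) (Pr : Measure Ω) (l : Fin (N.numBands s)) : ℝ :=
  ∫ ω, D.allowedPower l ω ^ (2 / N.α) ∂Pr

end Downlink

/-- `ρ(α, β)` for finite `β`. -/
def rho (α β : ℝ) : ℝ := ∫ ν in Ioi (β ^ (-(2 / α))), 1 / (1 + ν ^ (α / 2))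

/-- `ρ(α, ∞)`. -/
def rhoInf (α : ℝ) : ℝ := ∫ ν in Ioi (0 : ℝ), 1 / (1 + ν ^ (α / 2))

/-- The Laplace transform expression of the interference at a typical user of seller `s` on
sub-band `l`, at the point `κ` and for the threshold `β`; `M` is the moment `E [P ^ (2 / α)]`. -/
def laplaceInterference (N : Network O) (s : O) (l : Fin (N.numBands s)) (M β κ : ℝ) : ℝ :=
  Real.exp (-(Real.pi * N.bsIntensity s * N.PS ^ (2 / N.α) * κ ^ (2 / N.α) * rho N.α β)) *
  Real.exp (-(Real.pi * (∑ b ∈ (N.group s l).erase s, N.bsIntensity b) * M * κ ^ (2 / N.α) *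
    rhoInf N.α))

/-- The integrand, in `z`, of the coverage probability at threshold `β`. -/
def coverageIntegrand (N : Network O) (s : O) (l : Fin (N.numBands s)) (M β z : ℝ) : ℝ :=
  Real.pi * N.bsIntensity s * N.PS ^ (2 / N.α) *
    Real.exp (-(β * N.σ ^ 2 * z ^ (N.α / 2))) *
    Real.exp (-(Real.pi * N.bsIntensity s * N.PS ^ (2 / N.α) * z)) *
    laplaceInterference N s l M β (β * z ^ (N.α / 2))

end SpectrumSharing

end

/-! The mean of a nonnegative variable is the integral of its tail, so the rate on a sub-band is the
integral over t of the coverage probability at the threshold β = e^t - 1, computed in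
`Downlink.IsModel.measure_lt_sinr`. The gain of the serving station is exponential. Hence, given all
other variables, the SINR exceeds β with probability e^{-κ(I + σ²)}, where I is the interference, κ
= β u^{α/2} / P and u is the squared distance to the serving station. Coverage thus becomes a
Laplace transform of I, and independence splits it into noise, buyers and the seller's own other
stations.

Both interference factors come from the Laplace functional of a Poisson process
(`IsPoissonProcess.marked_laplace_functional`). Squared distances form a homogeneous Poisson process
on the half-line with intensity πλ (`IsHomogeneousPPP.sq_norm`), so all integrals are
one-dimensional. For a buyer, scaling the distance integral extracts E[P^{2/α}] and ρ(α, ∞)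
(`lintegral_expNeg_shotNoise`). For the seller, u is exponential with rate πλ and, given u, the
remaining points form a Poisson process beyond u (`IsHalfLinePPP.lintegral_iInf_mul_expNeg_tsum`);
the cutoff at u produces ρ(α, β). The substitution u = P^{2/α} z gives the stated integrand.

Two finiteness claims remain. A large allowed power forces a large disc to be free of users with
gain above one, so P^{2/α} has an exponential tail (`lintegral_div_iSup_rpow_ne_top`). The double
integral converges because coverage is at most one for small t and of order β^{-2/α}, hence
e^{-2t/α}, for large t. The conditional law of the SINR given the powers is never computed:
disintegrating the joint law gives the tower property, and the tail formula applies under almost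
every conditional law.

Exponentials are taken on [0, ∞] with e^{-∞} = 0. Sums then need no prior summability, void
probabilities are special cases of Laplace functionals, and almost sure finiteness of the
interference is deduced from its transform. -/

namespace SpectrumSharing
open Filter Topology

/-! ### The exponential and the logarithm on [0, ∞] -/

/-- The function `x ↦ exp (-x)` on the extended nonnegative reals. -/
noncomputable def expNeg (x : ℝ≥0∞) : ℝ≥0∞ := EReal.exp (-(x : EReal))

/-- The function `y ↦ -log y`, inverse to `expNeg` on the unit interval. -/
noncomputable def negLog (y : ℝ≥0∞) : ℝ≥0∞ := (-(ENNReal.log y)).toENNReal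

@[simp] lemma expNeg_zero : expNeg 0 = 1 := by simp [expNeg]

@[simp] lemma expNeg_top : expNeg ∞ = 0 := by simp [expNeg]

lemma expNeg_ofReal {r : ℝ} (hr : 0 ≤ r) :
    expNeg (ENNReal.ofReal r) = ENNReal.ofReal (Real.exp (-r)) := by
  rw [expNeg, EReal.coe_ennreal_ofReal, max_eq_left hr, ← EReal.coe_neg, EReal.exp_coe]

lemma expNeg_add (x y : ℝ≥0∞) : expNeg (x + y) = expNeg x * expNeg y := by
  rw [expNeg, expNeg, expNeg, ← EReal.exp_add, EReal.coe_ennreal_add, EReal.neg_add,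
    sub_eq_add_neg]
  · left; exact EReal.coe_ennreal_ne_bot _
  · right; exact EReal.coe_ennreal_ne_bot _

lemma continuous_expNeg : Continuous expNeg :=
  ENNReal.continuous_exp.comp (continuous_neg.comp continuous_coe_ennreal_ereal)

@[fun_prop] lemma measurable_expNeg : Measurable expNeg := continuous_expNeg.measurable

@[fun_prop] lemma measurable_negLog : Measurable negLog :=
  measurable_ereal_toENNReal.comp ((continuous_neg.measurable).comp ENNReal.measurable_log)

lemma expNeg_antitone : Antitone expNeg := fun x y h => by
  simp only [expNeg, EReal.exp_le_exp_iff, EReal.neg_le_neg_iff, EReal.coe_ennreal_le_coe_ennreal_iff]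
  exact h

lemma expNeg_le_one (x : ℝ≥0∞) : expNeg x ≤ 1 := by
  simpa using expNeg_antitone (zero_le (a := x))

lemma expNeg_ne_top (x : ℝ≥0∞) : expNeg x ≠ ∞ := ne_top_of_le_ne_top ENNReal.one_ne_top (expNeg_le_one x)

lemma expNeg_eq_zero_iff {x : ℝ≥0∞} : expNeg x = 0 ↔ x = ∞ := by
  simp [expNeg]

lemma expNeg_negLog {y : ℝ≥0∞} (hy : y ≤ 1) : expNeg (negLog y) = y := by
  rw [expNeg, negLog, EReal.coe_toENNReal, neg_neg, ENNReal.exp_log]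
  simpa using hy

lemma expNeg_sum {ι : Type*} (s : Finset ι) (f : ι → ℝ≥0∞) :
    expNeg (∑ i ∈ s, f i) = ∏ i ∈ s, expNeg (f i) := by
  classical
  induction s using Finset.induction_on with
  | empty => simp
  | insert a s ha ih => rw [Finset.sum_insert ha, Finset.prod_insert ha, expNeg_add, ih]

lemma expNeg_mul_natCast (a : ℝ≥0∞) (k : ℕ) : expNeg (a * k) = expNeg a ^ k := by
  have := expNeg_sum (Finset.range k) (fun _ => a)
  simpa [mul_comm] using this

/-- Replaces infinite products: a product of exponentials over all indices is read as the
exponential of a sum, which always exists in [0, ∞]. -/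
lemma tendsto_expNeg_sum_range (f : ℕ → ℝ≥0∞) :
    Tendsto (fun n => ∏ i ∈ Finset.range n, expNeg (f i)) atTop (𝓝 (expNeg (∑' i, f i))) := by
  simp_rw [← expNeg_sum]
  exact (continuous_expNeg.tendsto _).comp (ENNReal.tendsto_nat_tsum f)

/-- The generating function of the Poisson law. Taking `y = 1` gives total mass one, and `y =
e^{-a}` gives the Laplace transform. -/
lemma tsum_poisson_mul_pow {x : ℝ} (hx : 0 ≤ x) {y : ℝ} (hy : 0 ≤ y) :
    ∑' k : ℕ, ENNReal.ofReal (Real.exp (-x) * x ^ k / (k.factorial : ℝ)) * ENNReal.ofReal y ^ k =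
      ENNReal.ofReal (Real.exp (-((1 - y) * x))) := by
  have h1 : ∀ k : ℕ,
      ENNReal.ofReal (Real.exp (-x) * x ^ k / (k.factorial : ℝ)) * ENNReal.ofReal y ^ k =
        ENNReal.ofReal (Real.exp (-x) * ((x * y) ^ k / (k.factorial : ℝ))) := fun k => by
    rw [← ENNReal.ofReal_pow hy, ← ENNReal.ofReal_mul (by positivity)]
    congr 1
    rw [mul_pow]; ring
  have hs : HasSum (fun k : ℕ => Real.exp (-x) * ((x * y) ^ k / (k.factorial : ℝ)))
      (Real.exp (-x) * Real.exp (x * y)) := by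
    refine HasSum.mul_left _ ?_
    rw [Real.exp_eq_exp_ℝ]
    exact NormedSpace.expSeries_div_hasSum_exp (x * y)
  simp_rw [h1]
  rw [← ENNReal.ofReal_tsum_of_nonneg (fun k => by positivity) hs.summable, hs.tsum_eq,
    ← Real.exp_add]
  congr 2; ring

/-! ### The Laplace functional of a Poisson process -/

section Poisson

variable {Ω E : Type*} [MeasurableSpace Ω] [MeasurableSpace E]

lemma measurable_pointCount {X : ℕ → Ω → E} (hX : ∀ n, Measurable (X n)) {B : Set E}
    (hB : MeasurableSet B) : Measurable (pointCount X B) := by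
  refine Measurable.tsum fun n => ?_
  exact (measurable_const.indicator hB).comp (hX n)

namespace IsPoissonProcess

variable {X : ℕ → Ω → E} {Λ : Measure E} {Pr : Measure Ω}

/-- The number of points in a set of finite intensity is almost surely a natural number. -/
lemma ae_exists_natCast [IsProbabilityMeasure Pr] (hX : IsPoissonProcess X Λ Pr) {B : Set E}
    (hB : MeasurableSet B) (hΛ : Λ B ≠ ∞) : ∀ᵐ ω ∂Pr, ∃ k : ℕ, pointCount X B ω = k := by
  have hm := measurable_pointCount hX.measurable hB
  have hms : ∀ k : ℕ, MeasurableSet {ω | pointCount X B ω = (k : ℝ≥0∞)} := fun k =>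
    hm (measurableSet_singleton _)
  have hset : {ω | ∃ k : ℕ, pointCount X B ω = k} =
      ⋃ k : ℕ, {ω | pointCount X B ω = (k : ℝ≥0∞)} := by
    ext; simp
  change {ω | ∃ k : ℕ, pointCount X B ω = k} ∈ ae Pr
  rw [mem_ae_iff_prob_eq_one (hset ▸ MeasurableSet.iUnion hms), hset, measure_iUnion _ hms]
  · have := tsum_poisson_mul_pow (ENNReal.toReal_nonneg (a := Λ B)) zero_le_one
    simp only [ENNReal.ofReal_one, one_pow, mul_one, sub_self, zero_mul, neg_zero,
      Real.exp_zero] at this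
    rw [← this]
    exact tsum_congr fun k => hX.count_law B hB hΛ k
  · intro i j hij
    refine Set.disjoint_left.2 fun ω hi hj => hij ?_
    simp only [mem_ofPred_eq] at hi hj
    exact_mod_cast hi.symm.trans hj

/-- The Laplace transform of the number of points in a set of finite intensity. -/
lemma lintegral_expNeg_mul_pointCount [IsProbabilityMeasure Pr] (hX : IsPoissonProcess X Λ Pr)
    {B : Set E} (hB : MeasurableSet B) (hΛ : Λ B ≠ ∞) (a : ℝ≥0∞) :
    ∫⁻ ω, expNeg (a * pointCount X B ω) ∂Pr = expNeg ((1 - expNeg a) * Λ B) := by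
  have hm := measurable_pointCount hX.measurable hB
  have hms : ∀ k : ℕ, MeasurableSet {ω | pointCount X B ω = (k : ℝ≥0∞)} := fun k =>
    hm (measurableSet_singleton _)
  have huniv : (univ : Set Ω) =ᵐ[Pr] ⋃ k : ℕ, {ω | pointCount X B ω = (k : ℝ≥0∞)} := by
    filter_upwards [hX.ae_exists_natCast hB hΛ] with ω hω
    simp only [eq_iff_iff]
    exact ⟨fun _ => mem_iUnion.2 hω, fun _ => trivial⟩
  -- Split along the values `k` of the count, where the integrand is the constant `(e^{-a})^k`.
  rw [← setLIntegral_univ, setLIntegral_congr huniv, lintegral_iUnion hms]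
  · have hk : ∀ k : ℕ, ∫⁻ ω in {ω | pointCount X B ω = (k : ℝ≥0∞)},
        expNeg (a * pointCount X B ω) ∂Pr =
        ENNReal.ofReal (Real.exp (-(Λ B).toReal) * (Λ B).toReal ^ k / (k.factorial : ℝ)) *
          ENNReal.ofReal (expNeg a).toReal ^ k := fun k => by
      rw [setLIntegral_congr_fun (g := fun _ => expNeg a ^ k) (hms k), setLIntegral_const,
        hX.count_law B hB hΛ k, mul_comm, ENNReal.ofReal_toReal (expNeg_ne_top _)]
      intro ω hω
      simp only [mem_ofPred_eq] at hω
      simp only [hω, expNeg_mul_natCast]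
    simp_rw [hk]
    have h1 : (expNeg a).toReal ≤ 1 := by
      simpa using ENNReal.toReal_mono ENNReal.one_ne_top (expNeg_le_one a)
    rw [tsum_poisson_mul_pow ENNReal.toReal_nonneg ENNReal.toReal_nonneg,
      ← expNeg_ofReal (mul_nonneg (by linarith) ENNReal.toReal_nonneg),
      ENNReal.ofReal_mul (by linarith), ENNReal.ofReal_toReal hΛ,
      ENNReal.ofReal_sub _ ENNReal.toReal_nonneg, ENNReal.ofReal_one,
      ENNReal.ofReal_toReal (expNeg_ne_top _)]
  · intro i j hij
    refine Set.disjoint_left.2 fun ω hi hj => hij ?_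
    simp only [mem_ofPred_eq] at hi hj
    exact_mod_cast hi.symm.trans hj

/-- Grouping the points by the value of `f` turns the sum into a finite combination of counts on
disjoint fibres, and independence multiplies their transforms. The fibre over `0` may have infinite
intensity, because it contributes nothing. -/
lemma lintegral_expNeg_simpleFunc [IsProbabilityMeasure Pr] (hX : IsPoissonProcess X Λ Pr)
    (f : SimpleFunc E ℝ≥0∞) (hf : ∀ y ≠ 0, Λ (f ⁻¹' {y}) ≠ ∞) :
    ∫⁻ ω, expNeg (∑' n, f (X n ω)) ∂Pr = expNeg (∫⁻ x, (1 - expNeg (f x)) ∂Λ) := by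
  classical
  let e := f.range.equivFin.symm
  have hB : ∀ i, MeasurableSet (f ⁻¹' {(e i : ℝ≥0∞)}) := fun i => f.measurableSet_fiber _
  have hdisj : Pairwise (fun i j => Disjoint (f ⁻¹' {(e i : ℝ≥0∞)}) (f ⁻¹' {(e j : ℝ≥0∞)})) := by
    intro i j hij
    refine Set.disjoint_left.2 fun x hi hj => hij ?_
    simp only [mem_preimage, mem_singleton_iff] at hi hj
    exact e.injective (Subtype.ext (hi.symm.trans hj))
  have hind := hX.count_indep _ _ hB hdisj
  have hsum : ∀ ω, ∑' n, f (X n ω) =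
      ∑ i, (e i : ℝ≥0∞) * pointCount X (f ⁻¹' {(e i : ℝ≥0∞)}) ω := fun ω => by
    simp_rw [pointCount, ← ENNReal.tsum_mul_left]
    rw [← Summable.tsum_finsetSum fun _ _ => ENNReal.summable]
    refine tsum_congr fun n => ?_
    rw [Equiv.sum_comp e (fun y : f.range => (y : ℝ≥0∞) *
      (f ⁻¹' {(y : ℝ≥0∞)}).indicator (fun _ => (1 : ℝ≥0∞)) (X n ω)),
      Finset.sum_eq_single (⟨f (X n ω), f.mem_range_self _⟩ : f.range)]
    · simp
    · intro b _ hb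
      rw [indicator_of_notMem, mul_zero]
      intro h
      exact hb (Subtype.ext (by simpa using h.symm))
    · simp
  have hmeas : ∀ i, Measurable (fun ω => (e i : ℝ≥0∞) * pointCount X (f ⁻¹' {(e i : ℝ≥0∞)}) ω) :=
    fun i => (measurable_pointCount hX.measurable (hB i)).const_mul _
  have hterm : ∀ i, ∫⁻ ω, expNeg ((e i : ℝ≥0∞) * pointCount X (f ⁻¹' {(e i : ℝ≥0∞)}) ω) ∂Pr =
      expNeg ((1 - expNeg (e i)) * Λ (f ⁻¹' {(e i : ℝ≥0∞)})) := fun i => by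
    by_cases h0 : (e i : ℝ≥0∞) = 0
    · simp [h0]
    · exact hX.lintegral_expNeg_mul_pointCount (hB i) (hf _ h0) _
  simp_rw [hsum, expNeg_sum]
  rw [lintegral_prod_eq_prod_lintegral_of_indepFun Finset.univ
    (fun i ω => expNeg ((e i : ℝ≥0∞) * pointCount X (f ⁻¹' {(e i : ℝ≥0∞)}) ω))
    (hind.comp (fun i c => expNeg ((e i : ℝ≥0∞) * c)) (fun i => by fun_prop))
    (fun i => by have := hmeas i; fun_prop)]
  simp_rw [hterm]
  rw [← expNeg_sum]
  congr 1
  have : (fun x => 1 - expNeg (f x)) = f.map (fun y => 1 - expNeg y) := rfl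
  rw [this, SimpleFunc.lintegral_eq_lintegral, SimpleFunc.map_lintegral,
    ← Finset.sum_coe_sort f.range,
    Equiv.sum_comp e (fun y : f.range => (1 - expNeg y) * Λ (f ⁻¹' {(y : ℝ≥0∞)}))]

/-- The Laplace functional of a Poisson process. The function is allowed to take infinite values,
so that void probabilities are included. -/
theorem laplace_functional [IsProbabilityMeasure Pr] [SigmaFinite Λ]
    (hX : IsPoissonProcess X Λ Pr) {f : E → ℝ≥0∞} (hf : Measurable f) :
    ∫⁻ ω, expNeg (∑' n, f (X n ω)) ∂Pr = expNeg (∫⁻ x, (1 - expNeg (f x)) ∂Λ) := by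
  -- Cutting the simple approximations off outside sets of finite intensity gives their nonzero
  -- fibres finite intensity and still lets them increase to `f`.
  let g : ℕ → SimpleFunc E ℝ≥0∞ := fun m => (SimpleFunc.eapprox f m).restrict (spanningSets Λ m)
  have hg : ∀ m x, g m x = (spanningSets Λ m).indicator (SimpleFunc.eapprox f m) x := fun m x => by
    rw [SimpleFunc.restrict_apply _ (measurableSet_spanningSets Λ m)]
  have hmono : ∀ x, Monotone fun m => g m x := fun x m m' h => by
    simp only [hg]
    refine (indicator_le_indicator_of_subset (monotone_spanningSets Λ h)
      (fun _ => zero_le) x).trans ?_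
    exact indicator_le_indicator (SimpleFunc.monotone_eapprox f h x)
  have htend : ∀ x, Tendsto (fun m => g m x) atTop (𝓝 (f x)) := fun x => by
    have hx : x ∈ ⋃ m, spanningSets Λ m := by rw [iUnion_spanningSets]; trivial
    obtain ⟨m₀, hm₀⟩ := mem_iUnion.1 hx
    refine (SimpleFunc.tendsto_eapprox hf x).congr' ?_
    filter_upwards [eventually_ge_atTop m₀] with m hm
    rw [hg, indicator_of_mem (monotone_spanningSets Λ hm hm₀)]
  have hfin : ∀ m, ∀ y ≠ 0, Λ (g m ⁻¹' {y}) ≠ ∞ := fun m y hy => by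
    refine ne_top_of_le_ne_top (measure_spanningSets_lt_top Λ m).ne (measure_mono fun x hx => ?_)
    by_contra hxm
    simp only [mem_preimage, mem_singleton_iff] at hx
    rw [hg, indicator_of_notMem hxm] at hx
    exact hy hx.symm
  have hL : Tendsto (fun m => ∫⁻ ω, expNeg (∑' n, g m (X n ω)) ∂Pr) atTop
      (𝓝 (∫⁻ ω, expNeg (∑' n, f (X n ω)) ∂Pr)) := by
    refine tendsto_lintegral_of_dominated_convergence (fun _ => 1) (fun m => ?_)
      (fun m => ae_of_all _ fun ω => expNeg_le_one _) (by simp) (ae_of_all _ fun ω => ?_)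
    · have := hX.measurable
      have := (g m).measurable
      exact measurable_expNeg.comp (Measurable.tsum fun n => by fun_prop)
    · refine (continuous_expNeg.tendsto _).comp ?_
      -- The sum over the points is an integral for counting measure, so monotone convergence
      -- applies to it.
      simp_rw [← lintegral_count]
      exact lintegral_tendsto_of_tendsto_of_monotone (fun m => (measurable_of_countable _).aemeasurable)
        (ae_of_all _ fun n => hmono _) (ae_of_all _ fun n => htend _)
  have hR : Tendsto (fun m => expNeg (∫⁻ x, (1 - expNeg (g m x)) ∂Λ)) atTop
      (𝓝 (expNeg (∫⁻ x, (1 - expNeg (f x)) ∂Λ))) := by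
    refine (continuous_expNeg.tendsto _).comp ?_
    refine lintegral_tendsto_of_tendsto_of_monotone (fun m => ?_) (ae_of_all _ fun x => ?_)
      (ae_of_all _ fun x => ?_)
    · have := (g m).measurable
      fun_prop
    · exact fun m m' h => tsub_le_tsub_left (expNeg_antitone (hmono x h)) 1
    · exact ENNReal.Tendsto.sub tendsto_const_nhds ((continuous_expNeg.tendsto _).comp (htend x))
        (Or.inl ENNReal.one_ne_top)
  refine tendsto_nhds_unique hL (hR.congr fun m => ?_)
  exact (hX.lintegral_expNeg_simpleFunc (g m) (hfin m)).symm

end IsPoissonProcess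
end Poisson
-- Independent marks and almost sure properties of the points
section Marked

variable {Ω E : Type*} [MeasurableSpace Ω] [MeasurableSpace E]

/-- Integration of a function of two independent variables. -/
lemma lintegral_comp_prodMk_of_indepFun {𝓤 𝓥 : Type*} [MeasurableSpace 𝓤] [MeasurableSpace 𝓥]
    {Pr : Measure Ω} [IsProbabilityMeasure Pr] {U : Ω → 𝓤} {V : Ω → 𝓥} (hU : AEMeasurable U Pr)
    (hV : AEMeasurable V Pr) (h : IndepFun U V Pr) {F : 𝓤 × 𝓥 → ℝ≥0∞} (hF : Measurable F) :
    ∫⁻ ω, F (U ω, V ω) ∂Pr = ∫⁻ ω, ∫⁻ v, F (U ω, v) ∂(Pr.map V) ∂Pr := by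
  have := Measure.isProbabilityMeasure_map (μ := Pr) hV
  rw [← lintegral_map' hF.aemeasurable (hU.prodMk hV),
    (indepFun_iff_map_prod_eq_prod_map_map hU hV).1 h, lintegral_prod _ hF.aemeasurable,
    lintegral_map' (hF.lintegral_prod_right').aemeasurable hU]

/-- Independence settles finite products, and dominated convergence passes to the limit. Writing
each factor as the exponential of a `negLog` turns the infinite product into one sum over the
points, the shape that the unmarked Laplace functional accepts. -/
lemma lintegral_expNeg_tsum_infinitePi {𝓜 : Type*} [MeasurableSpace 𝓜] (ν : Measure 𝓜)
    [IsProbabilityMeasure ν] {g : ℕ → 𝓜 → ℝ≥0∞} (hg : ∀ n, Measurable (g n)) :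
    ∫⁻ m, expNeg (∑' n, g n (m n)) ∂(Measure.infinitePi fun _ : ℕ => ν) =
      expNeg (∑' n, negLog (∫⁻ y, expNeg (g n y) ∂ν)) := by
  have hle : ∀ n, ∫⁻ y, expNeg (g n y) ∂ν ≤ 1 := fun n => by
    simpa using lintegral_mono (μ := ν) (fun y => expNeg_le_one (g n y))
  have hfin : ∀ n, ∫⁻ m, ∏ i ∈ Finset.range n, expNeg (g i (m i))
      ∂(Measure.infinitePi fun _ : ℕ => ν) =
      ∏ i ∈ Finset.range n, expNeg (negLog (∫⁻ y, expNeg (g i y) ∂ν)) := fun n => by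
    rw [lintegral_prod_eq_prod_lintegral_of_indepFun (Finset.range n)
      (fun i (m : ℕ → 𝓜) => expNeg (g i (m i)))
      (iIndepFun_infinitePi (X := fun i y => expNeg (g i y)) (fun i => by fun_prop))
      (fun i => by fun_prop)]
    refine Finset.prod_congr rfl fun i _ => ?_
    rw [expNeg_negLog (hle i)]
    conv_rhs => rw [← Measure.infinitePi_map_eval (fun _ : ℕ => ν) i]
    rw [lintegral_map (by fun_prop) (by fun_prop)]
  refine tendsto_nhds_unique ?_ (tendsto_expNeg_sum_range _)
  simp_rw [← hfin]
  refine tendsto_lintegral_of_dominated_convergence (fun _ => 1) (fun n => by fun_prop)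
    (fun n => ae_of_all _ fun m => Finset.prod_le_one' fun i _ => expNeg_le_one _) (by simp)
    (ae_of_all _ fun m => tendsto_expNeg_sum_range _)

/-- Where `S = ∞` the integrand vanishes, as `c n ≠ 0`. Every transform is therefore at most `Pr {S
≠ ∞}`, which must equal one. -/
lemma ae_ne_top_of_tendsto_laplace {Pr : Measure Ω} [IsProbabilityMeasure Pr] {S : Ω → ℝ≥0∞}
    (hS : AEMeasurable S Pr) {c : ℕ → ℝ≥0∞} (hc : ∀ n, c n ≠ 0)
    (h : Tendsto (fun n => ∫⁻ ω, expNeg (c n * S ω) ∂Pr) atTop (𝓝 1)) : ∀ᵐ ω ∂Pr, S ω ≠ ∞ := by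
  have hm : NullMeasurableSet {ω | S ω ≠ ∞} Pr :=
    hS.nullMeasurableSet_preimage (measurableSet_singleton ∞).compl
  have hle : ∀ n, ∫⁻ ω, expNeg (c n * S ω) ∂Pr ≤ Pr {ω | S ω ≠ ∞} := fun n => by
    rw [← lintegral_indicator_one₀ hm]
    refine lintegral_mono fun ω => ?_
    by_cases h : S ω = ∞
    · simp [h, ENNReal.mul_top (hc n)]
    · rw [indicator_of_mem (by exact h)]
      exact expNeg_le_one _
  have h1 := le_antisymm prob_le_one (le_of_tendsto' h hle)
  rw [ae_iff]
  have := (prob_compl_eq_zero_iff₀ hm).2 h1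
  simpa [compl_def] using this

namespace IsPoissonProcess

variable {X : ℕ → Ω → E} {Λ : Measure E} {Pr : Measure Ω}

lemma map {E' : Type*} [MeasurableSpace E'] (hX : IsPoissonProcess X Λ Pr) {φ : E → E'}
    (hφ : Measurable φ) : IsPoissonProcess (fun n ω => φ (X n ω)) (Λ.map φ) Pr where
  measurable n := hφ.comp (hX.measurable n)
  count_law B hB hΛ k := by
    rw [Measure.map_apply hφ hB] at hΛ ⊢
    exact hX.count_law (φ ⁻¹' B) (hφ hB) hΛ k
  count_indep m B hB hd :=
    hX.count_indep m (fun i => φ ⁻¹' B i) (fun i => hφ (hB i))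
      (fun _ _ hij => (hd hij).preimage φ)

variable [IsProbabilityMeasure Pr] [SigmaFinite Λ]

/-- The Laplace functional of an independently marked Poisson process. -/
theorem marked_laplace_functional {𝓜 : Type*} [MeasurableSpace 𝓜] {M : ℕ → Ω → 𝓜}
    {ν : Measure 𝓜} [IsProbabilityMeasure ν] (hX : IsPoissonProcess X Λ Pr)
    (hM : ∀ n, HasLaw (M n) ν Pr) (hMi : iIndepFun M Pr)
    (hXM : IndepFun (fun ω n => X n ω) (fun ω n => M n ω) Pr) {g : E × 𝓜 → ℝ≥0∞}
    (hg : Measurable g) :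
    ∫⁻ ω, expNeg (∑' n, g (X n ω, M n ω)) ∂Pr =
      expNeg (∫⁻ x, (1 - ∫⁻ m, expNeg (g (x, m)) ∂ν) ∂Λ) := by
  have hMa : AEMeasurable (fun ω n => M n ω) Pr := aemeasurable_pi_iff.2 fun n => (hM n).aemeasurable
  have hXa : Measurable (fun ω n => X n ω) := measurable_pi_iff.2 hX.measurable
  have hlaw : Pr.map (fun ω n => M n ω) = Measure.infinitePi fun _ : ℕ => ν := by
    rw [hMi.map_fun_eq_infinitePi_map₀ hMa]
    congr 1
    exact funext fun n => (hM n).map_eq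
  have hle : ∀ x, ∫⁻ m, expNeg (g (x, m)) ∂ν ≤ 1 := fun x => by
    simpa using lintegral_mono (μ := ν) (fun m => expNeg_le_one (g (x, m)))
  rw [lintegral_comp_prodMk_of_indepFun hXa.aemeasurable hMa hXM
    (F := fun p : (ℕ → E) × (ℕ → 𝓜) => expNeg (∑' n, g (p.1 n, p.2 n)))
    (measurable_expNeg.comp (Measurable.tsum fun n => by fun_prop)), hlaw]
  have hinner : ∀ ω, ∫⁻ m, expNeg (∑' n, g (X n ω, m n)) ∂(Measure.infinitePi fun _ : ℕ => ν) =
      expNeg (∑' n, negLog (∫⁻ y, expNeg (g (X n ω, y)) ∂ν)) := fun ω =>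
    lintegral_expNeg_tsum_infinitePi ν (g := fun n y => g (X n ω, y)) (fun n => by fun_prop)
  simp only [hinner]
  have hm : Measurable fun x => negLog (∫⁻ m, expNeg (g (x, m)) ∂ν) :=
    measurable_negLog.comp (Measurable.lintegral_prod_right' (f := fun p => expNeg (g p)) (by fun_prop))
  -- With the marks averaged out, an unmarked functional remains. Its test function is `negLog` of
  -- the mean mark factor, infinite where that mean vanishes.
  rw [hX.laplace_functional hm]
  simp_rw [expNeg_negLog (hle _)]

omit [SigmaFinite Λ] in
lemma ae_forall_notMem (hX : IsPoissonProcess X Λ Pr) {B : Set E} (hB : MeasurableSet B)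
    (h0 : Λ B = 0) : ∀ᵐ ω ∂Pr, ∀ n, X n ω ∉ B := by
  have h1 := hX.count_law B hB (by simp [h0]) 0
  have hm : MeasurableSet {ω | pointCount X B ω = ((0 : ℕ) : ℝ≥0∞)} :=
    measurable_pointCount hX.measurable hB (measurableSet_singleton _)
  simp only [h0, ENNReal.toReal_zero, neg_zero, Real.exp_zero, pow_zero, mul_one,
    Nat.factorial_zero, Nat.cast_one, div_one, ENNReal.ofReal_one] at h1
  have h2 := (mem_ae_iff_prob_eq_one hm).2 h1
  filter_upwards [h2] with ω hω n hn
  simp only [Nat.cast_zero, pointCount, ENNReal.tsum_eq_zero] at hω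
  simpa [hn] using hω n

omit [SigmaFinite Λ] in
lemma ae_finite (hX : IsPoissonProcess X Λ Pr) {B : Set E} (hB : MeasurableSet B)
    (hΛ : Λ B ≠ ∞) : ∀ᵐ ω ∂Pr, {n | X n ω ∈ B}.Finite := by
  filter_upwards [hX.ae_exists_natCast hB hΛ] with ω ⟨k, hk⟩
  have := ENNReal.finite_const_le_of_tsum_ne_top (a := fun n => B.indicator (fun _ => 1) (X n ω))
    (by rw [pointCount] at hk; rw [hk]; exact ENNReal.natCast_ne_top k) one_ne_zero
  refine this.subset fun n hn => ?_
  simp only [mem_ofPred_eq] at hn ⊢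
  simp [hn]

/-- A sum over the points of a Poisson process is finite when its Laplace functional is
nondegenerate. -/
lemma ae_tsum_ne_top (hX : IsPoissonProcess X Λ Pr) {f : E → ℝ≥0∞} (hf : Measurable f)
    (hfin : ∀ᵐ x ∂Λ, f x ≠ ∞) (hint : ∫⁻ x, (1 - expNeg (f x)) ∂Λ ≠ ∞) :
    ∀ᵐ ω ∂Pr, ∑' n, f (X n ω) ≠ ∞ := by
  have hXm := hX.measurable
  refine ae_ne_top_of_tendsto_laplace (c := fun n => ((n : ℝ≥0∞) + 1)⁻¹)
    (Measurable.tsum fun n => by fun_prop).aemeasurable (fun n => by simp) ?_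
  have h1 : ∀ n : ℕ, ∫⁻ ω, expNeg (((n : ℝ≥0∞) + 1)⁻¹ * ∑' i, f (X i ω)) ∂Pr =
      expNeg (∫⁻ x, (1 - expNeg (((n : ℝ≥0∞) + 1)⁻¹ * f x)) ∂Λ) := fun n => by
    simp_rw [← ENNReal.tsum_mul_left]
    exact hX.laplace_functional (f := fun x => ((n : ℝ≥0∞) + 1)⁻¹ * f x) (by fun_prop)
  simp_rw [h1]
  suffices h : Tendsto (fun n : ℕ => ∫⁻ x, (1 - expNeg (((n : ℝ≥0∞) + 1)⁻¹ * f x)) ∂Λ) atTop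
      (𝓝 (∫⁻ _, 0 ∂Λ)) by
    simpa [Function.comp_def] using (continuous_expNeg.tendsto _).comp h
  -- The factors `1 / (n + 1)` are at most one, so the integrand without a factor dominates.
  refine tendsto_lintegral_of_dominated_convergence (fun x => 1 - expNeg (f x))
    (fun n => by fun_prop) (fun n => ae_of_all _ fun x => ?_) hint ?_
  · refine tsub_le_tsub_left (expNeg_antitone ?_) 1
    refine mul_le_of_le_one_left zero_le (ENNReal.inv_le_one.2 ?_)
    simp
  · filter_upwards [hfin] with x hx
    have h2 : Tendsto (fun n : ℕ => ((n : ℝ≥0∞) + 1)⁻¹ * f x) atTop (𝓝 0) := by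
      rw [← zero_mul (f x)]
      refine ENNReal.Tendsto.mul_const ?_ (Or.inr hx)
      have := ENNReal.tendsto_inv_nat_nhds_zero
      simpa using (tendsto_add_atTop_iff_nat 1).2 this
    have h3 := ENNReal.Tendsto.sub (tendsto_const_nhds (x := (1 : ℝ≥0∞)))
      ((continuous_expNeg.tendsto _).comp h2) (Or.inl ENNReal.one_ne_top)
    simpa using h3

omit [SigmaFinite Λ] in
-- With `x = Λ B` the probability is at most `1 - (1 + x) e^{-x}`, and `e^{-x} ≥ 1 - x` bounds this
-- by `x²`. The quadratic order is what later rules out coinciding points.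
lemma measure_two_le_pointCount_le (hX : IsPoissonProcess X Λ Pr) {B : Set E}
    (hB : MeasurableSet B) (hΛ : Λ B ≠ ∞) : Pr {ω | 2 ≤ pointCount X B ω} ≤ Λ B ^ 2 := by
  have hm := measurable_pointCount hX.measurable hB
  have hms : ∀ k : ℕ, MeasurableSet {ω | pointCount X B ω = (k : ℝ≥0∞)} := fun k =>
    hm (measurableSet_singleton _)
  have h0 := hX.count_law B hB hΛ 0
  have h1 := hX.count_law B hB hΛ 1
  set x := (Λ B).toReal
  have hx : 0 ≤ x := ENNReal.toReal_nonneg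
  have hsub : {ω | 2 ≤ pointCount X B ω} ⊆ ({ω | pointCount X B ω = ((0 : ℕ) : ℝ≥0∞)} ∪
      {ω | pointCount X B ω = ((1 : ℕ) : ℝ≥0∞)})ᶜ := by
    intro ω hω
    simp only [mem_ofPred_eq] at hω
    simp only [mem_compl_iff, mem_union, mem_ofPred_eq, not_or]
    constructor <;> intro h <;> rw [h] at hω <;> norm_num at hω
  refine (measure_mono hsub).trans ?_
  rw [prob_compl_eq_one_sub ((hms 0).union (hms 1)), measure_union _ (hms 1), h0, h1]
  · rw [← ENNReal.ofReal_add (by positivity) (by positivity), ← ENNReal.ofReal_one,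
      ← ENNReal.ofReal_sub _ (by positivity), ← ENNReal.ofReal_toReal hΛ,
      ← ENNReal.ofReal_pow hx]
    refine ENNReal.ofReal_le_ofReal ?_
    have := Real.add_one_le_exp (-x)
    simp only [pow_zero, mul_one, Nat.factorial_zero, Nat.cast_one, div_one, pow_one,
      Nat.factorial_one]
    nlinarith
  · refine Set.disjoint_left.2 fun ω hi hj => ?_
    simp only [mem_ofPred_eq] at hi hj
    rw [hi] at hj
    norm_num at hj

end IsPoissonProcess
end Marked
-- Squared distances as a Poisson process on the half-line
section HalfLine

variable {Ω : Type*} [MeasurableSpace Ω]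

/-- The points of `U` form a homogeneous Poisson process of intensity `c` on the half-line. -/
def IsHalfLinePPP (U : ℕ → Ω → ℝ) (c : ℝ) (Pr : Measure Ω) : Prop :=
  IsPoissonProcess U (ENNReal.ofReal c • (volume : Measure ℝ).restrict (Ioi 0)) Pr

instance (c : ℝ) : SigmaFinite (ENNReal.ofReal c • (volume : Measure ℝ).restrict (Ioi 0)) :=
  inferInstanceAs (SigmaFinite (c.toNNReal • (volume : Measure ℝ).restrict (Ioi 0)))

lemma volume_sq_norm_le (b : ℝ) :
    volume {x : Plane | ‖x‖ ^ 2 ≤ b} = ENNReal.ofReal (Real.pi * b) := by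
  rcases lt_or_ge b 0 with hb | hb
  · have : {x : Plane | ‖x‖ ^ 2 ≤ b} = ∅ := by
      ext x
      simp only [mem_ofPred_eq, mem_empty_iff_false, iff_false, not_le]
      exact hb.trans_le (sq_nonneg _)
    rw [this, measure_empty, ENNReal.ofReal_of_nonpos]
    exact mul_nonpos_of_nonneg_of_nonpos Real.pi_pos.le hb.le
  · have : {x : Plane | ‖x‖ ^ 2 ≤ b} = Metric.closedBall 0 (√b) := by
      ext x
      simp only [mem_ofPred_eq, mem_closedBall_zero_iff]
      exact (Real.le_sqrt (norm_nonneg _) hb).symm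
    rw [this, EuclideanSpace.volume_closedBall_fin_two, ← ENNReal.ofReal_pow (Real.sqrt_nonneg _),
      Real.sq_sqrt hb, ← ENNReal.ofReal_mul hb, mul_comm]

/-- The disc of squared radius `b` has area `πb`, linear in `b`, so an annulus has area `π` times
the length of the interval of squared radii. -/
lemma map_sq_norm_volume :
    (volume : Measure Plane).map (fun x => ‖x‖ ^ 2) =
      ENNReal.ofReal Real.pi • (volume : Measure ℝ).restrict (Ioi 0) := by
  have hloc : IsLocallyFiniteMeasure (ENNReal.ofReal Real.pi • (volume : Measure ℝ).restrict (Ioi 0)) :=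
    inferInstanceAs (IsLocallyFiniteMeasure (Real.pi.toNNReal • (volume : Measure ℝ).restrict (Ioi 0)))
  symm
  refine Measure.ext_of_Ioc _ _ fun a b hab => ?_
  rw [Measure.map_apply (by fun_prop) measurableSet_Ioc]
  have : (fun x : Plane => ‖x‖ ^ 2) ⁻¹' Ioc a b = {x | ‖x‖ ^ 2 ≤ b} \ {x | ‖x‖ ^ 2 ≤ a} := by
    ext x
    simp [and_comm]
  have hm : MeasurableSet {x : Plane | ‖x‖ ^ 2 ≤ a} := measurableSet_le (by fun_prop) (by fun_prop)
  have hsub : {x : Plane | ‖x‖ ^ 2 ≤ a} ⊆ {x | ‖x‖ ^ 2 ≤ b} := fun x hx => le_trans hx hab.le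
  rw [this, measure_sdiff hsub hm.nullMeasurableSet
    (by rw [volume_sq_norm_le]; exact ENNReal.ofReal_ne_top), volume_sq_norm_le, volume_sq_norm_le,
    Measure.smul_apply, Measure.restrict_apply measurableSet_Ioc, Ioc_inter_Ioi, Real.volume_Ioc,
    smul_eq_mul, ENNReal.ofReal_mul Real.pi_pos.le, ENNReal.ofReal_mul Real.pi_pos.le,
    ← ENNReal.mul_sub (by simp)]
  congr 1
  rcases le_total a 0 with ha | ha
  · rw [max_eq_right ha, ENNReal.ofReal_of_nonpos ha]; simp
  · rw [max_eq_left ha, ENNReal.ofReal_sub _ ha]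

lemma IsHomogeneousPPP.sq_norm {X : ℕ → Ω → Plane} {c : ℝ} {Pr : Measure Ω} (hc : 0 ≤ c)
    (hX : IsHomogeneousPPP X c Pr) :
    IsHalfLinePPP (fun n ω => ‖X n ω‖ ^ 2) (Real.pi * c) Pr := by
  have := IsPoissonProcess.map hX (φ := fun x : Plane => ‖x‖ ^ 2) (by fun_prop)
  rwa [Measure.map_smul, map_sq_norm_volume, smul_smul, ← ENNReal.ofReal_mul hc, mul_comm c] at this

namespace IsHalfLinePPP

variable {U : ℕ → Ω → ℝ} {c : ℝ} {Pr : Measure Ω} [IsProbabilityMeasure Pr]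

lemma ae_pos (hU : IsHalfLinePPP U c Pr) : ∀ᵐ ω ∂Pr, ∀ n, 0 < U n ω := by
  filter_upwards [IsPoissonProcess.ae_forall_notMem hU (measurableSet_Iic (a := (0 : ℝ)))
    (by simp [Measure.restrict_apply, Iic_inter_Ioi])] with ω hω n
  simpa using hω n

lemma ae_finite_le (hU : IsHalfLinePPP U c Pr) : ∀ᵐ ω ∂Pr, ∀ v : ℝ, {n | U n ω ≤ v}.Finite := by
  have h : ∀ k : ℕ, ∀ᵐ ω ∂Pr, {n | U n ω ∈ Iic (k : ℝ)}.Finite := fun k => by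
    refine IsPoissonProcess.ae_finite hU measurableSet_Iic ?_
    rw [Measure.smul_apply, Measure.restrict_apply measurableSet_Iic, Iic_inter_Ioi,
      Real.volume_Ioc, smul_eq_mul]
    finiteness
  filter_upwards [ae_all_iff.2 h] with ω hω v
  obtain ⟨k, hk⟩ := exists_nat_ge v
  exact (hω k).subset fun n hn => le_trans hn hk

/-- Almost surely, there is a first point. -/
lemma ae_exists_forall_le (hU : IsHalfLinePPP U c Pr) : ∀ᵐ ω ∂Pr, ∃ j, ∀ i, U j ω ≤ U i ω := by
  filter_upwards [hU.ae_finite_le] with ω hω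
  obtain ⟨j, hj, hmin⟩ := (hω (U 0 ω)).exists_minimalFor (fun n => U n ω) _ ⟨0, le_refl (U 0 ω)⟩
  refine ⟨j, fun i => ?_⟩
  by_contra! hlt
  exact absurd (hmin (hlt.le.trans hj) hlt.le) (not_le.2 hlt)

/-- Almost surely, no two points coincide. -/
lemma ae_injective (hU : IsHalfLinePPP U c Pr) :
    ∀ᵐ ω ∂Pr, Function.Injective fun n => U n ω := by
  -- Two coinciding points below `V` lie in one cell of the grid of mesh `1 / (m + 1)`. Each of the
  -- `V (m + 1)` cells holds two points with probability at most `(c / (m + 1))²`, so the total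
  -- tends to zero.
  let B : ℕ → ℕ → Set ℝ := fun m k => Ico ((k : ℝ) / (m + 1)) ((k + 1 : ℝ) / (m + 1))
  let S : ℕ → Set Ω := fun V => {ω | ∃ i j, i ≠ j ∧ U i ω = U j ω ∧ 0 ≤ U i ω ∧ U i ω < V}
  have hB : ∀ m k, (ENNReal.ofReal c • (volume : Measure ℝ).restrict (Ioi 0)) (B m k) ≤
      ENNReal.ofReal (c * (1 / (m + 1))) := fun m k => by
    rw [Measure.smul_apply, smul_eq_mul, ENNReal.ofReal_mul' (by positivity)]
    gcongr
    refine (Measure.restrict_apply_le _ _).trans_eq ?_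
    rw [Real.volume_Ico]
    congr 1; ring
  have hcover : ∀ V m : ℕ, S V ⊆ ⋃ k ∈ Finset.range (V * (m + 1)), {ω | 2 ≤ pointCount U (B m k) ω} := by
    rintro V m ω ⟨i, j, hij, heq, h0, hV⟩
    have hm : (0 : ℝ) < m + 1 := by positivity
    have hx : 0 ≤ U i ω * (m + 1) := by positivity
    have hmem : U i ω ∈ B m ⌊U i ω * (m + 1)⌋₊ := by
      simp only [B, mem_Ico, div_le_iff₀ hm, lt_div_iff₀ hm]
      exact ⟨Nat.floor_le hx, Nat.lt_floor_add_one _⟩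
    simp only [mem_iUnion]
    refine ⟨⌊U i ω * (m + 1)⌋₊, ?_, ?_⟩
    · rw [Finset.mem_range, Nat.floor_lt hx]
      push_cast
      gcongr
    · simp only [mem_ofPred_eq, pointCount]
      refine le_trans ?_ (ENNReal.sum_le_tsum {i, j})
      rw [Finset.sum_pair hij, ← heq, indicator_of_mem hmem]
      norm_num
  have hbound : ∀ V m : ℕ, Pr (S V) ≤ ENNReal.ofReal (V * c ^ 2 * (1 / (m + 1))) := fun V m => by
    have hm : (0 : ℝ) < m + 1 := by positivity
    calc Pr (S V) ≤ ∑ k ∈ Finset.range (V * (m + 1)), Pr {ω | 2 ≤ pointCount U (B m k) ω} :=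
          (measure_mono (hcover V m)).trans (measure_biUnion_finset_le _ _)
      _ ≤ ∑ k ∈ Finset.range (V * (m + 1)), ENNReal.ofReal ((c * (1 / (m + 1))) ^ 2) := by
          refine Finset.sum_le_sum fun k _ => ?_
          refine (IsPoissonProcess.measure_two_le_pointCount_le hU measurableSet_Ico
            (ne_top_of_le_ne_top ENNReal.ofReal_ne_top (hB m k))).trans ?_
          refine (pow_le_pow_left₀ zero_le (hB m k) 2).trans ?_
          rcases le_total c 0 with hc | hc
          · rw [ENNReal.ofReal_of_nonpos (mul_nonpos_of_nonpos_of_nonneg hc (by positivity))]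
            simp
          · rw [ENNReal.ofReal_pow (by positivity)]
      _ = ENNReal.ofReal (V * c ^ 2 * (1 / (m + 1))) := by
          rw [Finset.sum_const, Finset.card_range, nsmul_eq_mul, ← ENNReal.ofReal_natCast,
            ← ENNReal.ofReal_mul (by positivity)]
          congr 1
          push_cast
          field_simp
  have hS : ∀ V, Pr (S V) = 0 := fun V => by
    have := ENNReal.tendsto_ofReal
      ((tendsto_one_div_add_atTop_nhds_zero_nat (𝕜 := ℝ)).const_mul (V * c ^ 2))
    rw [mul_zero, ENNReal.ofReal_zero] at this
    exact le_antisymm (ge_of_tendsto' this (hbound V)) zero_le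
  have hS' : ∀ᵐ ω ∂Pr, ∀ V, ω ∉ S V := ae_all_iff.2 fun V => by
    rw [ae_iff]; simpa using hS V
  filter_upwards [hS', hU.ae_pos] with ω hω hpos i j heq
  by_contra hij
  obtain ⟨V, hV⟩ := exists_nat_gt (U i ω)
  exact hω V ⟨i, j, hij, heq, (hpos i).le, hV⟩

end IsHalfLinePPP
end HalfLine
-- The exponential law
lemma expMeasure_eq {r : ℝ} : expMeasure r = volume.withDensity (exponentialPDF r) := rfl

lemma lintegral_expMeasure {r : ℝ} {f : ℝ → ℝ≥0∞} (hf : Measurable f) :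
    ∫⁻ x, f x ∂expMeasure r =
      ∫⁻ x in Ioi 0, ENNReal.ofReal (r * Real.exp (-(r * x))) * f x := by
  have hm : Measurable (exponentialPDF r) := (measurable_exponentialPDFReal r).ennreal_ofReal
  rw [expMeasure_eq, lintegral_withDensity_eq_lintegral_mul _ hm hf,
    ← setLIntegral_congr (Ioi_ae_eq_Ici (a := (0 : ℝ)) (μ := volume)).symm,
    ← lintegral_indicator measurableSet_Ici]
  refine lintegral_congr fun x => ?_
  rcases lt_or_ge x 0 with hx | hx
  · rw [indicator_of_notMem (by simpa using hx), Pi.mul_apply, exponentialPDF_of_neg hx, zero_mul]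
  · rw [indicator_of_mem (by simpa using hx), Pi.mul_apply, exponentialPDF_of_nonneg hx]

lemma expMeasure_Ioi {r : ℝ} (hr : 0 < r) {t : ℝ} (ht : 0 ≤ t) :
    expMeasure r (Ioi t) = expNeg (ENNReal.ofReal (r * t)) := by
  have := isProbabilityMeasure_expMeasure hr
  have h1 := cdf_expMeasure_eq hr t
  rw [cdf_eq_real, if_pos ht] at h1
  have h2 : (expMeasure r).real (Ioi t) = Real.exp (-(r * t)) := by
    rw [← compl_Iic, probReal_compl_eq_one_sub measurableSet_Iic, h1]; ring
  rw [expNeg_ofReal (by positivity), ← h2, ofReal_measureReal]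

lemma expMeasure_singleton (r x : ℝ) : expMeasure r {x} = 0 :=
  withDensity_absolutelyContinuous _ _ (by simp)

lemma expMeasure_Iio_zero (r : ℝ) : expMeasure r (Iio 0) = 0 := by
  rw [expMeasure_eq, withDensity_apply _ measurableSet_Iio,
    setLIntegral_congr_fun (g := fun _ => 0) measurableSet_Iio, lintegral_zero]
  exact fun x hx => exponentialPDF_of_neg hx

/-! ### The first point and the points beyond it -/

section HalfLine

variable {Ω : Type*} [MeasurableSpace Ω]

namespace IsHalfLinePPP

variable {U : ℕ → Ω → ℝ} {c : ℝ} {Pr : Measure Ω} [IsProbabilityMeasure Pr]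

omit [IsProbabilityMeasure Pr] in
lemma measurable_iInf (hU : IsHalfLinePPP U c Pr) : Measurable fun ω => ⨅ n, U n ω :=
  Measurable.iInf (IsPoissonProcess.measurable hU)

/-- An infimum in `ℝ` is a lower bound only for families bounded below; the almost sure positivity
of the points provides this. -/
lemma ae_le_iInf_iff (hU : IsHalfLinePPP U c Pr) :
    ∀ᵐ ω ∂Pr, ∀ a, a ≤ ⨅ n, U n ω ↔ ∀ n, a ≤ U n ω := by
  filter_upwards [hU.ae_pos] with ω hω a
  exact le_ciInf_iff ⟨0, by rintro _ ⟨n, rfl⟩; exact (hω n).le⟩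

lemma ae_iInf_pos (hU : IsHalfLinePPP U c Pr) : ∀ᵐ ω ∂Pr, 0 < ⨅ n, U n ω := by
  filter_upwards [hU.ae_pos, hU.ae_le_iInf_iff, hU.ae_exists_forall_le] with ω hω hle ⟨j, hj⟩
  exact (hω j).trans_le ((hle _).2 hj)

/-- Having no point below `a` means that the function equal to `∞` below `a` sums to zero over the
points, so the event enters the Laplace functional as a summand of the test function. Since `a ≤ b`,
the two summands have disjoint supports and the transform factors. -/
lemma setLIntegral_le_iInf (hU : IsHalfLinePPP U c Pr) {a b : ℝ} (hb : 0 < b)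
    (hab : a ≤ b) {h : ℝ → ℝ≥0∞} (hh : Measurable h) :
    ∫⁻ ω in {ω | a ≤ ⨅ n, U n ω}, expNeg (∑' n, (Ici b).indicator h (U n ω)) ∂Pr =
      expNeg (ENNReal.ofReal c * ENNReal.ofReal a) *
        expNeg (ENNReal.ofReal c * ∫⁻ v in Ici b, (1 - expNeg (h v))) := by
  have hUm := IsPoissonProcess.measurable hU
  have hm : Measurable fun v => (Iio a).indicator (fun _ => (∞ : ℝ≥0∞)) v + (Ici b).indicator h v :=
    (measurable_const.indicator measurableSet_Iio).add (hh.indicator measurableSet_Ici)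
  have key := IsPoissonProcess.laplace_functional hU hm
  rw [← lintegral_indicator (measurableSet_le measurable_const hU.measurable_iInf)]
  have hL : ∫⁻ ω, {ω | a ≤ ⨅ n, U n ω}.indicator
        (fun ω => expNeg (∑' n, (Ici b).indicator h (U n ω))) ω ∂Pr =
      ∫⁻ ω, expNeg (∑' n, ((Iio a).indicator (fun _ => (∞ : ℝ≥0∞)) (U n ω) +
        (Ici b).indicator h (U n ω))) ∂Pr := by
    refine lintegral_congr_ae ?_
    filter_upwards [hU.ae_le_iInf_iff] with ω hω
    rw [ENNReal.tsum_add, expNeg_add]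
    by_cases hmem : a ≤ ⨅ n, U n ω
    · rw [indicator_of_mem (by exact hmem)]
      have : ∑' n, (Iio a).indicator (fun _ => (∞ : ℝ≥0∞)) (U n ω) = 0 := by
        rw [ENNReal.tsum_eq_zero]
        intro n
        exact indicator_of_notMem (by simpa using (hω a).1 hmem n) _
      rw [this, expNeg_zero, one_mul]
    · rw [indicator_of_notMem (by exact hmem)]
      rw [hω a] at hmem
      push Not at hmem
      obtain ⟨n, hn⟩ := hmem
      rw [ENNReal.tsum_eq_top_of_eq_top ⟨n, indicator_of_mem (by exact hn) _⟩, expNeg_top, zero_mul]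
  rw [hL, key, ← expNeg_add, ← mul_add]
  congr 1
  have hR : ∀ v, 1 - expNeg ((Iio a).indicator (fun _ => (∞ : ℝ≥0∞)) v + (Ici b).indicator h v) =
      (Iio a).indicator 1 v + (Ici b).indicator (fun v => 1 - expNeg (h v)) v := fun v => by
    by_cases hv : v < a
    · simp [indicator, hv, not_le.2 (hv.trans_le hab)]
    · by_cases hv' : b ≤ v <;> simp [indicator, hv, hv']
  simp_rw [hR]
  rw [lintegral_smul_measure, lintegral_add_left (measurable_one.indicator measurableSet_Iio),
    lintegral_indicator_one measurableSet_Iio, lintegral_indicator measurableSet_Ici,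
    Measure.restrict_restrict measurableSet_Ici, Measure.restrict_apply measurableSet_Iio,
    Iio_inter_Ioi, Real.volume_Ioo, sub_zero, smul_eq_mul,
    inter_eq_left.2 (show Ici b ⊆ Ioi 0 from fun v hv => hb.trans_le hv)]

lemma measure_le_iInf (hU : IsHalfLinePPP U c Pr) {a : ℝ} (ha : 0 ≤ a) :
    Pr {ω | a ≤ ⨅ n, U n ω} = expNeg (ENNReal.ofReal c * ENNReal.ofReal a) := by
  -- With `h = 0` any positive `b ≥ a` would do.
  have := hU.setLIntegral_le_iInf (a := a) (b := a + 1) (by positivity) (by linarith)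
    (h := fun _ => 0) measurable_const
  simpa using this

/-- The law of the first point. -/
lemma map_iInf (hU : IsHalfLinePPP U c Pr) (hc : 0 < c) :
    Pr.map (fun ω => ⨅ n, U n ω) = expMeasure c := by
  have := isProbabilityMeasure_expMeasure hc
  have := Measure.isProbabilityMeasure_map (μ := Pr) hU.measurable_iInf.aemeasurable
  refine Measure.ext_of_Ici _ _ fun a => ?_
  rw [Measure.map_apply hU.measurable_iInf measurableSet_Ici]
  change Pr {ω | a ≤ ⨅ n, U n ω} = _
  rcases lt_or_ge a 0 with ha | ha
  · have h1 : Pr {ω | a ≤ ⨅ n, U n ω} = 1 := by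
      refine (mem_ae_iff_prob_eq_one (measurableSet_le measurable_const hU.measurable_iInf)).1 ?_
      filter_upwards [hU.ae_iInf_pos] with ω hω using ha.le.trans hω.le
    rw [h1, ← compl_Iio, prob_compl_eq_one_sub measurableSet_Iio,
      measure_mono_null (Iio_subset_Iio ha.le) (expMeasure_Iio_zero c), tsub_zero]
  · rw [hU.measure_le_iInf ha, ← Ioi_insert, insert_eq, measure_union (by simp) measurableSet_Ioi,
      expMeasure_singleton, zero_add, expMeasure_Ioi hc ha, ENNReal.ofReal_mul hc.le]

/-- Subtract the identities for the thresholds `a` and `b`, which share the factor coming from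
beyond `b`: whether the first point falls in `[a, b)` does not influence the points from `b` on. -/
lemma setLIntegral_sdiff_le_iInf (hU : IsHalfLinePPP U c Pr) {a b : ℝ} (ha : 0 ≤ a) (hb : 0 < b)
    (hab : a ≤ b) {h : ℝ → ℝ≥0∞} (hh : Measurable h) :
    ∫⁻ ω in {ω | a ≤ ⨅ n, U n ω} \ {ω | b ≤ ⨅ n, U n ω},
        expNeg (∑' n, (Ici b).indicator h (U n ω)) ∂Pr =
      Pr ({ω | a ≤ ⨅ n, U n ω} \ {ω | b ≤ ⨅ n, U n ω}) *
        expNeg (ENNReal.ofReal c * ∫⁻ v in Ici b, (1 - expNeg (h v))) := by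
  have hS : ∀ a, MeasurableSet {ω | a ≤ ⨅ n, U n ω} := fun a =>
    measurableSet_le measurable_const hU.measurable_iInf
  have hsub : {ω | b ≤ ⨅ n, U n ω} ⊆ {ω | a ≤ ⨅ n, U n ω} := fun ω hω => hab.trans hω
  have h1 := hU.setLIntegral_le_iInf hb hab hh
  have h2 := hU.setLIntegral_le_iInf hb le_rfl hh
  have h3 := lintegral_union (μ := Pr) (f := fun ω => expNeg (∑' n, (Ici b).indicator h (U n ω)))
    (hS b) (show Disjoint ({ω | a ≤ ⨅ n, U n ω} \ {ω | b ≤ ⨅ n, U n ω}) {ω | b ≤ ⨅ n, U n ω} from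
      disjoint_sdiff_left)
  rw [sdiff_union_of_subset hsub, h1, h2] at h3
  rw [measure_sdiff hsub (hS b).nullMeasurableSet (measure_ne_top _ _), hU.measure_le_iInf ha,
    hU.measure_le_iInf hb.le, ENNReal.sub_mul (fun _ _ => expNeg_ne_top _)]
  refine ENNReal.eq_sub_of_add_eq ?_ h3.symm
  exact ENNReal.mul_ne_top (expNeg_ne_top _) (expNeg_ne_top _)

/-- The points of a Poisson process beyond its first point form, given the first point, a Poisson
process. -/
theorem lintegral_iInf_mul_expNeg_tsum (hU : IsHalfLinePPP U c Pr) {F : ℝ → ℝ≥0∞}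
    {g : ℝ → ℝ → ℝ≥0∞} {w : ℝ → ℝ≥0∞} (hFm : Measurable F)
    (hgm : Measurable (Function.uncurry g)) (hwm : Measurable w)
    (hF1 : ∀ u, F u ≤ 1) (hF : ∀ u > 0, ContinuousAt F u)
    (hmono : ∀ v > 0, ∀ u u', 0 < u → u ≤ u' → g u v ≤ g u' v)
    (hg : ∀ v > 0, ∀ u > 0, ContinuousAt (fun u => g u v) u)
    (hgtop : ∀ v > 0, ∀ u > 0, g u v ≠ ∞)
    (hint : ∀ u > 0, ∫⁻ v in Ioi 0, (1 - expNeg (g u v)) ≠ ∞)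
    (hw : ∀ u > 0, ∫⁻ v in Ici u, (1 - expNeg (g u v)) = w u)
    (hwc : ∀ u > 0, ContinuousAt w u) :
    ∫⁻ ω, F (⨅ n, U n ω) * expNeg (∑' n, (Ioi (⨅ n, U n ω)).indicator (g (⨅ n, U n ω)) (U n ω)) ∂Pr =
      ∫⁻ ω, F (⨅ n, U n ω) * expNeg (ENNReal.ofReal c * w (⨅ n, U n ω)) ∂Pr := by
  have hUm := IsPoissonProcess.measurable hU
  set U₀ : Ω → ℝ := fun ω => ⨅ n, U n ω with hU₀
  have hU₀m : Measurable U₀ := hU.measurable_iInf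
  -- Round the first point strictly up to a grid of mesh `1 / (m + 1)`. The rounded value is
  -- constant on each cell, where the factorization over `[a, b)` applies; refining the grid gives
  -- the statement conditional on the first point.
  let b : ℕ → Ω → ℝ := fun m ω => ((⌊U₀ ω * (m + 1)⌋₊ : ℝ) + 1) / (m + 1)
  have hbm : ∀ m, Measurable (b m) := fun m => by
    have : Measurable fun ω => ⌊U₀ ω * (m + 1)⌋₊ := Nat.measurable_floor.comp (by fun_prop)
    have h2 : Measurable fun ω => (⌊U₀ ω * (m + 1)⌋₊ : ℝ) := measurable_from_nat.comp this
    fun_prop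
  have hgrid : ∀ m, ∫⁻ ω, F (b m ω) * expNeg (∑' n, (Ici (b m ω)).indicator (g (b m ω)) (U n ω)) ∂Pr =
      ∫⁻ ω, F (b m ω) * expNeg (ENNReal.ofReal c * w (b m ω)) ∂Pr := fun m => by
    have hm : (0 : ℝ) < m + 1 := by positivity
    let A : ℕ → Set Ω := fun k => {ω | ⌊U₀ ω * (m + 1)⌋₊ = k}
    have hA : ∀ k, MeasurableSet (A k) := fun k =>
      (Nat.measurable_floor.comp (by fun_prop : Measurable fun ω => U₀ ω * (m + 1)))
        (measurableSet_singleton k)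
    have hAd : Pairwise (Function.onFun Disjoint A) := fun i j hij =>
      Set.disjoint_left.2 fun ω hi hj => hij (Eq.trans (Eq.symm hi) hj)
    have hAu : ⋃ k, A k = univ := eq_univ_of_forall fun ω => mem_iUnion.2 ⟨_, rfl⟩
    have hAe : ∀ k : ℕ, A k =ᵐ[Pr] ({ω | (k : ℝ) / (m + 1) ≤ ⨅ n, U n ω} \
        {ω | ((k : ℝ) + 1) / (m + 1) ≤ ⨅ n, U n ω} : Set Ω) := fun k => by
      filter_upwards [hU.ae_iInf_pos] with ω hω
      have h0 : 0 ≤ U₀ ω * (m + 1) := mul_nonneg (le_of_lt hω) hm.le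
      refine propext (Iff.trans (Nat.floor_eq_iff h0) ?_)
      refine and_congr (div_le_iff₀ hm).symm ?_
      refine Iff.trans ?_ (not_le (α := ℝ)).symm
      exact (lt_div_iff₀ hm).symm
    rw [← setLIntegral_univ, ← setLIntegral_univ (fun ω => F (b m ω) * expNeg (ENNReal.ofReal c * w (b m ω))),
      ← hAu, lintegral_iUnion hA hAd, lintegral_iUnion hA hAd]
    refine tsum_congr fun k => ?_
    have hbk : ∀ ω ∈ A k, b m ω = ((k : ℝ) + 1) / (m + 1) := fun ω hω => by
      simp only [A, mem_ofPred_eq] at hω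
      simp only [b, hω]
    have hbp : (0 : ℝ) < ((k : ℝ) + 1) / (m + 1) := by positivity
    have hgb : Measurable (g (((k : ℝ) + 1) / (m + 1))) := hgm.comp measurable_prodMk_left
    have e1 : ∫⁻ ω in A k, F (b m ω) *
          expNeg (∑' n, (Ici (b m ω)).indicator (g (b m ω)) (U n ω)) ∂Pr =
        ∫⁻ ω in A k, F (((k : ℝ) + 1) / (m + 1)) * expNeg (∑' n, (Ici (((k : ℝ) + 1) / (m + 1))).indicator
          (g (((k : ℝ) + 1) / (m + 1))) (U n ω)) ∂Pr :=
      setLIntegral_congr_fun (hA k) fun ω hω => by simp only [hbk ω hω]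
    have e2 : ∫⁻ ω in A k, F (b m ω) * expNeg (ENNReal.ofReal c * w (b m ω)) ∂Pr =
        ∫⁻ ω in A k, F (((k : ℝ) + 1) / (m + 1)) *
          expNeg (ENNReal.ofReal c * w (((k : ℝ) + 1) / (m + 1))) ∂Pr :=
      setLIntegral_congr_fun (hA k) fun ω hω => by simp only [hbk ω hω]
    rw [e1, e2,
      setLIntegral_const, lintegral_const_mul _ ?_, setLIntegral_congr (hAe k),
      hU.setLIntegral_sdiff_le_iInf (by positivity) hbp (by gcongr; linarith) hgb, hw _ hbp,
      measure_congr (hAe k)]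
    · ring
    · exact measurable_expNeg.comp (Measurable.tsum fun n =>
        (hgb.indicator measurableSet_Ici).comp (hUm n))
  have hb : ∀ ω, 0 < U₀ ω → (∀ m, U₀ ω < b m ω) ∧ Tendsto (fun m => b m ω) atTop (𝓝 (U₀ ω)) := by
    intro ω hω
    have hlt : ∀ m, U₀ ω < b m ω := fun m => by
      have hm : (0 : ℝ) < m + 1 := by positivity
      simp only [b, lt_div_iff₀ hm]
      exact Nat.lt_floor_add_one _
    refine ⟨hlt, ?_⟩
    have h1 : Tendsto (fun m : ℕ => U₀ ω + 1 / ((m : ℝ) + 1)) atTop (𝓝 (U₀ ω)) := by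
      simpa using (tendsto_one_div_add_atTop_nhds_zero_nat (𝕜 := ℝ)).const_add (U₀ ω)
    refine tendsto_of_tendsto_of_tendsto_of_le_of_le tendsto_const_nhds h1 (fun m => (hlt m).le)
      fun m => ?_
    have hm : (0 : ℝ) < m + 1 := by positivity
    have := Nat.floor_le (mul_nonneg hω.le hm.le)
    simp only [b]
    rw [div_le_iff₀ hm, add_mul, one_div, inv_mul_cancel₀ hm.ne']
    linarith
  -- These sums dominate the discretized ones, since `g` increases in its first argument and the
  -- rounded points are eventually at most `R + 1`. Integer `R` keeps the exceptional set null.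
  have hsum : ∀ᵐ ω ∂Pr, ∀ R : ℕ, ∑' n, g ((R : ℝ) + 1) (U n ω) ≠ ∞ := ae_all_iff.2 fun R => by
    refine IsPoissonProcess.ae_tsum_ne_top hU (hgm.comp measurable_prodMk_left) ?_ ?_
    · refine Measure.smul_absolutelyContinuous.ae_le ?_
      filter_upwards [ae_restrict_mem measurableSet_Ioi] with v hv
      exact hgtop v hv _ (by positivity)
    · rw [lintegral_smul_measure]
      exact ENNReal.mul_ne_top ENNReal.ofReal_ne_top (hint _ (by positivity))
  have hL : Tendsto (fun m => ∫⁻ ω, F (b m ω) *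
        expNeg (∑' n, (Ici (b m ω)).indicator (g (b m ω)) (U n ω)) ∂Pr) atTop
      (𝓝 (∫⁻ ω, F (U₀ ω) * expNeg (∑' n, (Ioi (U₀ ω)).indicator (g (U₀ ω)) (U n ω)) ∂Pr)) := by
    refine tendsto_lintegral_of_dominated_convergence (fun _ => 1) (fun m => ?_)
      (fun m => ae_of_all _ fun ω => mul_le_one' (hF1 _) (expNeg_le_one _)) (by simp) ?_
    · refine (hFm.comp (hbm m)).mul (measurable_expNeg.comp (Measurable.tsum fun n => ?_))
      have : (fun ω => (Ici (b m ω)).indicator (g (b m ω)) (U n ω)) =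
          {ω | b m ω ≤ U n ω}.indicator fun ω => g (b m ω) (U n ω) := by
        ext ω; simp [indicator]
      rw [this]
      have := hbm m
      exact (hgm.comp (by fun_prop : Measurable fun ω => (b m ω, U n ω))).indicator
        (measurableSet_le (by fun_prop) (hUm n))
    · filter_upwards [hU.ae_iInf_pos, hU.ae_pos, hsum] with ω hω hpos hs
      obtain ⟨hlt, htend⟩ := hb ω hω
      refine ENNReal.Tendsto.mul ((hF _ hω).tendsto.comp htend) (Or.inr (expNeg_ne_top _))
        ((continuous_expNeg.tendsto _).comp ?_) (Or.inr (ne_top_of_le_ne_top ENNReal.one_ne_top (hF1 _)))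
      obtain ⟨R, hR⟩ := exists_nat_ge (U₀ ω)
      simp_rw [← lintegral_count]
      refine tendsto_lintegral_filter_of_dominated_convergence (fun n => g ((R : ℝ) + 1) (U n ω))
        (Eventually.of_forall fun m => measurable_of_countable _) ?_
        (by rw [lintegral_count]; exact hs R) (ae_of_all _ fun n => ?_)
      · filter_upwards [htend.eventually_le_const (show U₀ ω < (R : ℝ) + 1 by linarith)] with m hm
        refine ae_of_all _ fun n => ?_
        refine (indicator_le_self' (fun _ _ => zero_le) _).trans ?_
        exact hmono _ (hpos n) _ _ (hω.trans (hlt m)) hm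
      · by_cases hn : U₀ ω < U n ω
        · rw [indicator_of_mem (by exact hn)]
          refine ((hg _ (hpos n) _ hω).tendsto.comp htend).congr' ?_
          filter_upwards [htend.eventually_le_const hn] with m hm
          rw [indicator_of_mem (by exact hm)]; rfl
        -- Rounding up is strict, so the first point never enters the discretized sums; hence the
        -- open half-line in the limit.
        · rw [indicator_of_notMem (by exact hn)]
          refine tendsto_const_nhds.congr fun m => ?_
          rw [indicator_of_notMem]
          simp only [mem_Ici, not_le]
          exact (not_lt.1 hn).trans_lt (hlt m)
  have hR : Tendsto (fun m => ∫⁻ ω, F (b m ω) * expNeg (ENNReal.ofReal c * w (b m ω)) ∂Pr) atTop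
      (𝓝 (∫⁻ ω, F (U₀ ω) * expNeg (ENNReal.ofReal c * w (U₀ ω)) ∂Pr)) := by
    refine tendsto_lintegral_of_dominated_convergence (fun _ => 1) (fun m => ?_)
      (fun m => ae_of_all _ fun ω => mul_le_one' (hF1 _) (expNeg_le_one _)) (by simp) ?_
    · have := hbm m
      fun_prop
    · filter_upwards [hU.ae_iInf_pos] with ω hω
      obtain ⟨-, htend⟩ := hb ω hω
      refine ENNReal.Tendsto.mul ((hF _ hω).tendsto.comp htend) (Or.inr (expNeg_ne_top _))
        ((continuous_expNeg.tendsto _).comp ?_) (Or.inr (ne_top_of_le_ne_top ENNReal.one_ne_top (hF1 _)))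
      exact ENNReal.Tendsto.const_mul ((hwc _ hω).tendsto.comp htend) (Or.inr ENNReal.ofReal_ne_top)
  exact tendsto_nhds_unique hL (hR.congr fun m => (hgrid m).symm)

end IsHalfLinePPP
end HalfLine
-- Path loss integrals
section Integrals

lemma integrableOn_one_div_one_add_rpow {a : ℝ} (ha : 1 < a) :
    IntegrableOn (fun ν : ℝ => 1 / (1 + ν ^ a)) (Ioi 0) := by
  have hm : Measurable fun ν : ℝ => 1 / (1 + ν ^ a) := by fun_prop
  rw [← Ioc_union_Ioi_eq_Ioi (zero_le_one' ℝ)]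
  refine IntegrableOn.union ?_ ?_
  · refine Measure.integrableOn_of_bounded (M := 1) (by simp) hm.aestronglyMeasurable ?_
    filter_upwards [ae_restrict_mem measurableSet_Ioc] with ν hν
    have := Real.rpow_nonneg hν.1.le a
    rw [Real.norm_of_nonneg (by positivity), div_le_one (by positivity)]
    linarith
  · refine (integrableOn_Ioi_rpow_of_lt (neg_lt_neg ha) zero_lt_one).mono'
      hm.aestronglyMeasurable ?_
    filter_upwards [ae_restrict_mem measurableSet_Ioi] with ν hν
    have h0 : (0 : ℝ) < ν := zero_lt_one.trans hν
    have := Real.rpow_pos_of_pos h0 a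
    rw [Real.norm_of_nonneg (by positivity), Real.rpow_neg h0.le, ← one_div]
    gcongr
    linarith

lemma one_sub_inv_one_add_ofReal {x : ℝ} (hx : 0 ≤ x) :
    1 - (1 + ENNReal.ofReal x)⁻¹ = ENNReal.ofReal (x / (1 + x)) := by
  rw [← ENNReal.ofReal_one, ← ENNReal.ofReal_add zero_le_one hx,
    ← ENNReal.ofReal_inv_of_pos (by positivity), ← ENNReal.ofReal_sub _ (by positivity)]
  congr 1
  field_simp
  ring

/-- Substitute `v = s ν`. The free lower limit `p` covers interference from all distances, `p = 0`,
as well as from beyond the serving station. -/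
lemma lintegral_one_sub_inv_one_add_rpow {a : ℝ} (ha : 1 < a) {s p : ℝ} (hs : 0 < s) (hp : 0 ≤ p) :
    ∫⁻ v in Ioi p, (1 - (1 + ENNReal.ofReal ((s / v) ^ a))⁻¹) =
      ENNReal.ofReal (s * ∫ ν in Ioi (s⁻¹ * p), 1 / (1 + ν ^ a)) := by
  have h1 : ∀ v ∈ Ioi p, 1 - (1 + ENNReal.ofReal ((s / v) ^ a))⁻¹ =
      ENNReal.ofReal (1 / (1 + (s⁻¹ * v) ^ a)) := fun v hv => by
    have hv : 0 < v := hp.trans_lt hv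
    have hx : 0 < (s / v) ^ a := Real.rpow_pos_of_pos (by positivity) a
    rw [one_sub_inv_one_add_ofReal hx.le]
    congr 1
    have : s⁻¹ * v = (s / v)⁻¹ := by field_simp
    rw [this, Real.inv_rpow (by positivity)]
    field_simp
    ring
  have hint : IntegrableOn (fun v => 1 / (1 + (s⁻¹ * v) ^ a)) (Ioi p) :=
    (integrableOn_Ioi_comp_mul_left_iff (fun ν : ℝ => 1 / (1 + ν ^ a)) p (inv_pos.2 hs)).2
      ((integrableOn_one_div_one_add_rpow ha).mono_set (Ioi_subset_Ioi (by positivity)))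
  rw [setLIntegral_congr_fun measurableSet_Ioi h1, ← ofReal_integral_eq_lintegral_ofReal hint]
  · rw [integral_comp_mul_left_Ioi (fun ν : ℝ => 1 / (1 + ν ^ a)) p (inv_pos.2 hs), inv_inv,
      smul_eq_mul]
  · filter_upwards [ae_restrict_mem measurableSet_Ioi] with v hv
    have hv : 0 < v := hp.trans_lt hv
    have := Real.rpow_nonneg (show 0 ≤ s⁻¹ * v by positivity) a
    simp only [Pi.zero_apply]
    positivity

lemma rho_nonneg (α β : ℝ) (hβ : 0 ≤ β) : 0 ≤ rho α β :=
  setIntegral_nonneg measurableSet_Ioi fun ν hν => by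
    have : 0 < ν := (Real.rpow_nonneg hβ _).trans_lt hν
    positivity

lemma rhoInf_nonneg (α : ℝ) : 0 ≤ rhoInf α :=
  setIntegral_nonneg measurableSet_Ioi fun ν (hν : 0 < ν) => by positivity

/-- The path loss integral beyond distance `√u`. -/
lemma setLIntegral_Ioi_pathLoss {α : ℝ} (hα : 2 < α) {β u : ℝ} (hβ : 0 < β) (hu : 0 < u) :
    ∫⁻ v in Ioi u, (1 - (1 + ENNReal.ofReal (β * (u / v) ^ (α / 2)))⁻¹) =
      ENNReal.ofReal (β ^ (2 / α) * u * rho α β) := by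
  have hb : 0 < β ^ (2 / α) := Real.rpow_pos_of_pos hβ _
  have h := lintegral_one_sub_inv_one_add_rpow (a := α / 2) (by linarith)
    (s := β ^ (2 / α) * u) (by positivity) hu.le
  -- After rescaling, the cutoff no longer depends on `u`: it is the lower limit in `rho`.
  have hlow : (β ^ (2 / α) * u)⁻¹ * u = β ^ (-(2 / α)) := by
    rw [Real.rpow_neg hβ.le]; field_simp
  rw [hlow] at h
  rw [rho, ← h]
  refine setLIntegral_congr_fun measurableSet_Ioi fun v hv => ?_
  have hv : 0 < v := hu.trans hv
  have hpow : (β ^ (2 / α)) ^ (α / 2) = β := by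
    rw [← Real.rpow_mul hβ.le, div_mul_div_cancel₀ (by linarith)]
    simp
  simp only [mul_div_assoc]
  rw [Real.mul_rpow hb.le (by positivity), hpow]

lemma setLIntegral_Ioi_zero_pathLoss {α : ℝ} (hα : 2 < α) {κ : ℝ} (hκ : 0 ≤ κ) :
    ∫⁻ v in Ioi 0, (1 - (1 + ENNReal.ofReal (κ * v ^ (-(α / 2))))⁻¹) =
      ENNReal.ofReal (κ ^ (2 / α) * rhoInf α) := by
  -- Zero is included because transmit powers are only known to be nonnegative.
  rcases hκ.eq_or_lt with rfl | hκ
  · have : (0 : ℝ) ^ (2 / α) = 0 := Real.zero_rpow (by positivity)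
    simp [this]
  have hb : 0 < κ ^ (2 / α) := Real.rpow_pos_of_pos hκ _
  have h := lintegral_one_sub_inv_one_add_rpow (a := α / 2) (by linarith) hb le_rfl
  rw [mul_zero] at h
  rw [rhoInf, ← h]
  refine setLIntegral_congr_fun measurableSet_Ioi fun v (hv : 0 < v) => ?_
  have hpow : (κ ^ (2 / α)) ^ (α / 2) = κ := by
    rw [← Real.rpow_mul hκ.le, div_mul_div_cancel₀ (by linarith)]
    simp
  rw [Real.div_rpow hb.le hv.le, hpow, Real.rpow_neg hv.le, ← div_eq_mul_inv]

end Integrals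

/-! ### Laplace transforms and races of exponential variables -/

section Exponential

/-- The product of the two exponentials is `1 / (1 + k)` times the density of rate `1 + k`, which
has mass one. -/
lemma lintegral_expNeg_mul_expMeasure {k : ℝ} (hk : 0 ≤ k) :
    ∫⁻ x, expNeg (ENNReal.ofReal (k * x)) ∂expMeasure 1 = (1 + ENNReal.ofReal k)⁻¹ := by
  have hk' : 0 < 1 + k := by positivity
  rw [lintegral_expMeasure (by fun_prop)]
  have h1 := lintegral_expMeasure (r := 1 + k) (measurable_const (a := (1 : ℝ≥0∞)))
  have := isProbabilityMeasure_expMeasure hk'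
  rw [lintegral_const, measure_univ, mul_one] at h1
  have h2 : ∀ x ∈ Ioi (0 : ℝ), ENNReal.ofReal (1 * Real.exp (-(1 * x))) *
        expNeg (ENNReal.ofReal (k * x)) =
      (1 + ENNReal.ofReal k)⁻¹ *
        (ENNReal.ofReal ((1 + k) * Real.exp (-((1 + k) * x))) * 1) := fun x (hx : 0 < x) => by
    rw [← ENNReal.ofReal_one, ← ENNReal.ofReal_add zero_le_one hk,
      ← ENNReal.ofReal_inv_of_pos hk', expNeg_ofReal (by positivity),
      ← ENNReal.ofReal_mul (by positivity), ← ENNReal.ofReal_mul (by positivity),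
      ← ENNReal.ofReal_mul (by positivity), one_mul, one_mul, mul_one, inv_mul_cancel_left₀ hk'.ne',
      ← Real.exp_add]
    congr 2; ring
  rw [setLIntegral_congr_fun measurableSet_Ioi h2, lintegral_const_mul _ (by fun_prop), ← h1,
    mul_one]

/-- The Rayleigh mechanism: the tail of a unit exponential is an exponential, so exceeding an
independent random level has as probability a Laplace transform of that level. The level may be `∞`.
-/
lemma expMeasure_one_lt_ofReal (K : ℝ≥0∞) :
    expMeasure 1 {x | K < ENNReal.ofReal x} = expNeg K := by
  induction K with
  | top => simp
  | coe k =>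
    have : {x : ℝ | (k : ℝ≥0∞) < ENNReal.ofReal x} = Ioi (k : ℝ) := by
      ext x
      rw [← ENNReal.ofReal_coe_nnreal]
      exact ENNReal.ofReal_lt_ofReal_iff_of_nonneg k.2
    rw [this, expMeasure_Ioi one_pos k.coe_nonneg, one_mul, ENNReal.ofReal_coe_nnreal]

instance : IsProbabilityMeasure (expMeasure 1) := isProbabilityMeasure_expMeasure one_pos

/-- The probability that one exponential variable exceeds a weighted sum of independent ones. -/
lemma infinitePi_expMeasure_tsum_lt (j : ℕ) (K : ℝ≥0∞) {x : ℕ → ℝ} (hx : ∀ n, 0 ≤ x n) :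
    (Measure.infinitePi fun _ : ℕ => expMeasure 1)
        {y | K + ∑' n, (if n = j then 0 else ENNReal.ofReal (x n * y n)) < ENNReal.ofReal (y j)} =
      expNeg K * expNeg (∑' n, if n = j then 0 else negLog (1 + ENNReal.ofReal (x n))⁻¹) := by
  set P := Measure.infinitePi fun _ : ℕ => expMeasure 1
  let T : (ℕ → ℝ) → ℝ≥0∞ := fun y => K + ∑' n, if n = j then 0 else ENNReal.ofReal (x n * y n)
  -- The level omits coordinate `j`, hence is measurable for the σ-algebra generated by the other
  -- coordinates, which is independent of coordinate `j`.
  let m : ℕ → MeasurableSpace (ℕ → ℝ) := fun n => MeasurableSpace.comap (fun y => y n) inferInstance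
  have hTm : Measurable[⨆ n ∈ ({j}ᶜ : Set ℕ), m n] T := by
    let _ : MeasurableSpace (ℕ → ℝ) := ⨆ n ∈ ({j}ᶜ : Set ℕ), m n
    refine Measurable.const_add (Measurable.tsum fun n => ?_) K
    by_cases hn : n = j
    · simp only [hn, if_true]; exact measurable_const
    · simp only [hn, if_false]
      have : Measurable fun y : ℕ → ℝ => y n :=
        Measurable.mono (comap_measurable _) (le_iSup₂_of_le n (by simpa using hn) le_rfl) le_rfl
      exact ENNReal.measurable_ofReal.comp (this.const_mul _)
  have hTm' : Measurable T := by
    refine Measurable.const_add (Measurable.tsum fun n => ?_) K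
    split_ifs <;> fun_prop
  have hi : iIndepFun (fun n (y : ℕ → ℝ) => y n) P :=
    iIndepFun_infinitePi (X := fun _ y => y) (fun _ => measurable_id)
  have hind : IndepFun T (fun y => y j) P := by
    rw [IndepFun_iff_Indep]
    have h := indep_iSup_of_disjoint (m := m) (fun n => (measurable_pi_apply n).comap_le)
      ((iIndepFun_iff_iIndep _ _ _).1 hi) (S := {j}ᶜ) (T := {j}) disjoint_compl_left
    refine indep_of_indep_of_le_left (indep_of_indep_of_le_right h ?_) hTm.comap_le
    simp [m]
  have hset : MeasurableSet {p : ℝ≥0∞ × ℝ | p.1 < ENNReal.ofReal p.2} :=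
    measurableSet_lt (by fun_prop) (by fun_prop)
  have h1 := lintegral_comp_prodMk_of_indepFun hTm'.aemeasurable
    (measurable_pi_apply j).aemeasurable hind
    (F := {p : ℝ≥0∞ × ℝ | p.1 < ENNReal.ofReal p.2}.indicator 1) (measurable_one.indicator hset)
  rw [Measure.infinitePi_map_eval] at h1
  have h2 : ∀ t : ℝ≥0∞, ∫⁻ v, {p : ℝ≥0∞ × ℝ | p.1 < ENNReal.ofReal p.2}.indicator 1 (t, v)
      ∂expMeasure 1 = expNeg t := fun t => by
    rw [← expMeasure_one_lt_ofReal t, ← lintegral_indicator_one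
      (measurableSet_lt measurable_const (by fun_prop))]
    rfl
  simp_rw [h2] at h1
  have h3 : ∫⁻ y, {p : ℝ≥0∞ × ℝ | p.1 < ENNReal.ofReal p.2}.indicator 1 (T y, y j) ∂P =
      P {y | T y < ENNReal.ofReal (y j)} := by
    rw [← lintegral_indicator_one (measurableSet_lt hTm' (by fun_prop))]
    rfl
  rw [h3] at h1
  rw [h1]
  simp only [T, expNeg_add]
  rw [lintegral_const_mul]
  · congr 1
    rw [lintegral_expNeg_tsum_infinitePi (expMeasure 1)
      (g := fun n y => if n = j then 0 else ENNReal.ofReal (x n * y))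
      (fun n => by split_ifs <;> fun_prop)]
    congr 1
    refine tsum_congr fun n => ?_
    split_ifs
    · simp [negLog]
    · rw [lintegral_expNeg_mul_expMeasure (hx n)]
  · refine measurable_expNeg.comp (Measurable.tsum fun n => ?_)
    split_ifs <;> fun_prop

end Exponential
lemma rpow_neg_eq_sq_rpow {r : ℝ} (hr : 0 ≤ r) (α : ℝ) : r ^ (-α) = (r ^ 2) ^ (-(α / 2)) := by
  rw [← Real.rpow_natCast r 2, ← Real.rpow_mul hr]
  congr 1
  push_cast
  ring

/-! ### Shot noise and the moment of the allowed power -/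

section ShotNoise

variable {Ω : Type*} [MeasurableSpace Ω] {Pr : Measure Ω} [IsProbabilityMeasure Pr]

/-- The Laplace transform of the total power received from a Poisson network whose stations carry
random transmit powers and Rayleigh fading gains. -/
theorem lintegral_expNeg_shotNoise {X : ℕ → Ω → Plane} {c : ℝ} (hc : 0 ≤ c)
    (hX : IsHomogeneousPPP X c Pr) {G P : ℕ → Ω → ℝ} {π₀ : Measure ℝ} [IsProbabilityMeasure π₀]
    (hG : ∀ n, HasLaw (G n) (expMeasure 1) Pr) (hP : ∀ n, HasLaw (P n) π₀ Pr)
    (hGP : ∀ n, IndepFun (G n) (P n) Pr) (hi : iIndepFun (fun n ω => (G n ω, P n ω)) Pr)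
    (hXM : IndepFun (fun ω n => X n ω) (fun ω n => (G n ω, P n ω)) Pr)
    (hπ₀ : ∀ᵐ p ∂π₀, 0 ≤ p) {α : ℝ} (hα : 2 < α) {κ : ℝ} (hκ : 0 ≤ κ) :
    ∫⁻ ω, expNeg (∑' n, ENNReal.ofReal (κ * (P n ω * G n ω * ‖X n ω‖ ^ (-α)))) ∂Pr =
      expNeg (ENNReal.ofReal (Real.pi * c * κ ^ (2 / α) * rhoInf α) *
        ∫⁻ p, ENNReal.ofReal (p ^ (2 / α)) ∂π₀) := by
  have hU := hX.sq_norm hc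
  have hM : ∀ n, HasLaw (fun ω => (G n ω, P n ω)) ((expMeasure 1).prod π₀) Pr := fun n =>
    { aemeasurable := (hG n).aemeasurable.prodMk (hP n).aemeasurable
      map_eq := by
        rw [(hGP n).map_prod_eq_prod_map_map (hG n).aemeasurable (hP n).aemeasurable,
          (hG n).map_eq, (hP n).map_eq] }
  have hUM : IndepFun (fun ω n => ‖X n ω‖ ^ 2) (fun ω n => (G n ω, P n ω)) Pr :=
    hXM.comp (φ := fun x n => ‖x n‖ ^ 2) (ψ := id) (by fun_prop) measurable_id
  have key := IsPoissonProcess.marked_laplace_functional hU hM hi hUM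
    (g := fun q : ℝ × ℝ × ℝ => ENNReal.ofReal (κ * (q.2.2 * q.2.1 * q.1 ^ (-(α / 2)))))
    (by fun_prop)
  simp_rw [rpow_neg_eq_sq_rpow (norm_nonneg _) α]
  rw [key]
  congr 1
  have hinner : ∀ v : ℝ, 0 < v →
      1 - ∫⁻ m : ℝ × ℝ, expNeg (ENNReal.ofReal (κ * (m.2 * m.1 * v ^ (-(α / 2)))))
        ∂((expMeasure 1).prod π₀) =
      ∫⁻ p, (1 - (1 + ENNReal.ofReal (κ * p * v ^ (-(α / 2))))⁻¹) ∂π₀ := fun v hv => by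
    have hm : Measurable fun p : ℝ => (1 + ENNReal.ofReal (κ * p * v ^ (-(α / 2))))⁻¹ := by fun_prop
    have hle : ∀ x : ℝ≥0∞, (1 + x)⁻¹ ≤ 1 := fun x => ENNReal.inv_le_one.2 le_self_add
    rw [lintegral_sub hm, lintegral_const, measure_univ, mul_one]
    · congr 1
      rw [lintegral_prod_symm _ (by fun_prop)]
      refine lintegral_congr_ae ?_
      filter_upwards [hπ₀] with p hp
      have hk : 0 ≤ κ * p * v ^ (-(α / 2)) := by positivity
      rw [← lintegral_expNeg_mul_expMeasure hk]
      refine lintegral_congr fun x => ?_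
      congr 2; ring
    · refine ne_top_of_le_ne_top ENNReal.one_ne_top ?_
      simpa using lintegral_mono (μ := π₀) fun p => hle (ENNReal.ofReal (κ * p * v ^ (-(α / 2))))
    · exact ae_of_all _ fun p => hle _
  -- Exchange distance and power: for a fixed power `p` the distance integral scales like `p^{2/α}`,
  -- which is where the moment comes from.
  rw [lintegral_smul_measure, setLIntegral_congr_fun measurableSet_Ioi hinner,
    lintegral_lintegral_swap (by fun_prop), smul_eq_mul]
  have hswap : ∫⁻ p, (∫⁻ v in Ioi (0 : ℝ), (1 - (1 + ENNReal.ofReal (κ * p * v ^ (-(α / 2))))⁻¹)) ∂π₀ =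
      ∫⁻ p, ENNReal.ofReal (κ ^ (2 / α) * rhoInf α) * ENNReal.ofReal (p ^ (2 / α)) ∂π₀ := by
    refine lintegral_congr_ae ?_
    filter_upwards [hπ₀] with p hp
    rw [setLIntegral_Ioi_zero_pathLoss hα (mul_nonneg hκ hp), Real.mul_rpow hκ hp,
      ← ENNReal.ofReal_mul (mul_nonneg (by positivity) (rhoInf_nonneg α))]
    congr 1; ring
  rw [hswap, lintegral_const_mul _ (by fun_prop), ← mul_assoc, ← ENNReal.ofReal_mul (by positivity)]
  congr 2; ring

/-- The Laplace transform at `κ = 1 / (n + 1)` tends to one, because its exponent is a finite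
constant times `κ^{2/α}`. -/
lemma ae_shotNoise_ne_top {X : ℕ → Ω → Plane} {c : ℝ} (hc : 0 ≤ c)
    (hX : IsHomogeneousPPP X c Pr) {G P : ℕ → Ω → ℝ} {π₀ : Measure ℝ} [IsProbabilityMeasure π₀]
    (hG : ∀ n, HasLaw (G n) (expMeasure 1) Pr) (hP : ∀ n, HasLaw (P n) π₀ Pr)
    (hGP : ∀ n, IndepFun (G n) (P n) Pr) (hi : iIndepFun (fun n ω => (G n ω, P n ω)) Pr)
    (hXM : IndepFun (fun ω n => X n ω) (fun ω n => (G n ω, P n ω)) Pr)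
    (hπ₀ : ∀ᵐ p ∂π₀, 0 ≤ p) {α : ℝ} (hα : 2 < α)
    (hmom : ∫⁻ p, ENNReal.ofReal (p ^ (2 / α)) ∂π₀ ≠ ∞) :
    ∀ᵐ ω ∂Pr, ∑' n, ENNReal.ofReal (P n ω * G n ω * ‖X n ω‖ ^ (-α)) ≠ ∞ := by
  refine ae_ne_top_of_tendsto_laplace (c := fun n : ℕ => ENNReal.ofReal (1 / ((n : ℝ) + 1)))
    (AEMeasurable.tsum fun n => ?_) (fun n => ?_) ?_
  · have h1 := (hP n).aemeasurable
    have h2 := (hG n).aemeasurable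
    have h3 := (IsPoissonProcess.measurable hX n).aemeasurable (μ := Pr)
    fun_prop
  · exact (ENNReal.ofReal_pos.2 (by positivity)).ne'
  · have h1 : ∀ n : ℕ, ∫⁻ ω, expNeg (ENNReal.ofReal (1 / ((n : ℝ) + 1)) *
        ∑' n, ENNReal.ofReal (P n ω * G n ω * ‖X n ω‖ ^ (-α))) ∂Pr =
        expNeg (ENNReal.ofReal (Real.pi * c * (1 / ((n : ℝ) + 1)) ^ (2 / α) * rhoInf α) *
        ∫⁻ p, ENNReal.ofReal (p ^ (2 / α)) ∂π₀) := fun n => by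
      have hn : (0 : ℝ) ≤ 1 / ((n : ℝ) + 1) := by positivity
      simp_rw [← ENNReal.tsum_mul_left, ← ENNReal.ofReal_mul hn]
      exact lintegral_expNeg_shotNoise hc hX hG hP hGP hi hXM hπ₀ hα hn
    simp_rw [h1]
    have h2 : Tendsto (fun n : ℕ => (1 / ((n : ℝ) + 1)) ^ (2 / α)) atTop (𝓝 0) := by
      have := (tendsto_one_div_add_atTop_nhds_zero_nat (𝕜 := ℝ)).rpow_const (p := 2 / α)
        (Or.inr (by positivity))
      rwa [Real.zero_rpow (by positivity)] at this
    have h3 := ENNReal.Tendsto.mul_const (ENNReal.tendsto_ofReal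
      ((h2.const_mul (Real.pi * c)).mul_const (rhoInf α))) (Or.inr hmom)
    simpa [Function.comp_def] using (continuous_expNeg.tendsto _).comp h3

/-- The allowed power of a station that must not disturb a Poisson process of users has a finite
moment of order `2 / α`. -/
theorem lintegral_div_iSup_rpow_ne_top {Y : ℕ → Ω → Plane} {μ : ℝ} (hμ : 0 < μ)
    (hY : IsHomogeneousPPP Y μ Pr) {G : ℕ → Ω → ℝ} (hG : ∀ n, HasLaw (G n) (expMeasure 1) Pr)
    (hi : iIndepFun G Pr) (hYG : IndepFun (fun ω n => Y n ω) (fun ω n => G n ω) Pr)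
    (x : Plane) {ζ : ℝ} (hζ : 0 < ζ) {α : ℝ} (hα : 2 < α) :
    ∫⁻ ω, ENNReal.ofReal ((ζ / ⨆ i, G i ω * ‖x - Y i ω‖ ^ (-α)) ^ (2 / α)) ∂Pr ≠ ∞ := by
  -- Seen from `x` the users are still a homogeneous Poisson process, as `y ↦ x - y` preserves area.
  have hXY : IsHomogeneousPPP (fun n ω => x - Y n ω) μ Pr := by
    have := IsPoissonProcess.map hY (φ := fun y => x - y) (by fun_prop)
    rwa [Measure.map_smul, (volume.measurePreserving_sub_left x).map_eq] at this
  have hV := hXY.sq_norm hμ.le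
  have hφ : Measurable (fun (y : ℕ → Plane) (n : ℕ) => ‖x - y n‖ ^ 2) := by
    refine measurable_pi_lambda _ fun n => ?_
    have h1 : Measurable fun y : ℕ → Plane => y n := measurable_pi_apply n
    have h2 := (h1.const_sub x).norm
    exact h2.pow_const 2
  have hVG : IndepFun (fun ω n => ‖x - Y n ω‖ ^ 2) (fun ω n => G n ω) Pr :=
    hYG.comp hφ measurable_id
  have hYm : ∀ n, AEMeasurable (Y n) Pr := fun n =>
    (IsPoissonProcess.measurable hY n).aemeasurable
  have hGm := fun n => (hG n).aemeasurable
  have hG0 : ∀ᵐ ω ∂Pr, ∀ n, 0 ≤ G n ω := ae_all_iff.2 fun n => by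
    have h := expMeasure_Iio_zero 1
    rw [← (hG n).map_eq, Measure.map_apply_of_aemeasurable (hG n).aemeasurable measurableSet_Iio] at h
    rw [ae_iff]
    simpa [preimage, Iio] using h
  have hH0 : ∀ᵐ ω ∂Pr, 0 ≤ ⨆ i, G i ω * ‖x - Y i ω‖ ^ (-α) := by
    filter_upwards [hG0] with ω hω
    exact Real.iSup_nonneg fun i => mul_nonneg (hω i) (by positivity)
  have hHm : AEMeasurable (fun ω => ⨆ i, G i ω * ‖x - Y i ω‖ ^ (-α)) Pr :=
    AEMeasurable.iSup fun i => by have := hYm i; have := hGm i; fun_prop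
  -- If `P^{2/α} > u`, no user of gain above one lies within squared distance `R = u ζ^{-2/α}`: such
  -- a user alone would push the maximum above `ζ / u^{α/2}`. A gain exceeds one with probability
  -- `e^{-1}`, so this void probability is `exp (-πμ e^{-1} R)`.
  have htail : ∀ u : ℝ, 0 < u →
      Pr {ω | u < (ζ / ⨆ i, G i ω * ‖x - Y i ω‖ ^ (-α)) ^ (2 / α)} ≤
        ENNReal.ofReal (Real.exp (-((Real.pi * μ * Real.exp (-1) * ζ ^ (-(2 / α))) * u))) := by
    intro u hu
    set R : ℝ := u * ζ ^ (-(2 / α)) with hR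
    have hRpos : 0 < R := by positivity
    let B : Set (ℝ × ℝ) := Iic R ×ˢ Ioi 1
    have hB : MeasurableSet B := measurableSet_Iic.prod measurableSet_Ioi
    have key := IsPoissonProcess.marked_laplace_functional hV hG hi hVG
      (g := B.indicator fun _ => ∞) (measurable_const.indicator hB)
    have hRHS : expNeg (∫⁻ v, (1 - ∫⁻ m, expNeg (B.indicator (fun _ => ∞) (v, m)) ∂expMeasure 1)
        ∂(ENNReal.ofReal (Real.pi * μ) • (volume : Measure ℝ).restrict (Ioi 0))) =
        ENNReal.ofReal (Real.exp (-((Real.pi * μ * Real.exp (-1) * ζ ^ (-(2 / α))) * u))) := by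
      have h1 : ∀ v, 1 - ∫⁻ m, expNeg (B.indicator (fun _ => ∞) (v, m)) ∂expMeasure 1 =
          (Iic R).indicator (fun _ => ENNReal.ofReal (Real.exp (-1))) v := fun v => by
        by_cases hv : v ≤ R
        · have h2 : ∀ m, expNeg (B.indicator (fun _ => ∞) (v, m)) = (Iic 1).indicator 1 m := fun m => by
            by_cases hm : 1 < m
            · simp [B, indicator, hv, hm, not_le.2 hm]
            · simp [B, indicator, hm, not_lt.1 hm]
          simp_rw [h2]
          rw [lintegral_indicator_one measurableSet_Iic, ← prob_compl_eq_one_sub measurableSet_Iic,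
            compl_Iic, expMeasure_Ioi one_pos zero_le_one, expNeg_ofReal (by norm_num), mul_one,
            indicator_of_mem (by exact hv)]
        · simp [B, indicator, hv]
      simp_rw [h1]
      rw [lintegral_smul_measure, lintegral_indicator_const measurableSet_Iic,
        Measure.restrict_apply measurableSet_Iic, Iic_inter_Ioi, Real.volume_Ioc, sub_zero,
        smul_eq_mul, ← ENNReal.ofReal_mul (by positivity), ← ENNReal.ofReal_mul (by positivity),
        expNeg_ofReal (by positivity), hR]
      congr 3; ring
    rw [← hRHS, ← key]
    have hm : NullMeasurableSet {ω | u < (ζ / ⨆ i, G i ω * ‖x - Y i ω‖ ^ (-α)) ^ (2 / α)} Pr :=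
      nullMeasurableSet_lt (by fun_prop) (by fun_prop)
    rw [← lintegral_indicator_one₀ hm]
    refine lintegral_mono_ae ?_
    filter_upwards [hH0, hV.ae_pos] with ω hH hVpos
    by_cases hω : u < (ζ / ⨆ i, G i ω * ‖x - Y i ω‖ ^ (-α)) ^ (2 / α)
    · rw [indicator_of_mem (by exact hω)]
      set H := ⨆ i, G i ω * ‖x - Y i ω‖ ^ (-α) with hHdef
      -- A zero maximum is excluded, because division by zero returns zero power. This also excludes
      -- an unbounded family, whose real supremum is zero.
      have hHpos : 0 < H := by
        refine lt_of_le_of_ne hH fun h0 => ?_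
        rw [← h0, div_zero, Real.zero_rpow (by positivity)] at hω
        exact hω.not_gt hu
      have hbdd : BddAbove (range fun i => G i ω * ‖x - Y i ω‖ ^ (-α)) := by
        by_contra h
        rw [hHdef, Real.iSup_of_not_bddAbove h] at hHpos
        exact lt_irrefl _ hHpos
      have h1 : u ^ (α / 2) < ζ / H := by
        have := Real.rpow_lt_rpow hu.le hω (show 0 < α / 2 by linarith)
        rwa [← Real.rpow_mul (by positivity), div_mul_div_cancel₀' (by norm_num) α,
          div_self (by linarith), Real.rpow_one] at this
      have h2 : R ^ (α / 2) = u ^ (α / 2) / ζ := by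
        rw [hR, Real.mul_rpow hu.le (by positivity), ← Real.rpow_mul hζ.le,
          neg_mul, div_mul_div_cancel₀' (by norm_num) α, div_self (by linarith), Real.rpow_neg_one,
          ← div_eq_mul_inv]
      have h3 : ∀ i, (‖x - Y i ω‖ ^ 2, G i ω) ∉ B := by
        rintro i ⟨hi1, hi2⟩
        simp only [mem_Iic, mem_Ioi] at hi1 hi2
        have hvi := hVpos i
        have h4 : G i ω * ‖x - Y i ω‖ ^ (-α) ≤ H := le_ciSup hbdd i
        rw [rpow_neg_eq_sq_rpow (norm_nonneg _), Real.rpow_neg hvi.le, ← div_eq_mul_inv,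
          div_le_iff₀ (Real.rpow_pos_of_pos hvi _)] at h4
        have h5 : H * (‖x - Y i ω‖ ^ 2) ^ (α / 2) ≤ H * R ^ (α / 2) := by
          gcongr
        rw [lt_div_iff₀ hHpos] at h1
        rw [h2] at h5
        have h6 : H * (u ^ (α / 2) / ζ) < 1 := by
          rw [mul_div_assoc', div_lt_one hζ]; linarith
        linarith
      have h7 : ∑' n, B.indicator (fun _ => (∞ : ℝ≥0∞)) (‖x - Y n ω‖ ^ 2, G n ω) = 0 := by
        rw [ENNReal.tsum_eq_zero]
        exact fun i => indicator_of_notMem (h3 i) _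
      rw [h7]; simp
    · rw [indicator_of_notMem (by exact hω)]; exact zero_le
  rw [lintegral_eq_lintegral_meas_lt Pr _ (by fun_prop)]
  · refine ne_top_of_le_ne_top ?_ (setLIntegral_mono (by fun_prop) fun u hu => htail u hu)
    exact ((integrableOn_exp_mul_Ioi (a := -(Real.pi * μ * Real.exp (-1) * ζ ^ (-(2 / α))))
      (neg_neg_of_pos (by positivity)) 0).congr_fun (fun u _ => by simp only [neg_mul])
      measurableSet_Ioi).lintegral_lt_top.ne
  · filter_upwards [hH0] with ω hω
    simp only [Pi.zero_apply]
    positivity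

end ShotNoise
section NegLog

lemma negLog_antitone : Antitone negLog := fun x y h => by
  rw [negLog, negLog]
  exact EReal.toENNReal_le_toENNReal (EReal.neg_le_neg_iff.2 (ENNReal.log_le_log h))

lemma continuous_negLog : Continuous negLog :=
  EReal.continuous_toENNReal.comp (continuous_neg.comp ENNReal.continuous_log)

lemma inv_one_add_le_one (x : ℝ≥0∞) : (1 + x)⁻¹ ≤ 1 := ENNReal.inv_le_one.2 le_self_add

lemma expNeg_negLog_inv_one_add (x : ℝ≥0∞) : expNeg (negLog (1 + x)⁻¹) = (1 + x)⁻¹ :=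
  expNeg_negLog (inv_one_add_le_one x)

lemma negLog_inv_one_add_ne_top {x : ℝ≥0∞} (hx : x ≠ ∞) : negLog (1 + x)⁻¹ ≠ ∞ := by
  rw [Ne, ← expNeg_eq_zero_iff, expNeg_negLog_inv_one_add]
  simpa using hx

end NegLog

/-! ### The serving station -/

section Serving

/-- The index of the station that provides the maximal average received power. -/
noncomputable def servingIndex (p α : ℝ) (x : ℕ → Plane) : ℕ :=
  sInf {f : ℕ | ∀ j, p * ‖x j‖ ^ (-α) ≤ p * ‖x f‖ ^ (-α)}

lemma measurable_servingIndex (p α : ℝ) : Measurable (servingIndex p α) := by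
  have hx : ∀ n : ℕ, Measurable fun x : ℕ → Plane => p * ‖x n‖ ^ (-α) := fun n => by
    have h1 : Measurable fun x : ℕ → Plane => x n := measurable_pi_apply n
    exact (h1.norm.pow_const _).const_mul p
  have hS : ∀ n : ℕ, MeasurableSet {x : ℕ → Plane | ∀ j, p * ‖x j‖ ^ (-α) ≤ p * ‖x n‖ ^ (-α)} :=
    fun n => by
      simp_rw [ofPred_forall]
      exact MeasurableSet.iInter fun j => measurableSet_le (hx j) (hx n)
  refine measurable_of_Iic fun n => ?_
  -- The last intersection is the case without a maximizer, where `sInf ∅ = 0`.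
  have h : servingIndex p α ⁻¹' Iic n =
      (⋃ m ∈ Finset.range (n + 1), {x | ∀ j, p * ‖x j‖ ^ (-α) ≤ p * ‖x m‖ ^ (-α)}) ∪
      ⋂ m, {x | ∀ j, p * ‖x j‖ ^ (-α) ≤ p * ‖x m‖ ^ (-α)}ᶜ := by
    ext x
    simp only [mem_preimage, mem_Iic, mem_union, mem_iUnion, mem_iInter, mem_compl_iff,
      Finset.mem_range, servingIndex]
    constructor
    · intro hle
      by_cases hne : {f : ℕ | ∀ j, p * ‖x j‖ ^ (-α) ≤ p * ‖x f‖ ^ (-α)}.Nonempty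
      · exact Or.inl ⟨_, Nat.lt_succ_of_le hle, Nat.sInf_mem hne⟩
      · exact Or.inr fun m hm => hne ⟨m, hm⟩
    · rintro (⟨m, hm, hmem⟩ | hall)
      · exact (Nat.sInf_le hmem).trans (Nat.le_of_lt_succ hm)
      · have : {f : ℕ | ∀ j, p * ‖x j‖ ^ (-α) ≤ p * ‖x f‖ ^ (-α)} = ∅ :=
          eq_empty_of_forall_notMem hall
        rw [this, Nat.sInf_empty]
        exact Nat.zero_le n
  rw [h]
  exact (Finset.measurableSet_biUnion _ fun m _ => hS m).union
    (MeasurableSet.iInter fun m => (hS m).compl)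

lemma forall_sq_norm_servingIndex_le {p α : ℝ} (hp : 0 < p) (hα : 0 < α) {x : ℕ → Plane}
    (hpos : ∀ n, 0 < ‖x n‖ ^ 2) (hmin : ∃ j, ∀ i, ‖x j‖ ^ 2 ≤ ‖x i‖ ^ 2) (i : ℕ) :
    ‖x (servingIndex p α x)‖ ^ 2 ≤ ‖x i‖ ^ 2 := by
  have hiff : ∀ f j, p * ‖x j‖ ^ (-α) ≤ p * ‖x f‖ ^ (-α) ↔ ‖x f‖ ^ 2 ≤ ‖x j‖ ^ 2 := fun f j => by
    rw [mul_le_mul_iff_right₀ hp, rpow_neg_eq_sq_rpow (norm_nonneg _),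
      rpow_neg_eq_sq_rpow (norm_nonneg _)]
    exact Real.rpow_le_rpow_iff_of_neg (hpos j) (hpos f) (by linarith)
  obtain ⟨j, hj⟩ := hmin
  have hne : {f : ℕ | ∀ j, p * ‖x j‖ ^ (-α) ≤ p * ‖x f‖ ^ (-α)}.Nonempty :=
    ⟨j, fun i => (hiff j i).2 (hj i)⟩
  exact (hiff _ i).1 (Nat.sInf_mem hne i)

end Serving

/-! ### Coverage by one Poisson network with external interference -/

section Coverage

variable {Ω : Type*} [MeasurableSpace Ω] {Pr : Measure Ω} [IsProbabilityMeasure Pr]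

/-- The event that the fading gain of the serving station exceeds the normalized interference,
integrated over the gains and over the external interference `J`. -/
lemma measure_fading_race {X : ℕ → Ω → Plane} (hX : ∀ n, Measurable (X n)) {G : ℕ → Ω → ℝ}
    (hG : ∀ n, HasLaw (G n) (expMeasure 1) Pr) (hi : iIndepFun G Pr)
    (hXG : IndepFun (fun ω n => X n ω) (fun ω n => G n ω) Pr)
    {J : Ω → ℝ≥0∞} (hJm : AEMeasurable J Pr)
    (hJ : IndepFun (fun ω => (fun n => X n ω, fun n => G n ω)) J Pr)
    {j : (ℕ → Plane) → ℕ} (hj : Measurable j) {κ : (ℕ → Plane) → ℝ≥0∞} (hκ : Measurable κ)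
    {b : (ℕ → Plane) → ℕ → ℝ} (hb : ∀ n, Measurable fun x => b x n) (hb0 : ∀ x n, 0 ≤ b x n)
    (N : ℝ≥0∞) :
    Pr {ω | κ (fun n => X n ω) * (J ω + N) + ∑' n, (if n = j (fun n => X n ω) then 0 else
        ENNReal.ofReal (b (fun n => X n ω) n * G n ω)) < ENNReal.ofReal (G (j fun n => X n ω) ω)} =
      ∫⁻ ω, expNeg (κ (fun n => X n ω) * N) * (∫⁻ t, expNeg (κ (fun n => X n ω) * t) ∂(Pr.map J)) *
        expNeg (∑' n, if n = j (fun n => X n ω) then 0 else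
          negLog (1 + ENNReal.ofReal (b (fun n => X n ω) n))⁻¹) ∂Pr := by
  have hXm : Measurable fun ω n => X n ω := measurable_pi_iff.2 hX
  have hGm : AEMeasurable (fun ω n => G n ω) Pr :=
    aemeasurable_pi_iff.2 fun n => (hG n).aemeasurable
  have hlaw : Pr.map (fun ω n => G n ω) = Measure.infinitePi fun _ : ℕ => expMeasure 1 := by
    rw [hi.map_fun_eq_infinitePi_map₀ hGm]
    congr 1
    exact funext fun n => (hG n).map_eq
  have := Measure.isProbabilityMeasure_map (μ := Pr) hJm
  let L : ((ℕ → Plane) × (ℕ → ℝ)) × ℝ≥0∞ → ℝ≥0∞ := fun q => κ q.1.1 * (q.2 + N) +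
    ∑' n, (if n = j q.1.1 then 0 else ENNReal.ofReal (b q.1.1 n * q.1.2 n))
  let R : ((ℕ → Plane) × (ℕ → ℝ)) × ℝ≥0∞ → ℝ≥0∞ := fun q => ENNReal.ofReal (q.1.2 (j q.1.1))
  have hLm : Measurable L := by
    refine Measurable.add (by fun_prop) (Measurable.tsum fun n => ?_)
    refine Measurable.ite ?_ measurable_const ?_
    · exact measurableSet_eq_fun measurable_const (hj.comp (by fun_prop))
    · have h1 : Measurable fun q : ((ℕ → Plane) × (ℕ → ℝ)) × ℝ≥0∞ => b q.1.1 n :=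
        (hb n).comp (by fun_prop)
      refine ENNReal.measurable_ofReal.comp (h1.mul ?_)
      fun_prop
  have hRm : Measurable R := by
    have h1 : Measurable fun q : (ℕ → ℝ) × ℕ => q.1 q.2 :=
      measurable_from_prod_countable_left fun n => measurable_pi_apply n
    have h2 : Measurable fun q : ((ℕ → Plane) × (ℕ → ℝ)) × ℝ≥0∞ => (q.1.2, j q.1.1) := by fun_prop
    exact ENNReal.measurable_ofReal.comp (h1.comp h2)
  have hset : MeasurableSet {q | L q < R q} := measurableSet_lt hLm hRm
  -- Independence is used twice: of `J` from stations and gains, then of the gains from the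
  -- stations. For fixed stations the order is exchanged afterwards, so that the gains are averaged
  -- with the external interference held fixed.
  have h1 := lintegral_comp_prodMk_of_indepFun (hXm.aemeasurable.prodMk hGm) hJm hJ
    (F := {q | L q < R q}.indicator 1) (measurable_one.indicator hset)
  have h2 := lintegral_comp_prodMk_of_indepFun hXm.aemeasurable hGm hXG
    (F := fun p => ∫⁻ t, {q | L q < R q}.indicator 1 (p, t) ∂(Pr.map J))
    (measurable_one.indicator hset).lintegral_prod_right'
  have h3 : ∫⁻ ω, {q | L q < R q}.indicator 1 ((fun n => X n ω, fun n => G n ω), J ω) ∂Pr =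
      Pr {ω | κ (fun n => X n ω) * (J ω + N) + ∑' n, (if n = j (fun n => X n ω) then 0 else
        ENNReal.ofReal (b (fun n => X n ω) n * G n ω)) <
          ENNReal.ofReal (G (j fun n => X n ω) ω)} := by
    have hq : AEMeasurable (fun ω => (((fun n => X n ω, fun n => G n ω), J ω) :
        ((ℕ → Plane) × (ℕ → ℝ)) × ℝ≥0∞)) Pr := (hXm.aemeasurable.prodMk hGm).prodMk hJm
    rw [← lintegral_indicator_one₀]
    · rfl
    · exact hq.nullMeasurableSet_preimage hset
  rw [← h3, h1, h2, hlaw]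
  refine lintegral_congr fun ω => ?_
  set x : ℕ → Plane := fun n => X n ω
  rw [lintegral_lintegral_swap]
  · have h4 : ∀ t, ∫⁻ y, {q | L q < R q}.indicator 1 ((x, y), t)
        ∂(Measure.infinitePi fun _ : ℕ => expMeasure 1) =
        expNeg (κ x * (t + N)) * expNeg (∑' n, if n = j x then 0 else
          negLog (1 + ENNReal.ofReal (b x n))⁻¹) := fun t => by
      rw [← infinitePi_expMeasure_tsum_lt (j x) (κ x * (t + N)) (hb0 x),
        ← lintegral_indicator_one]
      · rfl
      · exact (by fun_prop : Measurable fun y : ℕ → ℝ => ((x, y), t)) hset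
    simp_rw [h4, mul_add, expNeg_add]
    rw [lintegral_mul_const _ (by fun_prop), lintegral_mul_const _ (by fun_prop)]
    ring
  · exact ((measurable_one.indicator hset).comp (by fun_prop :
      Measurable fun q : (ℕ → ℝ) × ℝ≥0∞ => ((x, q.1), q.2))).aemeasurable

end Coverage
section Coverage

variable {Ω : Type*} [MeasurableSpace Ω] {Pr : Measure Ω} [IsProbabilityMeasure Pr]

lemma setLIntegral_Ioi_comp_mul {b : ℝ} (hb : 0 < b) (f : ℝ → ℝ≥0∞) :
    ∫⁻ u in Ioi 0, f u = ∫⁻ z in Ioi 0, ENNReal.ofReal b * f (b * z) := by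
  have h := lintegral_image_eq_lintegral_abs_deriv_mul (s := Ioi (0 : ℝ)) (f := fun z => b * z)
    (f' := fun _ => b) measurableSet_Ioi
    (fun x _ => by simpa using ((hasDerivAt_id x).const_mul b).hasDerivWithinAt)
    (fun x _ y _ hxy => mul_left_cancel₀ hb.ne' hxy) f
  rw [image_mul_left_Ioi hb, mul_zero] at h
  simpa [abs_of_pos hb] using h

lemma measurable_apply_servingIndex (p α : ℝ) :
    Measurable fun x : ℕ → Plane => x (servingIndex p α x) := by
  have h1 : Measurable fun q : (ℕ → Plane) × ℕ => q.1 q.2 :=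
    measurable_from_prod_countable_left fun n => measurable_pi_apply n
  exact h1.comp (measurable_id.prodMk (measurable_servingIndex p α))

/-- Averaging over the base stations of the serving operator. -/
lemma lintegral_serving {X : ℕ → Ω → Plane} {c : ℝ} (hc : 0 < c)
    (hX : IsHomogeneousPPP X c Pr) {p α β : ℝ} (hp : 0 < p) (hα : 2 < α) (hβ : 0 < β)
    {F : ℝ → ℝ≥0∞} (hFm : Measurable F) (hF1 : ∀ u, F u ≤ 1) (hF : ∀ u > 0, ContinuousAt F u) :
    ∫⁻ ω, F (‖X (servingIndex p α fun n => X n ω) ω‖ ^ 2) *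
        expNeg (∑' n, if n = servingIndex p α (fun n => X n ω) then 0 else
          negLog (1 + ENNReal.ofReal (β * (‖X (servingIndex p α fun n => X n ω) ω‖ ^ 2 /
            ‖X n ω‖ ^ 2) ^ (α / 2)))⁻¹) ∂Pr =
      ∫⁻ u in Ioi 0, ENNReal.ofReal (Real.pi * c * Real.exp (-(Real.pi * c * u))) *
        (F u * expNeg (ENNReal.ofReal (Real.pi * c * (β ^ (2 / α) * u * rho α β)))) := by
  have hU := hX.sq_norm hc.le
  have hπc : 0 < Real.pi * c := by positivity
  have hα2 : 0 < α / 2 := by linarith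
  -- An interferer at squared distance `v` contributes, after averaging over its gain, the factor
  -- `(1 + β (u / v)^{α/2})⁻¹`. Here `g` is minus the logarithm of this factor and `w` the path loss
  -- integral beyond `u`.
  have key := hU.lintegral_iInf_mul_expNeg_tsum (F := F)
    (g := fun u v => negLog (1 + ENNReal.ofReal (β * (u / v) ^ (α / 2)))⁻¹)
    (w := fun u => ENNReal.ofReal (β ^ (2 / α) * u * rho α β)) hFm
    (by unfold Function.uncurry; fun_prop) (by fun_prop) hF1 hF ?_ ?_ ?_ ?_ ?_ ?_
  · have hL : ∫⁻ ω, F (‖X (servingIndex p α fun n => X n ω) ω‖ ^ 2) *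
        expNeg (∑' n, if n = servingIndex p α (fun n => X n ω) then 0 else
          negLog (1 + ENNReal.ofReal (β * (‖X (servingIndex p α fun n => X n ω) ω‖ ^ 2 /
            ‖X n ω‖ ^ 2) ^ (α / 2)))⁻¹) ∂Pr =
        ∫⁻ ω, F (⨅ n, ‖X n ω‖ ^ 2) * expNeg (∑' n, (Ioi (⨅ n, ‖X n ω‖ ^ 2)).indicator
          (fun v => negLog (1 + ENNReal.ofReal (β * ((⨅ n, ‖X n ω‖ ^ 2) / v) ^ (α / 2)))⁻¹)
          (‖X n ω‖ ^ 2)) ∂Pr := by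
      refine lintegral_congr_ae ?_
      -- Distances are pairwise distinct, so the stations other than the serving one are exactly
      -- those strictly farther away.
      filter_upwards [hU.ae_pos, hU.ae_exists_forall_le, hU.ae_injective] with ω hpos hmin hinj
      set j := servingIndex p α fun n => X n ω
      have hle : ∀ i, ‖X j ω‖ ^ 2 ≤ ‖X i ω‖ ^ 2 :=
        forall_sq_norm_servingIndex_le (x := fun n => X n ω) hp (by linarith) hpos hmin
      have hinf : ⨅ n, ‖X n ω‖ ^ 2 = ‖X j ω‖ ^ 2 :=
        le_antisymm (ciInf_le ⟨0, by rintro _ ⟨n, rfl⟩; exact (hpos n).le⟩ j) (le_ciInf hle)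
      rw [hinf]
      congr 3
      funext n
      by_cases hn : n = j
      · rw [if_pos hn, hn, indicator_of_notMem (by simp)]
      · rw [if_neg hn, indicator_of_mem]
        exact lt_of_le_of_ne (hle n) fun h => hn (hinj h.symm)
    rw [hL, key, ← lintegral_map (f := fun u => F u * expNeg (ENNReal.ofReal (Real.pi * c) *
      ENNReal.ofReal (β ^ (2 / α) * u * rho α β))) (by fun_prop) hU.measurable_iInf,
      hU.map_iInf hπc, lintegral_expMeasure (by fun_prop)]
    simp_rw [← ENNReal.ofReal_mul hπc.le]
  · intro v hv u u' hu huu'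
    refine negLog_antitone (ENNReal.inv_le_inv.2 ?_)
    gcongr
  · intro v hv u hu
    refine (continuous_negLog.tendsto _).comp ?_
    refine ((continuous_inv (G := ℝ≥0∞)).tendsto _).comp ?_
    refine Tendsto.const_add 1 ?_
    refine (ENNReal.continuous_ofReal.tendsto _).comp (Tendsto.const_mul β ?_)
    exact (Real.continuousAt_rpow_const _ _ (Or.inr hα2.le)).tendsto.comp (f := fun u => u / v)
      ((continuous_id.div_const v).tendsto u)
  · intro v hv u hu
    exact negLog_inv_one_add_ne_top ENNReal.ofReal_ne_top
  · intro u hu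
    simp_rw [expNeg_negLog_inv_one_add]
    have h1 : ∀ v ∈ Ioi (0 : ℝ), 1 - (1 + ENNReal.ofReal (β * (u / v) ^ (α / 2)))⁻¹ =
        1 - (1 + ENNReal.ofReal (β * u ^ (α / 2) * v ^ (-(α / 2))))⁻¹ := fun v (hv : 0 < v) => by
      rw [Real.div_rpow (le_of_lt hu) hv.le, Real.rpow_neg hv.le, mul_div_assoc', ← div_eq_mul_inv]
    rw [setLIntegral_congr_fun measurableSet_Ioi h1, setLIntegral_Ioi_zero_pathLoss hα
      (mul_nonneg hβ.le (Real.rpow_nonneg (le_of_lt hu) _))]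
    exact ENNReal.ofReal_ne_top
  · intro u hu
    simp_rw [expNeg_negLog_inv_one_add]
    rw [setLIntegral_congr Ioi_ae_eq_Ici.symm, setLIntegral_Ioi_pathLoss hα hβ hu]
  · intro u hu
    exact (ENNReal.continuous_ofReal.comp (by fun_prop)).continuousAt

/-- The coverage probability of a user that is served by the nearest station of a Poisson network,
in the presence of an external interference `J` with a stable law. -/
theorem measure_lt_sinr {X : ℕ → Ω → Plane} {c : ℝ} (hc : 0 < c)
    (hX : IsHomogeneousPPP X c Pr) {G : ℕ → Ω → ℝ} (hG : ∀ n, HasLaw (G n) (expMeasure 1) Pr)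
    (hi : iIndepFun G Pr) (hXG : IndepFun (fun ω n => X n ω) (fun ω n => G n ω) Pr)
    {J : Ω → ℝ≥0∞} (hJm : AEMeasurable J Pr)
    (hJ : IndepFun (fun ω => (fun n => X n ω, fun n => G n ω)) J Pr)
    {p α β C τ : ℝ} (hp : 0 < p) (hα : 2 < α) (hβ : 0 < β) (hC : 0 ≤ C) (hτ : 0 ≤ τ)
    (hJtop : ∀ᵐ ω ∂Pr, J ω ≠ ∞)
    (hJL : ∀ κ : ℝ, 0 ≤ κ → ∫⁻ ω, expNeg (ENNReal.ofReal κ * J ω) ∂Pr =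
      expNeg (ENNReal.ofReal (C * κ ^ (2 / α)))) :
    Pr {ω | β < p * G (servingIndex p α fun n => X n ω) ω *
        ‖X (servingIndex p α fun n => X n ω) ω‖ ^ (-α) /
        ((∑' f, if f = servingIndex p α (fun n => X n ω) then 0 else
          p * G f ω * ‖X f ω‖ ^ (-α)) + (J ω).toReal + τ)} =
      ∫⁻ z in Ioi 0, ENNReal.ofReal (Real.pi * c * p ^ (2 / α) *
        Real.exp (-(β * τ * z ^ (α / 2))) *
        Real.exp (-(Real.pi * c * p ^ (2 / α) * z)) *
        (Real.exp (-(Real.pi * c * p ^ (2 / α) * (β * z ^ (α / 2)) ^ (2 / α) * rho α β)) *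
          Real.exp (-(C * (β * z ^ (α / 2)) ^ (2 / α))))) := by
  have hα2 : 0 < α / 2 := by linarith
  have hU := hX.sq_norm hc.le
  have hG0 : ∀ᵐ ω ∂Pr, ∀ n, 0 < G n ω := ae_all_iff.2 fun n => by
    have h : expMeasure 1 (Iic 0) = 0 := by
      rw [← Iio_insert, insert_eq]
      exact measure_union_null (expMeasure_singleton 1 0) (expMeasure_Iio_zero 1)
    rw [← (hG n).map_eq, Measure.map_apply_of_aemeasurable (hG n).aemeasurable measurableSet_Iic] at h
    rw [ae_iff]
    simpa [preimage, Iic] using h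
  -- The serving operator's own signal is a shot noise with deterministic power, hence the Dirac
  -- mass.
  have hS : ∀ᵐ ω ∂Pr, ∑' n, ENNReal.ofReal (p * G n ω * ‖X n ω‖ ^ (-α)) ≠ ∞ := by
    refine ae_shotNoise_ne_top (π₀ := Measure.dirac p) (P := fun _ _ => p) hc.le hX hG
      (fun n => ⟨aemeasurable_const, by simp⟩) (fun n => indepFun_const_right _ _)
      (hi.comp (fun _ y => (y, p)) (fun _ => by fun_prop))
      (hXG.comp (φ := id) (ψ := fun (y : ℕ → ℝ) n => (y n, p)) measurable_id (by fun_prop)) ?_ hα ?_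
    · rw [ae_dirac_eq]; exact hp.le
    · rw [lintegral_dirac]; exact ENNReal.ofReal_ne_top
  -- Noise and external interference as functions of the squared serving distance `u`, at the
  -- Laplace argument `κ = β u^{α/2} / p`.
  set F : ℝ → ℝ≥0∞ := fun u => expNeg (ENNReal.ofReal (β / p * u ^ (α / 2)) * ENNReal.ofReal τ) *
    expNeg (ENNReal.ofReal (C * (β / p * u ^ (α / 2)) ^ (2 / α))) with hFdef
  let j : (ℕ → Plane) → ℕ := servingIndex p α
  have hjm : Measurable fun x : ℕ → Plane => ‖x (j x)‖ ^ 2 :=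
    (measurable_apply_servingIndex p α).norm.pow_const 2
  have hevent : Pr {ω | β < p * G (servingIndex p α fun n => X n ω) ω *
        ‖X (servingIndex p α fun n => X n ω) ω‖ ^ (-α) /
        ((∑' f, if f = servingIndex p α (fun n => X n ω) then 0 else
          p * G f ω * ‖X f ω‖ ^ (-α)) + (J ω).toReal + τ)} =
      Pr {ω | ENNReal.ofReal (β / p * (‖X (j fun n => X n ω) ω‖ ^ 2) ^ (α / 2)) *
        (J ω + ENNReal.ofReal τ) + ∑' n, (if n = j (fun n => X n ω) then 0 else
        ENNReal.ofReal (β * (‖X (j fun n => X n ω) ω‖ ^ 2 / ‖X n ω‖ ^ 2) ^ (α / 2) * G n ω)) <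
          ENNReal.ofReal (G (j fun n => X n ω) ω)} := by
    refine measure_congr ?_
    filter_upwards [hG0, hS, hJtop, hU.ae_pos] with ω hGpos hSω hJω hpos
    refine propext ?_
    change (_ < _) ↔ (_ < _)
    change β < p * G (j fun n => X n ω) ω * ‖X (j fun n => X n ω) ω‖ ^ (-α) /
      ((∑' f, if f = j (fun n => X n ω) then 0 else p * G f ω * ‖X f ω‖ ^ (-α)) + (J ω).toReal + τ) ↔ _
    set k := j fun n => X n ω
    simp_rw [rpow_neg_eq_sq_rpow (norm_nonneg _) α] at hSω ⊢
    set v : ℕ → ℝ := fun n => ‖X n ω‖ ^ 2 with hv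
    have hvpos : ∀ n, 0 < v n := hpos
    change β < p * G k ω * v k ^ (-(α / 2)) /
      ((∑' f, if f = k then 0 else p * G f ω * v f ^ (-(α / 2))) + (J ω).toReal + τ) ↔
      ENNReal.ofReal (β / p * v k ^ (α / 2)) *
        (J ω + ENNReal.ofReal τ) + ∑' n, (if n = k then 0 else
        ENNReal.ofReal (β * (v k / v n) ^ (α / 2) * G n ω)) < ENNReal.ofReal (G k ω)
    change ∑' n, ENNReal.ofReal (p * G n ω * v n ^ (-(α / 2))) ≠ ∞ at hSω
    have hpow : ∀ n, 0 < v n ^ (-(α / 2)) := fun n => Real.rpow_pos_of_pos (hvpos n) _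
    have hterm : ∀ n, 0 < p * G n ω * v n ^ (-(α / 2)) := fun n =>
      mul_pos (mul_pos hp (hGpos n)) (hpow n)
    have hsum : Summable fun n => p * G n ω * v n ^ (-(α / 2)) := by
      have := ENNReal.summable_toReal hSω
      simpa only [ENNReal.toReal_ofReal (hterm _).le] using this
    have hnn : ∀ f, 0 ≤ (if f = k then 0 else p * G f ω * v f ^ (-(α / 2))) := fun f => by
      split_ifs; exacts [le_rfl, (hterm f).le]
    have hsum' : Summable fun f => if f = k then 0 else p * G f ω * v f ^ (-(α / 2)) := by
      refine Summable.of_nonneg_of_le hnn (fun f => ?_) hsum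
      split_ifs; exacts [(hterm f).le, le_rfl]
    -- Any station other than `k`, here `k + 1`, makes the denominator strictly positive, even
    -- without noise.
    have hI : 0 < ∑' f, if f = k then 0 else p * G f ω * v f ^ (-(α / 2)) :=
      hsum'.tsum_pos hnn (k + 1) (by simpa using hterm (k + 1))
    have hD : 0 < (∑' f, if f = k then 0 else p * G f ω * v f ^ (-(α / 2))) + (J ω).toReal + τ := by
      have := ENNReal.toReal_nonneg (a := J ω)
      linarith
    have hκ : 0 < β / p * v k ^ (α / 2) := mul_pos (div_pos hβ hp) (Real.rpow_pos_of_pos (hvpos k) _)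
    have hright : ∑' n, (if n = k then 0 else
        ENNReal.ofReal (β * (v k / v n) ^ (α / 2) * G n ω)) =
        ENNReal.ofReal (β / p * v k ^ (α / 2)) *
          ENNReal.ofReal (∑' f, if f = k then 0 else p * G f ω * v f ^ (-(α / 2))) := by
      rw [ENNReal.ofReal_tsum_of_nonneg hnn hsum', ← ENNReal.tsum_mul_left]
      refine tsum_congr fun n => ?_
      split_ifs
      · simp
      · rw [← ENNReal.ofReal_mul hκ.le]
        congr 1
        rw [Real.div_rpow (hvpos k).le (hvpos n).le, Real.rpow_neg (hvpos n).le]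
        field_simp
    rw [hright, ← mul_add, ← ENNReal.ofReal_toReal hJω,
      ← ENNReal.ofReal_add ENNReal.toReal_nonneg hτ,
      ← ENNReal.ofReal_add (by positivity) hI.le, ← ENNReal.ofReal_mul hκ.le,
      ENNReal.ofReal_lt_ofReal_iff (hGpos k), ENNReal.toReal_ofReal ENNReal.toReal_nonneg,
      lt_div_iff₀ hD]
    have hvk : 0 < v k ^ (α / 2) := Real.rpow_pos_of_pos (hvpos k) _
    rw [Real.rpow_neg (hvpos k).le, ← div_eq_mul_inv, lt_div_iff₀ hvk]
    generalize (∑' f, if f = k then 0 else p * G f ω * v f ^ (-(α / 2))) = I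
    constructor
    · intro h
      have h2 : β / p * v k ^ (α / 2) * ((J ω).toReal + τ + I) =
          (β * (I + (J ω).toReal + τ) * v k ^ (α / 2)) / p := by field_simp; ring
      rw [h2, div_lt_iff₀ hp]; linarith
    · intro h
      have h2 : β / p * v k ^ (α / 2) * ((J ω).toReal + τ + I) =
          (β * (I + (J ω).toReal + τ) * v k ^ (α / 2)) / p := by field_simp; ring
      rw [h2, div_lt_iff₀ hp] at h; linarith
  have hrace := measure_fading_race (IsPoissonProcess.measurable hX) hG hi hXG hJm hJ (j := j)
    (measurable_servingIndex p α) (κ := fun x => ENNReal.ofReal (β / p * (‖x (j x)‖ ^ 2) ^ (α / 2)))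
    (ENNReal.measurable_ofReal.comp ((hjm.pow_const (α / 2)).const_mul _))
    (b := fun x n => β * (‖x (j x)‖ ^ 2 / ‖x n‖ ^ 2) ^ (α / 2))
    (fun n => by
      have h1 : Measurable fun x : ℕ → Plane => x n := measurable_pi_apply n
      have h2 := h1.norm.pow_const 2
      exact ((hjm.div h2).pow_const (α / 2)).const_mul β)
    (fun x n => by positivity) (ENNReal.ofReal τ)
  rw [hevent, hrace]
  have hJL' : ∀ κ : ℝ, 0 ≤ κ → ∫⁻ t, expNeg (ENNReal.ofReal κ * t) ∂(Pr.map J) =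
      expNeg (ENNReal.ofReal (C * κ ^ (2 / α))) := fun κ hκ => by
    rw [← hJL κ hκ, lintegral_map' (by fun_prop) hJm]
  have hκ0 : ∀ r : ℝ, 0 ≤ β / p * (r ^ 2) ^ (α / 2) := fun r => by positivity
  simp_rw [hJL' _ (hκ0 _)]
  have hserv := lintegral_serving hc hX hp hα hβ (F := F) (by fun_prop)
    (fun u => mul_le_one' (expNeg_le_one _) (expNeg_le_one _)) (fun u hu => by
      have h1 : ContinuousAt (fun u : ℝ => β / p * u ^ (α / 2)) u :=
        continuousAt_const.mul (Real.continuousAt_rpow_const _ _ (Or.inr hα2.le))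
      have h2 : ContinuousAt (fun u : ℝ => C * (β / p * u ^ (α / 2)) ^ (2 / α)) u :=
        continuousAt_const.mul (h1.rpow_const (Or.inr (by positivity)))
      refine ENNReal.Tendsto.mul ?_ (Or.inr (expNeg_ne_top _)) ?_ (Or.inr (expNeg_ne_top _))
      · refine (continuous_expNeg.tendsto _).comp (ENNReal.Tendsto.mul_const ?_
          (Or.inr ENNReal.ofReal_ne_top))
        exact (ENNReal.continuous_ofReal.tendsto _).comp h1
      · exact (continuous_expNeg.tendsto _).comp ((ENNReal.continuous_ofReal.tendsto _).comp h2))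
  have hb : 0 < p ^ (2 / α) := Real.rpow_pos_of_pos hp _
  -- Substitute `u = p^{2/α} z`, which turns `β u^{α/2} / p` into `β z^{α/2}`.
  refine (hserv.trans (setLIntegral_Ioi_comp_mul hb _)).trans ?_
  refine setLIntegral_congr_fun measurableSet_Ioi fun z (hz : 0 < z) => ?_
  have hz2 : 0 < z ^ (α / 2) := Real.rpow_pos_of_pos hz _
  have hpow : (p ^ (2 / α) * z) ^ (α / 2) = p * z ^ (α / 2) := by
    rw [Real.mul_rpow hb.le hz.le, ← Real.rpow_mul hp.le, div_mul_div_cancel₀ (by linarith)]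
    simp
  have hκz : β / p * (p ^ (2 / α) * z) ^ (α / 2) = β * z ^ (α / 2) := by
    rw [hpow]; field_simp
  have hκpow : (β * z ^ (α / 2)) ^ (2 / α) = β ^ (2 / α) * z := by
    rw [Real.mul_rpow hβ.le hz2.le, ← Real.rpow_mul hz.le, div_mul_div_cancel₀ (by norm_num),
      div_self (by linarith), Real.rpow_one]
  have hρ := rho_nonneg α β hβ.le
  simp only [hFdef, hκz]
  have hE : ∀ x : ℝ, 0 ≤ x → expNeg (ENNReal.ofReal x) = ENNReal.ofReal (Real.exp (-x)) :=
    fun x hx => expNeg_ofReal hx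
  rw [← ENNReal.ofReal_mul (by positivity), hE _ (by positivity), hE _ (by positivity),
    hE _ (by positivity), ← ENNReal.ofReal_mul (by positivity), ← ENNReal.ofReal_mul (by positivity),
    ← ENNReal.ofReal_mul (by positivity), ← ENNReal.ofReal_mul (by positivity), hκpow]
  congr 1
  have e1 : β * z ^ (α / 2) * τ = β * τ * z ^ (α / 2) := by ring
  have e2 : Real.pi * c * (β ^ (2 / α) * (p ^ (2 / α) * z) * rho α β) =
    Real.pi * c * p ^ (2 / α) * (β ^ (2 / α) * z) * rho α β := by ring
  have e3 : Real.pi * c * (p ^ (2 / α) * z) = Real.pi * c * p ^ (2 / α) * z := by ring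
  rw [e1, e2, e3]
  ring

end Coverage
-- Gains and powers are only almost everywhere measurable, so the product formula is needed in this
-- generality.
lemma lintegral_prod_eq_prod_lintegral_of_iIndepFun₀ {Ω ι : Type*} [MeasurableSpace Ω]
    {Pr : Measure Ω} (s : Finset ι) (f : ι → Ω → ℝ≥0∞) (hf : iIndepFun f Pr)
    (hm : ∀ i, AEMeasurable (f i) Pr) :
    ∫⁻ ω, ∏ i ∈ s, f i ω ∂Pr = ∏ i ∈ s, ∫⁻ ω, f i ω ∂Pr := by
  have : IsProbabilityMeasure Pr := hf.isProbabilityMeasure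
  induction s using Finset.cons_induction with
  | empty => simp
  | cons j s hj ih =>
    simp only [← Finset.prod_apply, Finset.prod_cons, ← ih]
    exact lintegral_mul_eq_lintegral_mul_lintegral_of_indepFun' (hm j)
      (s.aemeasurable_prod fun i _ => hm i) (hf.indepFun_finsetProd_of_notMem₀ hm hj).symm

/-- Independence is indexed by the whole group, seller included; in sums over buyers the seller
stays as an index with contribution zero. -/
lemma sum_erase_eq_sum_subtype {O M : Type*} [DecidableEq O] [AddCommMonoid M] (g : Finset O)
    (s : O) (f : O → M) :
    ∑ b ∈ g.erase s, f b = ∑ i : {k // k ∈ g}, if i.1 = s then 0 else f i.1 := by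
  rw [Finset.sum_coe_sort g (fun b => if b = s then 0 else f b),
    ← Finset.sum_erase g (a := s) (f := fun b => if b = s then 0 else f b) (by simp)]
  refine Finset.sum_congr rfl fun b hb => ?_
  rw [if_neg (Finset.ne_of_mem_erase hb)]

/-! ### Interference of the buyers in the model -/

namespace Downlink

variable {O : Type*} [DecidableEq O] {N : Network O} {s : O} {Ω : Type*} [MeasurableSpace Ω]

/-- The total power received, on sub-band `l`, from the base stations of operator `b`. -/
noncomputable def shotNoise (D : Downlink N s Ω) (l : Fin (N.numBands s)) (b : O) (ω : Ω) : ℝ≥0∞ :=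
  ∑' f, ENNReal.ofReal (D.txPower l b f ω * D.gain l b f ω * ‖D.bs b f ω‖ ^ (-N.α))

/-- The interference, on sub-band `l`, from all the buyers. -/
noncomputable def buyerInterference (D : Downlink N s Ω) (l : Fin (N.numBands s)) (ω : Ω) : ℝ≥0∞ :=
  ∑ b ∈ (N.group s l).erase s, D.shotNoise l b ω

namespace IsModel

variable {D : Downlink N s Ω} {Pr : Measure Ω} [IsProbabilityMeasure Pr]

omit [IsProbabilityMeasure Pr] in
lemma aemeasurable_allowedPower (hD : D.IsModel Pr) (l : Fin (N.numBands s)) :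
    AEMeasurable (D.allowedPower l) Pr := by
  refine AEMeasurable.const_div (AEMeasurable.iSup fun i => ?_) _
  have h1 := (hD.ueGain_law l i).aemeasurable
  have h2 : Measurable (D.ue i) := IsPoissonProcess.measurable hD.ue_ppp i
  exact h1.mul ((h2.const_sub D.buyerSite).norm.pow_const _).aemeasurable

omit [IsProbabilityMeasure Pr] in
lemma ae_nonneg_of_hasLaw {G : Ω → ℝ} (hG : HasLaw G (expMeasure 1) Pr) : ∀ᵐ ω ∂Pr, 0 ≤ G ω := by
  have h := expMeasure_Iio_zero 1
  rw [← hG.map_eq, Measure.map_apply_of_aemeasurable hG.aemeasurable measurableSet_Iio] at h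
  rw [ae_iff]
  simpa [preimage, Iio] using h

variable (hs : s ∈ N.sellers)
include hs

omit [IsProbabilityMeasure Pr] in
lemma ae_allowedPower_nonneg (hD : D.IsModel Pr) (l : Fin (N.numBands s)) :
    ∀ᵐ ω ∂Pr, 0 ≤ D.allowedPower l ω := by
  filter_upwards [ae_all_iff.2 fun i => ae_nonneg_of_hasLaw (hD.ueGain_law l i)] with ω hω
  exact div_nonneg (N.ζ_pos s hs).le
    (Real.iSup_nonneg fun i => mul_nonneg (hω i) (by positivity))

lemma lintegral_allowedPower_rpow_ne_top (hD : D.IsModel Pr) (l : Fin (N.numBands s)) :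
    ∫⁻ ω, ENNReal.ofReal (D.allowedPower l ω ^ (2 / N.α)) ∂Pr ≠ ∞ :=
  lintegral_div_iSup_rpow_ne_top (N.ueIntensity_pos s (Finset.mem_union_left _ hs)) hD.ue_ppp
    (hD.ueGain_law l) (hD.ueGain_indep l) (hD.ue_indep_ueGain l) D.buyerSite (N.ζ_pos s hs)
    N.two_lt_α

lemma integrable_allowedPower_rpow (hD : D.IsModel Pr) (l : Fin (N.numBands s)) :
    Integrable (fun ω => D.allowedPower l ω ^ (2 / N.α)) Pr := by
  refine ⟨((hD.aemeasurable_allowedPower l).pow_const _).aestronglyMeasurable, ?_⟩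
  rw [hasFiniteIntegral_iff_ofReal]
  · exact (hD.lintegral_allowedPower_rpow_ne_top hs l).lt_top
  · filter_upwards [hD.ae_allowedPower_nonneg hs l] with ω hω
    exact Real.rpow_nonneg hω _

omit [IsProbabilityMeasure Pr] in
lemma powerMoment_nonneg (hD : D.IsModel Pr) (l : Fin (N.numBands s)) : 0 ≤ D.powerMoment Pr l := by
  refine integral_nonneg_of_ae ?_
  filter_upwards [hD.ae_allowedPower_nonneg hs l] with ω hω
  exact Real.rpow_nonneg hω _

lemma lintegral_map_allowedPower (hD : D.IsModel Pr) (l : Fin (N.numBands s)) :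
    ∫⁻ p, ENNReal.ofReal (p ^ (2 / N.α)) ∂(Pr.map (D.allowedPower l)) =
      ENNReal.ofReal (D.powerMoment Pr l) := by
  rw [lintegral_map' (by fun_prop) (hD.aemeasurable_allowedPower l), powerMoment,
    ofReal_integral_eq_lintegral_ofReal (hD.integrable_allowedPower_rpow hs l)]
  filter_upwards [hD.ae_allowedPower_nonneg hs l] with ω hω
  exact Real.rpow_nonneg hω _

omit [IsProbabilityMeasure Pr] in
lemma mem_operators_of_mem_group {l : Fin (N.numBands s)} {k : O} (hk : k ∈ N.group s l) :
    k ∈ N.sellers ∪ N.buyers := by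
  by_cases h : k = s
  · exact Finset.mem_union_left _ (h ▸ hs)
  · exact Finset.mem_union_right _ (N.group_subset s hs l (Finset.mem_erase.2 ⟨h, hk⟩))

omit [IsProbabilityMeasure Pr] in
lemma measurable_bs (hD : D.IsModel Pr) {l : Fin (N.numBands s)} {k : O} (hk : k ∈ N.group s l)
    (f : ℕ) : Measurable (D.bs k f) :=
  IsPoissonProcess.measurable (hD.bs_ppp k (mem_operators_of_mem_group hs hk)) f

omit [IsProbabilityMeasure Pr] hs in
lemma aemeasurable_txPower (hD : D.IsModel Pr) {l : Fin (N.numBands s)} {k : O}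
    (hk : k ∈ N.group s l) (f : ℕ) : AEMeasurable (D.txPower l k f) Pr := by
  by_cases h : k = s
  · have : D.txPower l k f = fun _ => N.PS := by funext ω; simp [txPower, h]
    rw [this]; exact aemeasurable_const
  · have : D.txPower l k f = D.buyerPower l k f := by funext ω; simp [txPower, h]
    rw [this]; exact (hD.power_law l k (Finset.mem_erase.2 ⟨h, hk⟩) f).aemeasurable_fst

omit [IsProbabilityMeasure Pr] in
lemma aemeasurable_marked (hD : D.IsModel Pr) {l : Fin (N.numBands s)} {k : O}
    (hk : k ∈ N.group s l) :
    AEMeasurable (fun ω => ((fun f => D.bs k f ω), fun f => (D.gain l k f ω, D.txPower l k f ω)))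
      Pr :=
  (measurable_pi_iff.2 fun f => hD.measurable_bs hs hk f).aemeasurable.prodMk
    (aemeasurable_pi_iff.2 fun f =>
      (hD.gain_law l k hk f).aemeasurable.prodMk (hD.aemeasurable_txPower hk f))

omit [IsProbabilityMeasure Pr] hs in
lemma measurable_received (α : ℝ) : Measurable fun q : (ℕ → Plane) × (ℕ → ℝ × ℝ) =>
    ∑' f, ENNReal.ofReal ((q.2 f).2 * (q.2 f).1 * ‖q.1 f‖ ^ (-α)) := by
  refine Measurable.tsum fun f => ?_
  have h1 : Measurable fun q : (ℕ → Plane) × (ℕ → ℝ × ℝ) => q.1 f :=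
    (measurable_pi_apply f).comp measurable_fst
  have h2 : Measurable fun q : (ℕ → Plane) × (ℕ → ℝ × ℝ) => q.2 f :=
    (measurable_pi_apply f).comp measurable_snd
  exact ENNReal.measurable_ofReal.comp ((h2.snd.mul h2.fst).mul (h1.norm.pow_const _))

omit [IsProbabilityMeasure Pr] in
lemma aemeasurable_shotNoise (hD : D.IsModel Pr) {l : Fin (N.numBands s)} {k : O}
    (hk : k ∈ N.group s l) : AEMeasurable (D.shotNoise l k) Pr :=
  (measurable_received N.α).comp_aemeasurable (hD.aemeasurable_marked hs hk)

omit [IsProbabilityMeasure Pr] in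
lemma aemeasurable_buyerInterference (hD : D.IsModel Pr) (l : Fin (N.numBands s)) :
    AEMeasurable (D.buyerInterference l) Pr :=
  Finset.aemeasurable_fun_sum _ fun _ hb =>
    hD.aemeasurable_shotNoise hs (Finset.mem_of_mem_erase hb)

omit [MeasurableSpace Ω] hs in
lemma txPower_buyer {l : Fin (N.numBands s)} {b : O} (hb : b ∈ (N.group s l).erase s) (f : ℕ) :
    D.txPower l b f = D.buyerPower l b f := by
  funext ω
  simp [txPower, Finset.ne_of_mem_erase hb]

omit [IsProbabilityMeasure Pr] hs in
lemma hasLaw_txPower (hD : D.IsModel Pr) {l : Fin (N.numBands s)} {b : O}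
    (hb : b ∈ (N.group s l).erase s) (f : ℕ) :
    HasLaw (D.txPower l b f) (Pr.map (D.allowedPower l)) Pr := by
  rw [txPower_buyer hb]
  exact ⟨(hD.power_law l b hb f).aemeasurable_fst, (hD.power_law l b hb f).map_eq⟩

omit [IsProbabilityMeasure Pr] in
lemma ae_map_allowedPower_nonneg (hD : D.IsModel Pr) (l : Fin (N.numBands s)) :
    ∀ᵐ p ∂(Pr.map (D.allowedPower l)), 0 ≤ p := by
  rw [ae_map_iff (hD.aemeasurable_allowedPower l) measurableSet_Ici]
  exact hD.ae_allowedPower_nonneg hs l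

omit [IsProbabilityMeasure Pr] in
lemma ae_buyerPower_nonneg (hD : D.IsModel Pr) {l : Fin (N.numBands s)} {b : O}
    (hb : b ∈ (N.group s l).erase s) (f : ℕ) : ∀ᵐ ω ∂Pr, 0 ≤ D.buyerPower l b f ω := by
  rw [← txPower_buyer hb f]
  refine ae_of_ae_map (hD.hasLaw_txPower hb f).aemeasurable (p := fun p => 0 ≤ p) ?_
  rw [(hD.hasLaw_txPower hb f).map_eq]
  exact hD.ae_map_allowedPower_nonneg hs l

lemma lintegral_expNeg_mul_shotNoise (hD : D.IsModel Pr) {l : Fin (N.numBands s)} {b : O}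
    (hb : b ∈ (N.group s l).erase s) {κ : ℝ} (hκ : 0 ≤ κ) :
    ∫⁻ ω, expNeg (ENNReal.ofReal κ * D.shotNoise l b ω) ∂Pr =
      expNeg (ENNReal.ofReal (Real.pi * N.bsIntensity b * D.powerMoment Pr l * κ ^ (2 / N.α) *
        rhoInf N.α)) := by
  have hbg := Finset.mem_of_mem_erase hb
  have hop := mem_operators_of_mem_group hs hbg
  have := Measure.isProbabilityMeasure_map (μ := Pr) (hD.aemeasurable_allowedPower l)
  have hc := (N.bsIntensity_pos b hop).le
  have hρ := rhoInf_nonneg N.α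
  simp_rw [shotNoise, ← ENNReal.tsum_mul_left, ← ENNReal.ofReal_mul hκ]
  rw [lintegral_expNeg_shotNoise hc (hD.bs_ppp b hop)
    (hD.gain_law l b hbg) (hD.hasLaw_txPower hb) (hD.gain_indep_power l b hbg)
    (hD.marks_indep l b hbg) (hD.bs_indep_marks l b hbg) (hD.ae_map_allowedPower_nonneg hs l)
    N.two_lt_α hκ, hD.lintegral_map_allowedPower hs l, ← ENNReal.ofReal_mul (by positivity)]
  congr 2; ring

lemma ae_shotNoise_ne_top (hD : D.IsModel Pr) {l : Fin (N.numBands s)} {b : O}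
    (hb : b ∈ (N.group s l).erase s) : ∀ᵐ ω ∂Pr, D.shotNoise l b ω ≠ ∞ := by
  have hbg := Finset.mem_of_mem_erase hb
  have hop := mem_operators_of_mem_group hs hbg
  have := Measure.isProbabilityMeasure_map (μ := Pr) (hD.aemeasurable_allowedPower l)
  exact SpectrumSharing.ae_shotNoise_ne_top (N.bsIntensity_pos b hop).le (hD.bs_ppp b hop)
    (hD.gain_law l b hbg) (hD.hasLaw_txPower hb) (hD.gain_indep_power l b hbg)
    (hD.marks_indep l b hbg) (hD.bs_indep_marks l b hbg) (hD.ae_map_allowedPower_nonneg hs l)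
    N.two_lt_α (by rw [hD.lintegral_map_allowedPower hs l]; exact ENNReal.ofReal_ne_top)

lemma ae_buyerInterference_ne_top (hD : D.IsModel Pr) (l : Fin (N.numBands s)) :
    ∀ᵐ ω ∂Pr, D.buyerInterference l ω ≠ ∞ := by
  have h : ∀ᵐ ω ∂Pr, ∀ b ∈ (N.group s l).erase s, D.shotNoise l b ω ≠ ∞ :=
    (Finset.eventually_all _).2 fun b hb => hD.ae_shotNoise_ne_top hs hb
  filter_upwards [h] with ω hω
  exact ENNReal.sum_ne_top.2 hω

/-- Buyers are independent and their powers share one law, so the exponents add up and only the sum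
of the intensities matters. -/
lemma lintegral_expNeg_mul_buyerInterference (hD : D.IsModel Pr) (l : Fin (N.numBands s)) {κ : ℝ}
    (hκ : 0 ≤ κ) :
    ∫⁻ ω, expNeg (ENNReal.ofReal κ * D.buyerInterference l ω) ∂Pr =
      expNeg (ENNReal.ofReal ((Real.pi * (∑ b ∈ (N.group s l).erase s, N.bsIntensity b) *
        D.powerMoment Pr l * rhoInf N.α) * κ ^ (2 / N.α))) := by
  have hind : iIndepFun (fun (i : {k // k ∈ N.group s l}) ω => D.shotNoise l i.1 ω) Pr :=
    (hD.operators_indep l).comp (fun _ q => ∑' f, ENNReal.ofReal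
      ((q.2 f).2 * (q.2 f).1 * ‖q.1 f‖ ^ (-N.α))) (fun _ => measurable_received N.α)
  have hind' : iIndepFun (fun (i : {k // k ∈ N.group s l}) ω =>
      expNeg (if i.1 = s then 0 else ENNReal.ofReal κ * D.shotNoise l i.1 ω)) Pr :=
    hind.comp (fun i t => expNeg (if i.1 = s then 0 else ENNReal.ofReal κ * t))
      (fun i => by split_ifs <;> fun_prop)
  simp_rw [buyerInterference, Finset.mul_sum, sum_erase_eq_sum_subtype, expNeg_sum]
  rw [lintegral_prod_eq_prod_lintegral_of_iIndepFun₀ _ _ hind' fun i => by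
    have := hD.aemeasurable_shotNoise hs i.2
    split_ifs <;> fun_prop]
  have hterm : ∀ i : {k // k ∈ N.group s l},
      ∫⁻ ω, expNeg (if i.1 = s then 0 else ENNReal.ofReal κ * D.shotNoise l i.1 ω) ∂Pr =
      expNeg (ENNReal.ofReal (if i.1 = s then 0 else Real.pi * N.bsIntensity i.1 *
        D.powerMoment Pr l * κ ^ (2 / N.α) * rhoInf N.α)) := fun i => by
    split_ifs with hi
    · simp
    · exact hD.lintegral_expNeg_mul_shotNoise hs (Finset.mem_erase.2 ⟨hi, i.2⟩) hκ
  simp_rw [hterm]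
  rw [← expNeg_sum, ← ENNReal.ofReal_sum_of_nonneg]
  · congr 2
    rw [← sum_erase_eq_sum_subtype (N.group s l) s (fun b => Real.pi * N.bsIntensity b *
        D.powerMoment Pr l * κ ^ (2 / N.α) * rhoInf N.α),
      ← sum_erase_eq_sum_subtype (N.group s l) s (fun b => Real.pi * N.bsIntensity b),
      ← Finset.sum_mul, ← Finset.sum_mul, ← Finset.sum_mul]
    ring
  · intro i _
    split_ifs
    · exact le_rfl
    · have h1 := N.bsIntensity_pos i.1 (mem_operators_of_mem_group hs i.2)
      have h2 := rhoInf_nonneg N.α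
      have h3 := hD.powerMoment_nonneg hs l
      positivity

omit [IsProbabilityMeasure Pr] in
-- The seller and the remaining operators are disjoint blocks of an independent family, and each
-- side is a measurable function of one block.
lemma indepFun_buyerInterference (hD : D.IsModel Pr) (l : Fin (N.numBands s)) :
    IndepFun (fun ω => ((fun n => D.bs s n ω), fun n => D.gain l s n ω)) (D.buyerInterference l)
      Pr := by
  let s₀ : {k // k ∈ N.group s l} := ⟨s, N.seller_mem_group s hs l⟩
  have h := (hD.operators_indep l).indepFun_finset₀ {s₀} (Finset.univ.erase s₀)
    (by simp) (fun i => hD.aemeasurable_marked hs i.2)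
  let φ : (({s₀} : Finset {k // k ∈ N.group s l}) → (ℕ → Plane) × (ℕ → ℝ × ℝ)) →
      (ℕ → Plane) × (ℕ → ℝ) := fun q =>
    ((q ⟨s₀, Finset.mem_singleton_self _⟩).1, fun n => ((q ⟨s₀, Finset.mem_singleton_self _⟩).2 n).1)
  let ψ : (((Finset.univ : Finset {k // k ∈ N.group s l}).erase s₀ : Finset _) →
      (ℕ → Plane) × (ℕ → ℝ × ℝ)) → ℝ≥0∞ := fun q =>
    ∑ i, ∑' f, ENNReal.ofReal (((q i).2 f).2 * ((q i).2 f).1 * ‖(q i).1 f‖ ^ (-N.α))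
  have hφ : Measurable φ := by
    have h1 := measurable_pi_apply (X := fun _ : ({s₀} : Finset {k // k ∈ N.group s l}) =>
      (ℕ → Plane) × (ℕ → ℝ × ℝ)) ⟨s₀, Finset.mem_singleton_self _⟩
    exact h1.fst.prodMk (measurable_pi_lambda _ fun n => ((measurable_pi_apply n).comp h1.snd).fst)
  have hψ : Measurable ψ := Finset.measurable_fun_sum _ fun i _ =>
    (measurable_received N.α).comp (measurable_pi_apply i)
  have h2 := h.comp hφ hψ
  have h3 : D.buyerInterference l = ψ ∘ fun ω i => ((fun f => D.bs i.1.1 f ω),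
      fun f => (D.gain l i.1.1 f ω, D.txPower l i.1.1 f ω)) := by
    funext ω
    simp only [buyerInterference, ψ, Function.comp]
    rw [Finset.sum_coe_sort ((Finset.univ : Finset {k // k ∈ N.group s l}).erase s₀)
      (fun i => ∑' f, ENNReal.ofReal (D.txPower l i.1 f ω * D.gain l i.1 f ω *
        ‖D.bs i.1 f ω‖ ^ (-N.α))), sum_erase_eq_sum_subtype]
    rw [← Finset.sum_erase Finset.univ (a := s₀) (by simp [s₀])]
    refine Finset.sum_congr rfl fun i hi => ?_
    rw [if_neg fun h => Finset.ne_of_mem_erase hi (Subtype.ext h)]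
    rfl
  rw [h3]
  exact h2

end IsModel
end Downlink
-- Measurability and decay of the coverage integrand
section Integrand

/-- The parameter sits in the domain of integration; moved into the integrand as an indicator, it
gives a jointly measurable function. -/
lemma measurable_rho (α : ℝ) : Measurable (rho α) := by
  have h1 : StronglyMeasurable fun x : ℝ => ∫ ν, (if x < ν then 1 / (1 + ν ^ (α / 2)) else 0) := by
    refine StronglyMeasurable.integral_prod_right
      (f := fun x ν : ℝ => if x < ν then 1 / (1 + ν ^ (α / 2)) else 0) ?_
    refine (Measurable.ite (measurableSet_lt measurable_fst measurable_snd) ?_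
      measurable_const).stronglyMeasurable
    fun_prop
  have h2 : rho α = fun β => ∫ ν, (if β ^ (-(2 / α)) < ν then 1 / (1 + ν ^ (α / 2)) else 0) := by
    funext β
    rw [rho, ← integral_indicator measurableSet_Ioi]
    rfl
  rw [h2]
  exact h1.measurable.comp (by fun_prop : Measurable fun β : ℝ => β ^ (-(2 / α)))

/-- A uniform lower bound for `ρ(α, β)` with `β ≥ 1`. -/
lemma le_rho_of_one_le {α β : ℝ} (hα : 2 < α) (hβ : 1 ≤ β) : 1 / (1 + 2 ^ (α / 2)) ≤ rho α β := by
  have hlow : β ^ (-(2 / α)) ≤ 1 :=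
    Real.rpow_le_one_of_one_le_of_nonpos hβ (by have : 0 < 2 / α := by positivity
                                                linarith)
  have hlow0 : 0 ≤ β ^ (-(2 / α)) := Real.rpow_nonneg (by linarith) _
  -- The lower limit is at most one, so the domain contains `(1, 2]`, where the integrand is at
  -- least its value at `2`.
  have hsub : Ioc (1 : ℝ) 2 ⊆ Ioi (β ^ (-(2 / α))) := fun ν hν => hlow.trans_lt hν.1
  have hint : IntegrableOn (fun ν : ℝ => 1 / (1 + ν ^ (α / 2))) (Ioi (β ^ (-(2 / α)))) :=
    (integrableOn_one_div_one_add_rpow (by linarith)).mono_set (Ioi_subset_Ioi hlow0)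
  have h1 : 1 / (1 + 2 ^ (α / 2)) = ∫ _ in Ioc (1 : ℝ) 2, 1 / (1 + (2 : ℝ) ^ (α / 2)) := by
    rw [setIntegral_const, Real.volume_real_Ioc]
    norm_num
  rw [h1, rho]
  refine (setIntegral_mono_on (by simp) (hint.mono_set hsub)
    measurableSet_Ioc fun ν hν => ?_).trans (setIntegral_mono_set hint ?_ hsub.eventuallyLE)
  · have : 0 < ν := zero_lt_one.trans hν.1
    have := hν.2
    gcongr
  · filter_upwards [ae_restrict_mem measurableSet_Ioi] with ν hν
    have : 0 < ν := hlow0.trans_lt hν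
    simp only [Pi.zero_apply]
    positivity

variable {O : Type*} [DecidableEq O] {N : Network O} {s : O}

lemma measurable_coverageIntegrand (l : Fin (N.numBands s)) (M : ℝ) :
    Measurable fun q : ℝ × ℝ => coverageIntegrand N s l M (Real.exp q.1 - 1) q.2 := by
  have h1 : Measurable fun q : ℝ × ℝ => rho N.α (Real.exp q.1 - 1) :=
    (measurable_rho N.α).comp (by fun_prop)
  unfold coverageIntegrand laplaceInterference
  fun_prop

lemma coverageIntegrand_nonneg (hs : s ∈ N.sellers) (l : Fin (N.numBands s)) (M β z : ℝ) :
    0 ≤ coverageIntegrand N s l M β z := by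
  have h1 := N.bsIntensity_pos s (Finset.mem_union_left _ hs)
  have h2 := N.PS_pos
  unfold coverageIntegrand laplaceInterference
  positivity

/-- Only the factor from the seller's own interference is kept, with `rho` bounded below; the other
exponentials are at most one. -/
lemma coverageIntegrand_le (hs : s ∈ N.sellers) (l : Fin (N.numBands s)) {M β z : ℝ} (hM : 0 ≤ M)
    (hβ : 1 ≤ β) (hz : 0 ≤ z) : coverageIntegrand N s l M β z ≤
      Real.pi * N.bsIntensity s * N.PS ^ (2 / N.α) *
        Real.exp (-(Real.pi * N.bsIntensity s * N.PS ^ (2 / N.α) * β ^ (2 / N.α) *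
          (1 / (1 + 2 ^ (N.α / 2))) * z)) := by
  have h1 := N.bsIntensity_pos s (Finset.mem_union_left _ hs)
  have h2 := N.PS_pos
  have hα := N.two_lt_α
  have hβ0 : 0 < β := by linarith
  have hb : 0 ≤ ∑ b ∈ (N.group s l).erase s, N.bsIntensity b := Finset.sum_nonneg fun b hb =>
    (N.bsIntensity_pos b (Finset.mem_union_right _ (N.group_subset s hs l hb))).le
  have hκpow : (β * z ^ (N.α / 2)) ^ (2 / N.α) = β ^ (2 / N.α) * z := by
    rw [Real.mul_rpow hβ0.le (by positivity), ← Real.rpow_mul hz, div_mul_div_cancel₀ (by norm_num),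
      div_self (by linarith), Real.rpow_one]
  have hρ := le_rho_of_one_le hα hβ
  have hρI := rhoInf_nonneg N.α
  set c := Real.pi * N.bsIntensity s * N.PS ^ (2 / N.α) with hc
  have hc0 : 0 ≤ c := by positivity
  have hβα : 0 ≤ β ^ (2 / N.α) := by positivity
  rw [coverageIntegrand, laplaceInterference, hκpow, mul_assoc, mul_assoc]
  refine mul_le_mul_of_nonneg_left ?_ hc0
  rw [← Real.exp_add, ← Real.exp_add, ← Real.exp_add, Real.exp_le_exp]
  have e1 : 0 ≤ β * N.σ ^ 2 * z ^ (N.α / 2) := by positivity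
  have e2 : 0 ≤ c * z := by positivity
  have e3 : 0 ≤ Real.pi * (∑ b ∈ (N.group s l).erase s, N.bsIntensity b) * M *
    (β ^ (2 / N.α) * z) * rhoInf N.α := by positivity
  have e4 : c * β ^ (2 / N.α) * (1 / (1 + 2 ^ (N.α / 2))) * z ≤
      c * (β ^ (2 / N.α) * z) * rho N.α β := by
    have : c * β ^ (2 / N.α) * (1 / (1 + 2 ^ (N.α / 2))) * z =
      c * (β ^ (2 / N.α) * z) * (1 / (1 + 2 ^ (N.α / 2))) := by ring
    rw [this]
    exact mul_le_mul_of_nonneg_left hρ (by positivity)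
  linarith

/-- Comparison with the exponential density of rate `r = c β^{2/α} / (1 + 2^{α/2})`; the bound is `c
/ r`. -/
lemma lintegral_coverageIntegrand_le (hs : s ∈ N.sellers) (l : Fin (N.numBands s)) {M β : ℝ}
    (hM : 0 ≤ M) (hβ : 1 ≤ β) :
    ∫⁻ z in Ioi 0, ENNReal.ofReal (coverageIntegrand N s l M β z) ≤
      ENNReal.ofReal ((1 + 2 ^ (N.α / 2)) * β ^ (-(2 / N.α))) := by
  have h1 := N.bsIntensity_pos s (Finset.mem_union_left _ hs)
  have h2 := N.PS_pos
  have hβ0 : 0 < β := by linarith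
  set c := Real.pi * N.bsIntensity s * N.PS ^ (2 / N.α) with hc
  have hc0 : 0 < c := by positivity
  set r := c * β ^ (2 / N.α) * (1 / (1 + 2 ^ (N.α / 2))) with hr
  have hr0 : 0 < r := by positivity
  have := isProbabilityMeasure_expMeasure hr0
  have h3 := lintegral_expMeasure (r := r) (measurable_const (a := (1 : ℝ≥0∞)))
  rw [lintegral_const, measure_univ, mul_one] at h3
  calc ∫⁻ z in Ioi 0, ENNReal.ofReal (coverageIntegrand N s l M β z)
      ≤ ∫⁻ z in Ioi 0, ENNReal.ofReal (c / r) *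
          (ENNReal.ofReal (r * Real.exp (-(r * z))) * 1) := by
        refine setLIntegral_mono (by fun_prop) fun z (hz : 0 < z) => ?_
        rw [mul_one, ← ENNReal.ofReal_mul (by positivity)]
        refine ENNReal.ofReal_le_ofReal ((coverageIntegrand_le hs l hM hβ hz.le).trans_eq ?_)
        rw [← mul_assoc, div_mul_cancel₀ _ hr0.ne']
    _ = ENNReal.ofReal ((1 + 2 ^ (N.α / 2)) * β ^ (-(2 / N.α))) := by
        rw [lintegral_const_mul _ (by fun_prop), ← h3, mul_one, hr, Real.rpow_neg hβ0.le]
        congr 1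
        field_simp

end Integrand

/-! ### Coverage probability and average rate in the model -/

namespace Downlink

variable {O : Type*} [DecidableEq O] {N : Network O} {s : O} {Ω : Type*} [MeasurableSpace Ω]

namespace IsModel

variable {D : Downlink N s Ω} {Pr : Measure Ω} [IsProbabilityMeasure Pr] (hs : s ∈ N.sellers)
include hs

omit [IsProbabilityMeasure Pr] in
lemma aemeasurable_sinr (hD : D.IsModel Pr) (l : Fin (N.numBands s)) :
    AEMeasurable (D.sinr l) Pr := by
  have hsg := N.seller_mem_group s hs l
  have hX : Measurable fun ω n => D.bs s n ω := measurable_pi_iff.2 fun n => hD.measurable_bs hs hsg n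
  have hG : AEMeasurable (fun ω n => D.gain l s n ω) Pr :=
    aemeasurable_pi_iff.2 fun n => (hD.gain_law l s hsg n).aemeasurable
  have hj : Measurable D.serving := (measurable_servingIndex N.PS N.α).comp hX
  have hev : Measurable fun q : (ℕ → ℝ) × ℕ => q.1 q.2 :=
    measurable_from_prod_countable_left fun n => measurable_pi_apply n
  have hg : AEMeasurable (fun ω => D.gain l s (D.serving ω) ω) Pr :=
    hev.comp_aemeasurable (hG.prodMk hj.aemeasurable)
  have hx : Measurable fun ω => D.bs s (D.serving ω) ω :=
    (measurable_apply_servingIndex N.PS N.α).comp hX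
  have hnorm : ∀ {k} (_ : k ∈ N.group s l) f, AEMeasurable (fun ω => ‖D.bs k f ω‖ ^ (-N.α)) Pr :=
    fun hk f => ((hD.measurable_bs hs hk f).norm.pow_const _).aemeasurable
  refine AEMeasurable.div ((hg.const_mul _).mul (hx.norm.pow_const _).aemeasurable)
    (AEMeasurable.add_const (AEMeasurable.add ?_ ?_) _)
  · refine AEMeasurable.tsum fun f => ?_
    have h1 : AEMeasurable (fun ω => N.PS * D.gain l s f ω * ‖D.bs s f ω‖ ^ (-N.α)) Pr :=
      ((hD.gain_law l s hsg f).aemeasurable.const_mul _).mul (hnorm hsg f)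
    have hset : MeasurableSet {ω | f = D.serving ω}ᶜ :=
      (measurableSet_eq_fun measurable_const hj).compl
    refine (h1.indicator hset).congr (ae_of_all _ fun ω => ?_)
    by_cases h : f = D.serving ω <;> simp [h]
  · refine Finset.aemeasurable_fun_sum _ fun b hb => AEMeasurable.tsum fun f => ?_
    have hbg := Finset.mem_of_mem_erase hb
    exact ((hD.power_law l b hb f).aemeasurable_fst.mul
      (hD.gain_law l b hbg f).aemeasurable).mul (hnorm hbg f)

/-- A divergent real series has the default value zero while the extended sum is infinite. The two
agree because the terms are almost surely nonnegative and the interference almost surely finite. -/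
lemma ae_sum_tsum_eq_toReal (hD : D.IsModel Pr) (l : Fin (N.numBands s)) :
    ∀ᵐ ω ∂Pr, ∑ b ∈ (N.group s l).erase s,
      ∑' f, D.buyerPower l b f ω * D.gain l b f ω * ‖D.bs b f ω‖ ^ (-N.α) =
        (D.buyerInterference l ω).toReal := by
  have h1 : ∀ᵐ ω ∂Pr, ∀ b ∈ (N.group s l).erase s, D.shotNoise l b ω ≠ ∞ :=
    (Finset.eventually_all _).2 fun b hb => hD.ae_shotNoise_ne_top hs hb
  have h2 : ∀ᵐ ω ∂Pr, ∀ b ∈ (N.group s l).erase s, ∀ f, 0 ≤ D.buyerPower l b f ω ∧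
      0 ≤ D.gain l b f ω := (Finset.eventually_all _).2 fun b hb => ae_all_iff.2 fun f =>
    (hD.ae_buyerPower_nonneg hs hb f).and
      (ae_nonneg_of_hasLaw (hD.gain_law l b (Finset.mem_of_mem_erase hb) f))
  filter_upwards [h1, h2] with ω hω1 hω2
  rw [buyerInterference, ENNReal.toReal_sum hω1]
  refine Finset.sum_congr rfl fun b hb => ?_
  rw [shotNoise, ENNReal.tsum_toReal_eq fun f => ENNReal.ofReal_ne_top]
  refine tsum_congr fun f => ?_
  have h3 := (hω2 b hb f).1
  have h4 := (hω2 b hb f).2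
  rw [txPower_buyer hb, ENNReal.toReal_ofReal (by positivity)]

lemma ae_sinr_nonneg (hD : D.IsModel Pr) (l : Fin (N.numBands s)) : ∀ᵐ ω ∂Pr, 0 ≤ D.sinr l ω := by
  have hsg := N.seller_mem_group s hs l
  have hPS := N.PS_pos
  filter_upwards [hD.ae_sum_tsum_eq_toReal hs l,
    ae_all_iff.2 fun f => ae_nonneg_of_hasLaw (hD.gain_law l s hsg f)] with ω hω hg
  rw [sinr, interference, hω]
  have h1 : 0 ≤ ∑' f, if f = D.serving ω then 0 else
      N.PS * D.gain l s f ω * ‖D.bs s f ω‖ ^ (-N.α) := tsum_nonneg fun f => by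
    have := hg f
    split_ifs <;> positivity
  have h2 := ENNReal.toReal_nonneg (a := D.buyerInterference l ω)
  have h3 := hg (D.serving ω)
  positivity

/-- The coverage probability. -/
theorem measure_lt_sinr (hD : D.IsModel Pr) (l : Fin (N.numBands s)) {β : ℝ} (hβ : 0 < β) :
    Pr {ω | β < D.sinr l ω} = ∫⁻ z in Ioi 0,
      ENNReal.ofReal (coverageIntegrand N s l (D.powerMoment Pr l) β z) := by
  have hsg := N.seller_mem_group s hs l
  have hsm := Finset.mem_union_left N.buyers hs
  have hb : 0 ≤ ∑ b ∈ (N.group s l).erase s, N.bsIntensity b := Finset.sum_nonneg fun b hb =>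
    (N.bsIntensity_pos b (Finset.mem_union_right _ (N.group_subset s hs l hb))).le
  have hM := hD.powerMoment_nonneg hs l
  have hρ := rhoInf_nonneg N.α
  have hXG : IndepFun (fun ω n => D.bs s n ω) (fun ω n => D.gain l s n ω) Pr :=
    (hD.bs_indep_marks l s hsg).comp (φ := id) (ψ := fun (q : ℕ → ℝ × ℝ) n => (q n).1)
      measurable_id (measurable_pi_lambda _ fun n => (measurable_pi_apply n).fst)
  have key := SpectrumSharing.measure_lt_sinr (N.bsIntensity_pos s hsm) (hD.bs_ppp s hsm)
    (hD.gain_law l s hsg)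
    ((hD.marks_indep l s hsg).comp (fun _ q => q.1) fun _ => measurable_fst)
    hXG
    (hD.aemeasurable_buyerInterference hs l) (hD.indepFun_buyerInterference hs l) N.PS_pos
    N.two_lt_α hβ (C := Real.pi * (∑ b ∈ (N.group s l).erase s, N.bsIntensity b) *
        D.powerMoment Pr l * rhoInf N.α) (by positivity) (sq_nonneg N.σ)
    (hD.ae_buyerInterference_ne_top hs l)
    (fun κ hκ => hD.lintegral_expNeg_mul_buyerInterference hs l hκ)
  have h1 : Pr {ω | β < D.sinr l ω} = _ := (measure_congr (by
    filter_upwards [hD.ae_sum_tsum_eq_toReal hs l] with ω hω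
    refine propext ?_
    change β < D.sinr l ω ↔ _
    rw [sinr, interference, hω]
    exact Iff.rfl)).trans key
  rw [h1]
  refine lintegral_congr fun z => ?_
  rw [coverageIntegrand, laplaceInterference]
  congr 5
  ring

theorem lintegral_log_one_add_sinr (hD : D.IsModel Pr) (l : Fin (N.numBands s)) :
    ∫⁻ ω, ENNReal.ofReal (Real.log (1 + D.sinr l ω)) ∂Pr =
      ∫⁻ t in Ioi 0, ∫⁻ z in Ioi 0,
        ENNReal.ofReal (coverageIntegrand N s l (D.powerMoment Pr l) (Real.exp t - 1) z) := by
  have hm := hD.aemeasurable_sinr hs l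
  have h0 := hD.ae_sinr_nonneg hs l
  rw [lintegral_eq_lintegral_meas_lt Pr (f := fun ω => Real.log (1 + D.sinr l ω)) ?_
    (Real.measurable_log.comp_aemeasurable (hm.const_add 1))]
  · refine setLIntegral_congr_fun measurableSet_Ioi fun t (ht : 0 < t) => ?_
    have hβ : 0 < Real.exp t - 1 := by simpa using ht
    rw [← hD.measure_lt_sinr hs l hβ]
    refine measure_congr ?_
    filter_upwards [h0] with ω hω
    refine propext ?_
    change t < Real.log (1 + D.sinr l ω) ↔ Real.exp t - 1 < D.sinr l ω
    rw [Real.lt_log_iff_exp_lt (by linarith), sub_lt_iff_lt_add']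
  · filter_upwards [h0] with ω hω
    exact Real.log_nonneg (by linarith)

/-- Up to `t = 1` the inner integral is a probability; beyond, it is bounded by a multiple of
`e^{-2t/α}`. -/
lemma lintegral_lintegral_coverageIntegrand_ne_top (hD : D.IsModel Pr) (l : Fin (N.numBands s)) :
    ∫⁻ t in Ioi 0, ∫⁻ z in Ioi 0,
      ENNReal.ofReal (coverageIntegrand N s l (D.powerMoment Pr l) (Real.exp t - 1) z) ≠ ∞ := by
  have hα := N.two_lt_α
  have hM := hD.powerMoment_nonneg hs l
  rw [← Ioc_union_Ioi_eq_Ioi (zero_le_one' ℝ), lintegral_union measurableSet_Ioi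
    (Ioc_disjoint_Ioi le_rfl), ENNReal.add_ne_top]
  constructor
  · refine ne_top_of_le_ne_top (b := ∫⁻ _ in Ioc (0 : ℝ) 1, 1) (by simp)
      (setLIntegral_mono measurable_const fun t ht => ?_)
    have hβ : 0 < Real.exp t - 1 := by simpa using ht.1
    rw [Ioc_union_Ioi_eq_Ioi (zero_le_one' ℝ), ← hD.measure_lt_sinr hs l hβ]
    exact prob_le_one
  · have hint : IntegrableOn (fun t => (1 + 2 ^ (N.α / 2)) * 2 ^ (2 / N.α) *
        Real.exp (-(2 / N.α) * t)) (Ioi 1) :=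
      (integrableOn_exp_mul_Ioi (neg_neg_of_pos (by positivity)) 1).const_mul _
    refine ne_top_of_le_ne_top hint.lintegral_lt_top.ne
      (setLIntegral_mono (by fun_prop) fun t (ht : 1 < t) => ?_)
    rw [Ioc_union_Ioi_eq_Ioi (zero_le_one' ℝ)]
    -- Gives both `e^t - 1 ≥ 1` and `e^t - 1 ≥ e^t / 2`.
    have he : 2 ≤ Real.exp t := by linarith [Real.add_one_le_exp t]
    refine (lintegral_coverageIntegrand_le hs l hM (by linarith)).trans
      (ENNReal.ofReal_le_ofReal ?_)
    rw [mul_assoc]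
    refine mul_le_mul_of_nonneg_left ?_ (by positivity)
    have h1 : (Real.exp t - 1) ^ (-(2 / N.α)) ≤ (Real.exp t / 2) ^ (-(2 / N.α)) :=
      Real.rpow_le_rpow_of_nonpos (by positivity) (by linarith)
        (by have : 0 < 2 / N.α := by positivity
            linarith)
    refine h1.trans_eq ?_
    rw [Real.div_rpow (Real.exp_pos t).le (by norm_num), ← Real.exp_mul,
      Real.rpow_neg (by norm_num : (0 : ℝ) ≤ 2), div_inv_eq_mul, mul_comm, mul_comm t]

lemma integrable_log_one_add_sinr (hD : D.IsModel Pr) (l : Fin (N.numBands s)) :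
    Integrable (fun ω => Real.log (1 + D.sinr l ω)) Pr := by
  refine ⟨(Real.measurable_log.comp_aemeasurable
    ((hD.aemeasurable_sinr hs l).const_add 1)).aestronglyMeasurable, ?_⟩
  rw [hasFiniteIntegral_iff_ofReal, hD.lintegral_log_one_add_sinr hs l]
  · exact (hD.lintegral_lintegral_coverageIntegrand_ne_top hs l).lt_top
  · filter_upwards [hD.ae_sinr_nonneg hs l] with ω hω
    exact Real.log_nonneg (by linarith)

omit [IsProbabilityMeasure Pr] hs in
lemma lintegral_coverageIntegrand_prod (D : Downlink N s Ω) (Pr : Measure Ω)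
    (l : Fin (N.numBands s)) :
    ∫⁻ q in Ioi (0 : ℝ) ×ˢ Ioi (0 : ℝ), ENNReal.ofReal
        (coverageIntegrand N s l (D.powerMoment Pr l) (Real.exp q.1 - 1) q.2) =
      ∫⁻ t in Ioi 0, ∫⁻ z in Ioi 0,
        ENNReal.ofReal (coverageIntegrand N s l (D.powerMoment Pr l) (Real.exp t - 1) z) := by
  rw [Measure.volume_eq_prod, ← Measure.prod_restrict, lintegral_prod]
  exact (measurable_coverageIntegrand l _).ennreal_ofReal.aemeasurable

lemma integrableOn_coverageIntegrand (hD : D.IsModel Pr) (l : Fin (N.numBands s)) :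
    IntegrableOn (fun q : ℝ × ℝ =>
      coverageIntegrand N s l (D.powerMoment Pr l) (Real.exp q.1 - 1) q.2) (Ioi 0 ×ˢ Ioi 0) := by
  refine ⟨(measurable_coverageIntegrand l _).aestronglyMeasurable, ?_⟩
  rw [hasFiniteIntegral_iff_ofReal (ae_of_all _ fun q => coverageIntegrand_nonneg hs l _ _ _),
    lintegral_coverageIntegrand_prod]
  exact (hD.lintegral_lintegral_coverageIntegrand_ne_top hs l).lt_top

lemma integral_log_one_add_sinr (hD : D.IsModel Pr) (l : Fin (N.numBands s)) :
    ∫ ω, Real.log (1 + D.sinr l ω) ∂Pr = ∫ t in Ioi 0, ∫ z in Ioi 0,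
      coverageIntegrand N s l (D.powerMoment Pr l) (Real.exp t - 1) z := by
  have hint := hD.integrableOn_coverageIntegrand hs l
  rw [Measure.volume_eq_prod] at hint
  rw [← setIntegral_prod _ hint, ← Measure.volume_eq_prod, integral_eq_lintegral_of_nonneg_ae _
    (hD.integrable_log_one_add_sinr hs l).aestronglyMeasurable, integral_eq_lintegral_of_nonneg_ae
    (ae_of_all _ fun q => coverageIntegrand_nonneg hs l _ _ _)
    (measurable_coverageIntegrand l _).aestronglyMeasurable, hD.lintegral_log_one_add_sinr hs l,
    lintegral_coverageIntegrand_prod]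
  filter_upwards [hD.ae_sinr_nonneg hs l] with ω hω
  exact Real.log_nonneg (by linarith)

omit [IsProbabilityMeasure Pr] hs in
lemma aemeasurable_buyerPowers (hD : D.IsModel Pr) (l : Fin (N.numBands s)) :
    AEMeasurable (D.buyerPowers l) Pr :=
  aemeasurable_pi_iff.2 fun b => aemeasurable_pi_iff.2 fun f =>
    (hD.power_law l b.1 b.2 f).aemeasurable_fst

/-- Composing the law of the powers with the conditional law recovers the joint law of powers and
SINR, so integrability transfers from `Ω`. -/
lemma integrable_log_compProd (hD : D.IsModel Pr) (l : Fin (N.numBands s)) :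
    Integrable (fun q : ({b // b ∈ (N.group s l).erase s} → ℕ → ℝ) × ℝ => Real.log (1 + q.2))
      (Pr.map (D.buyerPowers l) ⊗ₘ D.sinrLaw Pr l) := by
  have hm : Measurable fun q : ({b // b ∈ (N.group s l).erase s} → ℕ → ℝ) × ℝ =>
    Real.log (1 + q.2) := by fun_prop
  rw [sinrLaw, compProd_map_condDistrib (hD.aemeasurable_sinr hs l), integrable_map_measure
    hm.aestronglyMeasurable ((hD.aemeasurable_buyerPowers l).prodMk (hD.aemeasurable_sinr hs l))]
  exact hD.integrable_log_one_add_sinr hs l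

lemma integral_sinrLaw (hD : D.IsModel Pr) (l : Fin (N.numBands s)) :
    ∫ p, (∫ γ, Real.log (1 + γ) ∂(D.sinrLaw Pr l p)) ∂(Pr.map (D.buyerPowers l)) =
      ∫ ω, Real.log (1 + D.sinr l ω) ∂Pr := by
  have hm : Measurable fun q : ({b // b ∈ (N.group s l).erase s} → ℕ → ℝ) × ℝ =>
    Real.log (1 + q.2) := by fun_prop
  have : IsMarkovKernel (D.sinrLaw Pr l) := by unfold sinrLaw; infer_instance
  have h := Measure.integral_compProd (hD.integrable_log_compProd hs l)
  rw [← h, sinrLaw, compProd_map_condDistrib (hD.aemeasurable_sinr hs l), integral_map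
    ((hD.aemeasurable_buyerPowers l).prodMk (hD.aemeasurable_sinr hs l)) hm.aestronglyMeasurable]

/-- Nonnegativity of the SINR and integrability hold under almost every conditional law, so the tail
formula applies to each of these laws separately. -/
lemma integral_sinrLaw_eq_integral_measure_lt (hD : D.IsModel Pr) (l : Fin (N.numBands s)) :
    ∫ p, (∫ γ, Real.log (1 + γ) ∂(D.sinrLaw Pr l p)) ∂(Pr.map (D.buyerPowers l)) =
      ∫ p, (∫ t in Ioi (0 : ℝ), (D.sinrLaw Pr l p).real {γ | t < Real.log (1 + γ)})
        ∂(Pr.map (D.buyerPowers l)) := by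
  have : IsMarkovKernel (D.sinrLaw Pr l) := by unfold sinrLaw; infer_instance
  have hpair := (hD.aemeasurable_buyerPowers l).prodMk (hD.aemeasurable_sinr hs l)
  have h1 : ∀ᵐ q ∂(Pr.map (D.buyerPowers l) ⊗ₘ D.sinrLaw Pr l), 0 ≤ q.2 := by
    rw [sinrLaw, compProd_map_condDistrib (hD.aemeasurable_sinr hs l), ae_map_iff hpair
      (p := fun q => 0 ≤ q.2) (measurableSet_le measurable_const measurable_snd)]
    exact hD.ae_sinr_nonneg hs l
  have h2 := ((Measure.integrable_compProd_iff
    (hD.integrable_log_compProd hs l).aestronglyMeasurable).1 (hD.integrable_log_compProd hs l)).1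
  refine integral_congr_ae ?_
  filter_upwards [Measure.ae_ae_of_ae_compProd h1, h2] with p hp hint
  refine Integrable.integral_eq_integral_meas_lt hint ?_
  filter_upwards [hp] with γ hγ
  exact Real.log_nonneg (by linarith)

end IsModel
end Downlink
end SpectrumSharing

theorem theorem4 {O : Type*} [DecidableEq O] (N : SpectrumSharing.Network O)
    (s : O) (hs : s ∈ N.sellers)
    {Ω : Type*} [MeasurableSpace Ω] (Pr : MeasureTheory.Measure Ω)
    [MeasureTheory.IsProbabilityMeasure Pr]
    (D : SpectrumSharing.Downlink N s Ω) (hD : D.IsModel Pr) :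
    -- all the expectations and integrals below converge
    (∀ l, Integrable (fun ω => D.allowedPower l ω ^ (2 / N.α)) Pr ∧
      Integrable (fun ω => Real.log (1 + D.sinr l ω)) Pr ∧
      IntegrableOn (fun q : ℝ × ℝ =>
        SpectrumSharing.coverageIntegrand N s l (D.powerMoment Pr l) (Real.exp q.1 - 1) q.2)
        (Ioi 0 ×ˢ Ioi 0)) ∧
    D.averageRate Pr =
      ∑ l, ∫ p, (∫ t in Ioi (0 : ℝ), (D.sinrLaw Pr l p).real {γ | t < Real.log (1 + γ)})
        ∂(Pr.map (D.buyerPowers l)) ∧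
    D.averageRate Pr =
      ∑ l, ∫ t in Ioi (0 : ℝ), ∫ z in Ioi (0 : ℝ),
        SpectrumSharing.coverageIntegrand N s l (D.powerMoment Pr l) (Real.exp t - 1) z := by
  refine ⟨fun l => ⟨hD.integrable_allowedPower_rpow hs l, hD.integrable_log_one_add_sinr hs l,
    hD.integrableOn_coverageIntegrand hs l⟩, ?_, ?_⟩
  · exact Finset.sum_congr rfl fun l _ => hD.integral_sinrLaw_eq_integral_measure_lt hs l
  · exact Finset.sum_congr rfl fun l _ =>
      (hD.integral_sinrLaw hs l).trans (hD.integral_log_one_add_sinr hs l)
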